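/- **Setting.** Let $T>0$, let $F$ and $Z$ be Hausdorff first countable topological spaces, $X=F\times Z$ with the product topology, and $x_o=(\varphi_o,z_o)\in X$. Let $\tilde d:Z\times Z\to[0,\infty]$ be lower semicontinuous with $\tilde d(z,z)=0$, $\tilde d(z_o,z)<\infty$, $\tilde d(z,z'')\le\tilde d(z,z')+\tilde d(z',z'')$, and suppose that $\tilde d$ separates $Z$: $\tilde d(z,z')=0\Rightarrow z=z'$. Put $d((\varphi,z),(\varphi',z'))=\tilde d(z,z')$. Let $\mathcal E,\mathcal P:[0,T]\times X\to\mathbb R$, $F_o\ge 0$, $C_P>0$, and $\mathcal F(t,x)=\mathcal E(t,x)+d(x_o,x)+F_o$. Assume: (A1) for every $C\in\mathbb R$ the sublevel $\{(t,x)\in[0,T]\times X:\mathcal F(t,x)\le C\}$ is sequentially compact, and $\mathcal E$ is lower semicontinuous on it; (A2′) if $x_n\to x$ and $\sup_n\mathcal F(0,x_n)<\infty$, then $d(x_n,v)\to d(x,v)$ for all $v\in X$; for all $(t,x)\in[0,T]\times X$, $|\mathcal P(t,x)|\le C_P\mathcal F(t,x)$ and $$\liminf_{s\uparrow t}\frac{\mathcal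 E(t,x)-\mathcal E(s,x)}{t-s}\ \ge\ \mathcal P(t,x)\ \ge\ \limsup_{s\downarrow t}\frac{\mathcal E(s,x)-\mathcal E(t,x)}{s-t}$$ (only the meaningful inequality at $t=0$ and $t=T$); and if $(t_n,x_n)\to(t,x)$ in $[0,T]\times X$ and $\mathcal E(t_n,x_n)\to\mathcal E(t,x)$, then $\limsup_n\mathcal P(t_n,x_n)\le\mathcal P(t,x)$. Let $\tilde\delta=h(\tilde d)$, where $h:[0,\infty)\to[0,\infty)$ is continuous and nondecreasing with $\lim_{r\downarrow0}h(r)/r=0$, and $h(\infty):=\sup h$. Put $\tilde D=\tilde d+\tilde\delta$, $$\Phi(t,z)=\operatorname{argmin}_F\mathcal E(t,\cdot,z),\quad \tilde{\mathcal E}(t,z)=\min_{\varphi\in F}\mathcal E(t,\varphi,z),\quad \tilde{\mathcal P}(t,z)=\max_{\varphi\in\Phi(t,z)}\mathcal P(t,\varphi,z).$$ **Visco-energetic solutions.** $\operatorname{Var}(u,A)$ is the supremum of $\sum_j\tilde d(u(t_{j-1}),u(t_j))$ over finite increasing families $(t_j)$ in $A\subset\mathbb R$. A curve $u:[0,T]\to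 Z$ belongs to $BV_{\sigma,\tilde d}([0,T];Z)$ if $\operatorname{Var}(u,[0,T])<\infty$, at every $t$ the one-sided limits $u(t\pm)$ exist ($u(0-):=u(0)$, $u(T+):=u(T)$), $\tilde d(u(s),u(t-))\to0$ as $s\uparrow t$, $\tilde d(u(t+),u(s))\to0$ as $s\downarrow t$, and $\tilde d(u(t-),u(t))=0\Rightarrow u(t-)=u(t)$, $\tilde d(u(t),u(t+))=0\Rightarrow u(t)=u(t+)$. Its jump set is $J_u=\{t:u(t-)\ne u(t)\text{ or }u(t)\ne u(t+)\}$. Let $\mathcal R(t,z)=\sup_{y\in Z}\{\tilde{\mathcal E}(t,z)-\tilde{\mathcal E}(t,y)-\tilde D(z,y)\}$. For a nonempty compact $A\subset\mathbb R$ with minimum $A^-$ and maximum $A^+$, and $\vartheta:A\to Z$, $$\operatorname{Trc}(t,\vartheta,A)=\operatorname{Var}(\vartheta,A)+\sum_{I}\tilde\delta(\vartheta(I^-),\vartheta(I^+))+\sum_{s\in A\setminus\{A^+\}}\mathcal R(t,\vartheta(s)),$$ where $I=(I^-,I^+)$ runs over the connected components of $[A^-,A^+]\setminus A$. Let $\tilde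 c(t,z_0,z_1)$ be the infimum of $\operatorname{Trc}(t,\vartheta,A)$ over all such $A$ and all continuous $\vartheta:A\to Z$ with $\vartheta(A^-)=z_0$, $\vartheta(A^+)=z_1$ such that for every $\varepsilon>0$ there is $\eta>0$ with $\tilde d(\vartheta(r),\vartheta(s))\le\varepsilon$ whenever $r,s\in A$, $r\le s\le r+\eta$. With $\Delta=\tilde c-\tilde d$, for $0\le a<b\le T$, $$\operatorname{mVar}(u,[a,b])=\operatorname{Var}(u,[a,b])+\Delta(a,u(a),u(a+))+\Delta(b,u(b-),u(b))+\sum_{t\in J_u\cap(a,b)}\big(\Delta(t,u(t-),u(t))+\Delta(t,u(t),u(t+))\big),$$ and $\operatorname{mVar}(u,[a,a])=0$. A VE solution of the reduced system $(Z,\tilde{\mathcal E},\tilde d,\tilde\delta)$ is a curve $u\in BV_{\sigma,\tilde d}([0,T];Z)$ such that $\tilde{\mathcal E}(t,u(t))\le\tilde{\mathcal E}(t,y)+\tilde D(u(t),y)$ for all $y\in Z$ and $t\in[0,T]\setminus J_u$, $s\mapsto\tilde{\mathcal P}(s,u(s))$ is Lebesgue integrable on $[0,T]$, and $$\tilde{\mathcal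 E}(t,u(t))+\operatorname{mVar}(u,[0,t])=\tilde{\mathcal E}(0,u(0))+\int_0^t\tilde{\mathcal P}(s,u(s))\,ds\qquad\text{for all }t\in[0,T].$$ **Theorem.** The minimum and the maximum defining $\tilde{\mathcal E}$ and $\tilde{\mathcal P}$ are attained, and for every $z_0\in Z$ there is a VE solution $z$ of $(Z,\tilde{\mathcal E},\tilde d,\tilde\delta)$ with $z(0)=z_0$. Moreover, a curve $z:[0,T]\to Z$ is such a VE solution (with some initial datum) if and only if $z\in BV_{\sigma,\tilde d}([0,T];Z)$ and there is a map $\varphi:[0,T]\to F$, which is Lebesgue measurable (preimages of Borel sets are Lebesgue measurable) if $F$ is Souslin (a continuous image of a Polish space), such that $\varphi(t)\in\Phi(t,z(t))$ for all $t\in[0,T]$; $$\mathcal E(t,\varphi(t),z(t))\le\mathcal E(t,\varphi',z')+\tilde d(z(t),z')+\tilde\delta(z(t),z')\quad\text{for all }t\in[0,T]\setminus J_z,\ (\varphi',z')\in X;$$ $r\mapsto\mathcal P(r,\varphi(r),z(r))$ is Lebesgue integrable on $[0,T]$; and for all $0\le s\le t\le T$ $$\mathcal E(t,\varphi(t),z(t))+\operatorname{mVar}(z,[s,t])=\mathcal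 E(s,\varphi(s),z(s))+\int_s^t\mathcal P(r,\varphi(r),z(r))\,dr.$$ -/

import Mathlib

open Set Filter Topology MeasureTheory
open scoped NNReal ENNReal

/-! Rate-independent systems `(X, E, d)` on a topological space `X` and a time interval `[0, T]`.
Energies, powers and curves are functions of a real time variable; only their values at times in
`[0, T]` are ever used. -/

namespace VE

section General

variable {X : Type*} [TopologicalSpace X]

/-- A lower semicontinuous asymmetric quasi-distance with values in `[0, ∞]`, finite from the
reference point `x₀`. -/
structure IsQuasiDistance (d : X → X → ℝ≥0∞) (x₀ : X) : Prop where
  lsc : LowerSemicontinuous fun p : X × X => d p.1 p.2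
  self_eq_zero : ∀ x, d x x = 0
  finite_from : ∀ x, d x₀ x ≠ ⊤
  triangle : ∀ x y z, d x z ≤ d x y + d y z

/-- `d` separates the points of the whole space. -/
def Separates (d : X → X → ℝ≥0∞) : Prop := ∀ x y, d x y = 0 → x = y

/-- The perturbed functional `E(t,x) + d(x₀,x) + F₀`. -/
noncomputable def perturbedEnergy (x₀ : X) (F₀ : ℝ) (d : X → X → ℝ≥0∞) (E : ℝ → X → ℝ)
    (t : ℝ) (x : X) : ℝ :=
  E t x + (d x₀ x).toReal + F₀

/-- The sublevel `{(t,x) ∈ [0,T] × X : E(t,x) + d(x₀,x) + F₀ ≤ C}`. -/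
def sublevel (T : ℝ) (x₀ : X) (F₀ : ℝ) (d : X → X → ℝ≥0∞) (E : ℝ → X → ℝ) (C : ℝ) :
    Set (ℝ × X) :=
  {p | p.1 ∈ Icc 0 T ∧ perturbedEnergy x₀ F₀ d E p.1 p.2 ≤ C}

/-- Lower semicontinuity of the energy on the sublevels, and their sequential compactness. -/
structure LscCompact (T : ℝ) (x₀ : X) (F₀ : ℝ) (d : X → X → ℝ≥0∞) (E : ℝ → X → ℝ) : Prop where
  lsc : ∀ C, LowerSemicontinuousOn (fun p : ℝ × X => E p.1 p.2) (sublevel T x₀ F₀ d E C)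
  compact : ∀ C, IsSeqCompact (sublevel T x₀ F₀ d E C)

/-- Power control with left-continuity of `d` on the sublevels of `F(0,·)`. At the end points of
`[0, T]` only the one-sided condition that makes sense is imposed (the filters below are trivial
for the other one). -/
structure PowerControl (T : ℝ) (x₀ : X) (F₀ C_P : ℝ) (d : X → X → ℝ≥0∞) (E P : ℝ → X → ℝ) :
    Prop where
  left_continuous : ∀ (C : ℝ) (x : ℕ → X) (y : X),
    (∀ n, perturbedEnergy x₀ F₀ d E 0 (x n) ≤ C) → Tendsto x atTop (𝓝 y) →
      ∀ v, Tendsto (fun n => d (x n) v) atTop (𝓝 (d y v))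
  left_quotient : ∀ t ∈ Icc 0 T, ∀ x,
    (P t x : EReal) ≤
      liminf (fun s => (((E t x - E s x) / (t - s) : ℝ) : EReal)) (𝓝[Ico 0 t] t)
  right_quotient : ∀ t ∈ Icc 0 T, ∀ x,
    limsup (fun s => (((E s x - E t x) / (s - t) : ℝ) : EReal)) (𝓝[Ioc t T] t) ≤ (P t x : EReal)
  bound : ∀ t ∈ Icc 0 T, ∀ x, |P t x| ≤ C_P * perturbedEnergy x₀ F₀ d E t x
  conditional_usc : ∀ (s : ℕ → ℝ) (x : ℕ → X) (t : ℝ) (y : X),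
    (∀ n, s n ∈ Icc 0 T) → t ∈ Icc 0 T → Tendsto s atTop (𝓝 t) → Tendsto x atTop (𝓝 y) →
    Tendsto (fun n => E (s n) (x n)) atTop (𝓝 (E t y)) →
      limsup (fun n => (P (s n) (x n) : EReal)) atTop ≤ (P t y : EReal)

/-- The correction `δ(x,y) = h(d(x,y))`, where `h` (nondecreasing on `[0,∞)`) is extended to `∞`
by `h(∞) = sup h`. -/
noncomputable def correction (h : ℝ≥0 → ℝ≥0) (d : X → X → ℝ≥0∞) (x y : X) : ℝ≥0∞ :=
  ⨆ (r : ℝ≥0) (_ : (r : ℝ≥0∞) ≤ d x y), (h r : ℝ≥0∞)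

/-- The pointwise total variation on `A ⊆ ℝ` of a curve `u` with respect to `d`. Repetitions in
the partition are harmless because `d x x = 0`. -/
noncomputable def variation (d : X → X → ℝ≥0∞) (u : ℝ → X) (A : Set ℝ) : ℝ≥0∞ :=
  ⨆ (n : ℕ) (τ : {τ : ℕ → ℝ // Monotone τ ∧ ∀ i, τ i ∈ A}),
    ∑ i ∈ Finset.range n, d (u (τ.1 i)) (u (τ.1 (i + 1)))

open Classical in
/-- The left limit `u(t-)` of a curve on `[0,T]`, with the convention `u(0-) = u(0)`. -/
noncomputable def leftLimit (u : ℝ → X) (t : ℝ) : X :=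
  if h : 0 < t ∧ ∃ l, Tendsto u (𝓝[<] t) (𝓝 l) then h.2.choose else u t

open Classical in
/-- The right limit `u(t+)` of a curve on `[0,T]`, with the convention `u(T+) = u(T)`. -/
noncomputable def rightLimit (T : ℝ) (u : ℝ → X) (t : ℝ) : X :=
  if h : t < T ∧ ∃ l, Tendsto u (𝓝[>] t) (𝓝 l) then h.2.choose else u t

/-- `(σ,d)`-regulated curves on `[0,T]`. -/
structure IsRegulated (T : ℝ) (d : X → X → ℝ≥0∞) (u : ℝ → X) : Prop where
  left_lim : ∀ t ∈ Ioc 0 T, Tendsto u (𝓝[<] t) (𝓝 (leftLimit u t)) ∧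
    Tendsto (fun s => d (u s) (leftLimit u t)) (𝓝[<] t) (𝓝 0)
  right_lim : ∀ t ∈ Ico 0 T, Tendsto u (𝓝[>] t) (𝓝 (rightLimit T u t)) ∧
    Tendsto (fun s => d (rightLimit T u t) (u s)) (𝓝[>] t) (𝓝 0)
  left_eq : ∀ t ∈ Icc 0 T, d (leftLimit u t) (u t) = 0 → leftLimit u t = u t
  right_eq : ∀ t ∈ Icc 0 T, d (u t) (rightLimit T u t) = 0 → u t = rightLimit T u t

/-- The space of `(σ,d)`-regulated curves on `[0,T]` with finite total variation. -/
structure IsBV (T : ℝ) (d : X → X → ℝ≥0∞) (u : ℝ → X) : Prop where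
  regulated : IsRegulated T d u
  finite_variation : variation d u (Icc 0 T) ≠ ⊤

/-- The jump set of a curve on `[0,T]`. -/
def jumpSet (T : ℝ) (u : ℝ → X) : Set ℝ :=
  {t | t ∈ Icc 0 T ∧ (leftLimit u t ≠ u t ∨ u t ≠ rightLimit T u t)}

/-- The residual stability function `sup_y (E(t,x) - E(t,y) - D(x,y))`, `D = d + δ`. It is
nonnegative (take `y = x`), so each term may be replaced by its positive part, which is what the
truncated operations of `[0,∞]` compute. -/
noncomputable def residual (E : ℝ → X → ℝ) (d δ : X → X → ℝ≥0∞) (t : ℝ) (x : X) : ℝ≥0∞ :=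
  ⨆ y, (ENNReal.ofReal (E t x - E t y) - (d x y + δ x y))

/-- The holes of a compact set `A ⊆ ℝ`: the connected components `(a,b)` of
`[min A, max A] \ A`, given by their end points. -/
def holes (A : Set ℝ) : Set (ℝ × ℝ) :=
  {I | I.1 ∈ A ∧ I.2 ∈ A ∧ I.1 < I.2 ∧ Disjoint (Ioo I.1 I.2) A}

/-- The transition cost of `θ : A → X` at time `t`: total variation, plus `δ` across the holes,
plus the sum of the residuals over `A \ {max A}`. -/
noncomputable def transitionCost (E : ℝ → X → ℝ) (d δ : X → X → ℝ≥0∞) (t : ℝ) (θ : ℝ → X)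
    (A : Set ℝ) : ℝ≥0∞ :=
  variation d θ A + ∑' I : holes A, δ (θ I.1.1) (θ I.1.2)
    + ∑' s : (A \ {sSup A} : Set ℝ), residual E d δ t (θ s)

/-- `θ` is a transition from `x` to `y` with compact parameter set `A`: it is continuous on `A`,
it satisfies the one-sided uniform `d`-continuity, and it has the prescribed end points. -/
structure IsTransition (d : X → X → ℝ≥0∞) (A : Set ℝ) (θ : ℝ → X) (x y : X) : Prop where
  nonempty : A.Nonempty
  compact : IsCompact A
  continuous : ContinuousOn θ A
  d_continuous : ∀ ε : ℝ≥0∞, 0 < ε → ∃ η : ℝ, 0 < η ∧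
    ∀ r ∈ A, ∀ s ∈ A, r ≤ s → s ≤ r + η → d (θ r) (θ s) ≤ ε
  start : θ (sInf A) = x
  finish : θ (sSup A) = y

/-- The jump dissipation cost `c(t,x,y)`. -/
noncomputable def jumpCost (E : ℝ → X → ℝ) (d δ : X → X → ℝ≥0∞) (t : ℝ) (x y : X) : ℝ≥0∞ :=
  ⨅ (A : Set ℝ) (θ : ℝ → X) (_ : IsTransition d A θ x y), transitionCost E d δ t θ A

/-- The incremental cost `c(t,x,y) - d(x,y)`. -/
noncomputable def incrementalCost (E : ℝ → X → ℝ) (d δ : X → X → ℝ≥0∞) (t : ℝ) (x y : X) :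
    ℝ≥0∞ :=
  jumpCost E d δ t x y - d x y

open Classical in
/-- The incremental jump variation of `u` on `[a,b] ⊆ [0,T]`; it vanishes on a one-point
interval. -/
noncomputable def jumpVariation (T : ℝ) (E : ℝ → X → ℝ) (d δ : X → X → ℝ≥0∞) (u : ℝ → X)
    (a b : ℝ) : ℝ≥0∞ :=
  if a < b then
    incrementalCost E d δ a (u a) (rightLimit T u a)
      + incrementalCost E d δ b (leftLimit u b) (u b)
      + ∑' t : (jumpSet T u ∩ Ioo a b : Set ℝ),
          (incrementalCost E d δ t (leftLimit u t) (u t)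
            + incrementalCost E d δ t (u t) (rightLimit T u t))
  else 0

/-- The augmented total variation of `u` on `[a,b] ⊆ [0,T]`. -/
noncomputable def augmentedVariation (T : ℝ) (E : ℝ → X → ℝ) (d δ : X → X → ℝ≥0∞) (u : ℝ → X)
    (a b : ℝ) : ℝ≥0∞ :=
  variation d u (Icc a b) + jumpVariation T E d δ u a b

/-- Visco-energetic solutions of the rate-independent system `(X, E, d, δ)` with power `P`. The
balance is an identity in `[-∞,∞]` with real right-hand side, so it contains the finiteness of
the augmented total variation. -/
structure IsVESolution (T : ℝ) (E P : ℝ → X → ℝ) (d δ : X → X → ℝ≥0∞) (u : ℝ → X) : Prop where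
  bv : IsBV T d u
  stable : ∀ t ∈ Icc 0 T \ jumpSet T u, ∀ y,
    (E t (u t) : EReal) ≤ (E t y : EReal) + ((d (u t) y + δ (u t) y : ℝ≥0∞) : EReal)
  integrable : IntegrableOn (fun s => P s (u s)) (Icc 0 T)
  balance : ∀ t ∈ Icc 0 T,
    (E t (u t) : EReal) + (augmentedVariation T E d δ u 0 t : EReal)
      = ((E 0 (u 0) + ∫ s in (0 : ℝ)..t, P s (u s) : ℝ) : EReal)

end General

section Marginal

variable {F Z : Type*}

/-- The set `Φ(t,z)` of minimizers of `E(t,·,z)`. -/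
def minimizers (E : ℝ → F × Z → ℝ) (t : ℝ) (z : Z) : Set F :=
  {φ | ∀ φ', E t (φ, z) ≤ E t (φ', z)}

/-- The marginal energy `min_φ E(t,φ,z)`. -/
noncomputable def marginalEnergy (E : ℝ → F × Z → ℝ) (t : ℝ) (z : Z) : ℝ :=
  ⨅ φ, E t (φ, z)

/-- The marginal power `max {P(t,φ,z) : φ ∈ Φ(t,z)}`. -/
noncomputable def marginalPower (E P : ℝ → F × Z → ℝ) (t : ℝ) (z : Z) : ℝ :=
  sSup ((fun φ => P t (φ, z)) '' minimizers E t z)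

/-- The quasi-distance on `F × Z` which only sees the `Z`-component. -/
def liftDist (d : Z → Z → ℝ≥0∞) (x y : F × Z) : ℝ≥0∞ := d x.2 y.2

/-- The pair `(φ, z)` is a curve of minimizers over a `(σ,d)`-regulated curve `z` of finite
variation which satisfies the stability condition and the energy balance on all subintervals; the
augmented variation of `z` is the one of the reduced system. The selection `φ` is Lebesgue
measurable (for the Borel σ-algebra of `F`) as soon as `F` is a Souslin space. -/
structure IsSelectedSolution [TopologicalSpace F] [MeasurableSpace F] [TopologicalSpace Z] (T : ℝ)
    (E P : ℝ → F × Z → ℝ) (d δ : Z → Z → ℝ≥0∞) (φ : ℝ → F) (z : ℝ → Z) : Prop where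
  bv : IsBV T d z
  measurable : AnalyticSet (univ : Set F) → NullMeasurable φ (volume.restrict (Icc 0 T))
  minimizer : ∀ t ∈ Icc 0 T, φ t ∈ minimizers E t (z t)
  stable : ∀ t ∈ Icc 0 T \ jumpSet T z, ∀ φ' z',
    (E t (φ t, z t) : EReal) ≤
      (E t (φ', z') : EReal) + ((d (z t) z' + δ (z t) z' : ℝ≥0∞) : EReal)
  integrable : IntegrableOn (fun r => P r (φ r, z r)) (Icc 0 T)
  balance : ∀ s ∈ Icc 0 T, ∀ t ∈ Icc 0 T, s ≤ t →
    (E t (φ t, z t) : EReal) + (augmentedVariation T (marginalEnergy E) d δ z s t : EReal)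
      = ((E s (φ s, z s) + ∫ r in s..t, P r (φ r, z r) : ℝ) : EReal)

end Marginal

end VE

/-!
The theorem has three parts: the partial minimization over `F` turns the system into one of the same
kind on `Z`, such a system has a visco-energetic solution for every initial state, and the solutions
of the reduced system are those that lift to a selection of minimizers.

*Existence.* Incremental minimization of `E(t, ·) + d(x, ·) + δ(x, ·)` on uniform time grids
(`IsPreSystem.exists_scheme`) is parametrized by the elapsed time plus the energy released by the
minimization steps. An increment of this parameter dominates the elapsed time plus the distance, the
correction and the residual of the step (`IsScheme`). The parameter stays in a bounded interval, so
a diagonal argument (`exists_limit_chain`) gives, for vanishing mesh, a compact set `A` of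
parameters and a continuous curve `θ = (time, state)` on it (`IsSystem.exists_limitCurve`). The part
of `A` that lies over one time `r` is a transition at time `r`: its holes are limits of single
minimization steps. Hence its cost is at most its length (`IsLimitCurve.jumpCost_le`), and jumps of
the limit are paid by the energy released in them.

As a function of time, the limit `IsLimitCurve.curve` takes the state at the first parameter over
each time. It is left-continuous, and its augmented variation up to `r` is at most the parameter of
entry minus `r` (`IsLimitCurve.augmentedVariation_le`). Nodes that converge to such a first
parameter have predecessors with the same limit, since no hole over time `r` ends there. Therefore
the energies converge and the limit is stable (`IsLimitCurve.tendsto_energy_node`), and the discrete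
balance passes to the limit by a reverse Fatou lemma for the powers
(`IsLimitCurve.energy_add_entry_le`). The opposite inequality rests on stability and left continuity
of the curve: from the left, stability bounds the loss of energy by the distance up to a factor `1 + ε`; at
a jump to the right, the released energy is at most the cost of the jump
(`IsPreSystem.ofReal_energy_sub_le_jumpCost`). A real induction combines the two
(`IsLimitCurve.energy_le_energy_add`), and the two estimates give the energy balance.

*Reduction.* Minimizers over a sublevel are sequentially compact. This gives the attainment of the
minimum and of the maximum, and it transfers compactness, lower semicontinuity and the conditional
upper semicontinuity of the power to the marginal energy and power (`IsPreSystem.marginal`).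

*Equivalence.* From a reduced solution, one selects minimizers of maximal power. When `F` is
Souslin, countably many open sets that separate the points of `F` generate its Borel sets
(`exists_separating_open_seq`), so that shrinking by their closed complements, whenever possible,
gives a measurable selection (`exists_measurable_selection`); the measurability of the multifunction
follows from upper semicontinuity (`IsPreSystem.measurableSet_maximalMinimizers`). Additivity of the
augmented variation (`augmentedVariation_add`) extends the balance to all pairs of times.
Conversely, the power of any selection is at most the marginal power. Where the primitive of the
power and the variation of the curve are differentiable, the stability at earlier times and the
balance give the reverse inequality (`IsPreSystem.ae_power_eq`), so the two powers agree almost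
everywhere.
-/

namespace VE

/-! ### Real induction and extraction of subsequences -/

/-- Real induction along a compact set: a function that does not exceed its value at `t` just to
the left of `t`, and that is lower semicontinuous from the right, takes a larger value at the
maximum than at the minimum. If `t` is isolated from the left in `A`, the first condition
only concerns the preceding point `s₀` of `A`. -/
theorem le_of_forall_left_of_forall_right {A : Set ℝ} (hA : IsClosed A) {a b : ℝ}
    (ha : IsLeast A a) (hb : IsGreatest A b) {f : ℝ → ℝ}
    (hl : ∀ t ∈ A, a < t → ∃ s₀ ∈ A, s₀ < t ∧ ∀ s ∈ A, s₀ ≤ s → s < t → f s ≤ f t)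
    (hr : ∀ t ∈ A, t < b → ∀ η > 0, ∃ s₁ > t, ∀ s ∈ A, t < s → s < s₁ → f t - η ≤ f s) :
    f a ≤ f b := by
  set S : Set ℝ := {s ∈ A | ∀ s' ∈ A, s ≤ s' → f s' ≤ f b} with hS
  have hbS : b ∈ S := ⟨hb.1, fun s' hs' h => by rw [le_antisymm (hb.2 hs') h]⟩
  have hbdd : BddBelow S := ⟨a, fun s hs => ha.2 hs.1⟩
  set σ := sInf S with hσ
  have hσA : σ ∈ A := by
    have : σ ∈ closure S := csInf_mem_closure ⟨b, hbS⟩ hbdd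
    exact hA.closure_subset_iff.2 (fun s hs => hs.1) this
  have hgt : ∀ s' ∈ A, σ < s' → f s' ≤ f b := by
    intro s' hs' h
    obtain ⟨s, hs, hlt⟩ := exists_lt_of_csInf_lt ⟨b, hbS⟩ h
    exact hs.2 s' hs' hlt.le
  have hσS : σ ∈ S := by
    by_contra hn
    have hσb : σ < b := lt_of_le_of_ne (csInf_le hbdd hbS) (fun h => hn (h ▸ hbS))
    apply hn
    refine ⟨hσA, fun s' hs' h => ?_⟩
    rcases h.lt_or_eq with h | h
    · exact hgt s' hs' h
    · subst h
      refine le_of_forall_pos_le_add fun η hη => ?_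
      obtain ⟨s₁, hs₁, H⟩ := hr σ hσA hσb η hη
      obtain ⟨s, hs, hlt⟩ := exists_lt_of_csInf_lt ⟨b, hbS⟩ hs₁
      have hσs : σ < s := lt_of_le_of_ne (csInf_le hbdd hs) (fun h => hn (h ▸ hs))
      linarith [H s hs.1 hσs hlt, hs.2 s hs.1 le_rfl]
  rcases (ha.2 hσA).lt_or_eq with h | h
  · obtain ⟨s₀, hs₀, hlt, H⟩ := hl σ hσA h
    have : s₀ ∈ S := by
      refine ⟨hs₀, fun s' hs' h' => ?_⟩
      rcases le_or_gt σ s' with h'' | h''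
      · exact hσS.2 s' hs' h''
      · exact (H s' hs' h' h'').trans (hσS.2 σ hσA le_rfl)
    exact absurd (csInf_le hbdd this) (not_le.2 hlt)
  · exact h ▸ hσS.2 σ hσA le_rfl

theorem le_of_eventually_left_of_eventually_right {a b : ℝ} (hab : a ≤ b) {f : ℝ → ℝ}
    (hl : ∀ t ∈ Ioc a b, ∀ᶠ s in 𝓝[<] t, f s ≤ f t)
    (hr : ∀ t ∈ Ico a b, ∀ η > 0, ∀ᶠ s in 𝓝[>] t, f t - η ≤ f s) : f a ≤ f b := by
  refine le_of_forall_left_of_forall_right isClosed_Icc (isLeast_Icc hab) (isGreatest_Icc hab)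
    ?_ ?_
  · intro t ht hat
    obtain ⟨l, hl', H⟩ := mem_nhdsLT_iff_exists_Ioo_subset.1 (hl t ⟨hat, ht.2⟩)
    have hlt : l < t := hl'
    refine ⟨max a ((l + t) / 2), ⟨le_max_left _ _, ?_⟩, ?_, ?_⟩
    · exact max_le hab (by linarith [ht.2])
    · exact max_lt hat (by linarith)
    · intro s _ h1 h2
      exact H ⟨by linarith [le_max_right a ((l + t) / 2)], h2⟩
  · intro t ht htb η hη
    obtain ⟨l, hl', H⟩ := mem_nhdsGT_iff_exists_Ioo_subset.1 (hr t ⟨ht.1, htb⟩ η hη)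
    exact ⟨l, hl', fun s _ h1 h2 => H ⟨h1, h2⟩⟩

/-- The reflection `t ↦ -t` of `le_of_eventually_left_of_eventually_right`. -/
theorem le_of_eventually_right_of_eventually_left {a b : ℝ} (hab : a ≤ b) {f : ℝ → ℝ}
    (hr : ∀ t ∈ Ico a b, ∀ᶠ s in 𝓝[>] t, f s ≤ f t)
    (hl : ∀ t ∈ Ioc a b, ∀ η > 0, ∀ᶠ s in 𝓝[<] t, f t - η ≤ f s) : f b ≤ f a := by
  have h1 : ∀ t : ℝ, Tendsto (fun s : ℝ => -s) (𝓝[<] t) (𝓝[>] (-t)) := fun t =>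
    tendsto_neg_nhdsLT
  have h2 : ∀ t : ℝ, Tendsto (fun s : ℝ => -s) (𝓝[>] t) (𝓝[<] (-t)) := fun t =>
    tendsto_neg_nhdsGT
  have := le_of_eventually_left_of_eventually_right (f := fun s => f (-s)) (neg_le_neg hab)
    (fun t ht => (h1 t).eventually (hr (-t) ⟨by linarith [ht.2], by linarith [ht.1]⟩))
    (fun t ht η hη => (h2 t).eventually (hl (-t) ⟨by linarith [ht.2], by linarith [ht.1]⟩ η hη))
  simpa using this

/-- Diagonal extraction: countably many sequences in a sequentially compact set converge along a
common subsequence. -/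
theorem exists_common_subseq {Y : Type*} [TopologicalSpace Y] {K : Set Y} (hK : IsSeqCompact K)
    (x : ℕ → ℕ → Y) (hx : ∀ q n, x q n ∈ K) :
    ∃ φ : ℕ → ℕ, StrictMono φ ∧ ∀ q, ∃ l ∈ K, Tendsto (fun n => x q (φ n)) atTop (𝓝 l) := by
  have key : ∀ (q : ℕ) (ψ : ℕ → ℕ), ∃ χ : ℕ → ℕ, StrictMono χ ∧
      ∃ l ∈ K, Tendsto (fun n => x q (ψ (χ n))) atTop (𝓝 l) := by
    intro q ψ
    obtain ⟨l, hl, χ, hχ, hlim⟩ := hK (fun n => hx q (ψ n))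
    exact ⟨χ, hχ, l, hl, hlim⟩
  choose χ hχ hlim using key
  let ψ : ℕ → ℕ → ℕ := fun q => Nat.rec id (fun q ψ => ψ ∘ χ q ψ) q
  have hψ1 : ∀ q, ψ (q + 1) = ψ q ∘ χ q (ψ q) := fun q => rfl
  have hψm : ∀ q, StrictMono (ψ q) := by
    intro q
    induction q with
    | zero => exact strictMono_id
    | succ q ih => rw [hψ1]; exact ih.comp (hχ _ _)
  have hψle : ∀ q k, ∃ ρ : ℕ → ℕ, StrictMono ρ ∧ ψ (q + k) = ψ q ∘ ρ := by
    intro q k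
    induction k with
    | zero => exact ⟨id, strictMono_id, rfl⟩
    | succ k ih =>
      obtain ⟨ρ, hρ, e⟩ := ih
      refine ⟨ρ ∘ χ (q + k) (ψ (q + k)), hρ.comp (hχ _ _), ?_⟩
      rw [← add_assoc, hψ1]
      conv_lhs => rw [e]
      rw [e]; rfl
  refine ⟨fun n => ψ n n, ?_, ?_⟩
  · refine strictMono_nat_of_lt_succ fun n => ?_
    rw [hψ1]
    exact (hψm n) (lt_of_lt_of_le (Nat.lt_succ_self n) ((hχ n (ψ n)).le_apply))
  · intro q
    obtain ⟨l, hl, hlim'⟩ := hlim q (ψ q)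
    refine ⟨l, hl, ?_⟩
    choose! ρ hρ e using hψle (q + 1)
    have h1 : Tendsto (fun n => ρ (n - (q + 1)) n) atTop atTop :=
      tendsto_atTop_mono (fun n => (hρ _).le_apply) tendsto_id
    refine (hlim'.comp h1).congr' ?_
    filter_upwards [eventually_ge_atTop (q + 1)] with n hn
    have := e (n - (q + 1))
    rw [Nat.add_sub_cancel' hn] at this
    simp only [Function.comp]
    rw [this]
    simp [hψ1]

/-! ### Variation -/

section Variation

variable {X : Type*} {d : X → X → ℝ≥0∞} {u : ℝ → X}

theorem variation_le {A : Set ℝ} {C : ℝ≥0∞}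
    (h : ∀ (n : ℕ) (τ : ℕ → ℝ), Monotone τ → (∀ i, τ i ∈ A) →
      ∑ i ∈ Finset.range n, d (u (τ i)) (u (τ (i + 1))) ≤ C) : variation d u A ≤ C :=
  iSup_le fun n => iSup_le fun τ => h n τ.1 τ.2.1 τ.2.2

theorem sum_le_variation {A : Set ℝ} (n : ℕ) {τ : ℕ → ℝ} (hτ : Monotone τ) (hA : ∀ i, τ i ∈ A) :
    ∑ i ∈ Finset.range n, d (u (τ i)) (u (τ (i + 1))) ≤ variation d u A :=
  le_iSup_of_le n (le_iSup_of_le (⟨τ, hτ, hA⟩ : {τ : ℕ → ℝ // Monotone τ ∧ ∀ i, τ i ∈ A}) le_rfl)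

theorem variation_mono {A B : Set ℝ} (h : A ⊆ B) : variation d u A ≤ variation d u B :=
  variation_le fun n _ hτ hA => sum_le_variation n hτ fun i => h (hA i)

theorem dist_le_variation {A : Set ℝ} {r s : ℝ} (hr : r ∈ A) (hs : s ∈ A) (h : r ≤ s) :
    d (u r) (u s) ≤ variation d u A := by
  have := sum_le_variation (d := d) (u := u) (A := A) 1 (τ := fun i => if i = 0 then r else s)
    (by
      intro i j hij
      by_cases hi : i = 0 <;> by_cases hj : j = 0 <;> simp [hi, hj, h]
      omega)
    (by intro i; by_cases hi : i = 0 <;> simp [hi, hr, hs])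
  simpa using this

/-- Superadditivity of the variation over sets that follow one another. -/
theorem variation_add_le {A B C : Set ℝ} (hB : B ⊆ A) (hC : C ⊆ A)
    (hBC : ∀ x ∈ B, ∀ y ∈ C, x ≤ y) : variation d u B + variation d u C ≤ variation d u A := by
  rcases B.eq_empty_or_nonempty with rfl | ⟨b₀, hb₀⟩
  · have : variation d u ∅ ≤ 0 := variation_le fun n τ _ h => absurd (h 0) (by simp)
    rw [nonpos_iff_eq_zero.1 this, zero_add]; exact variation_mono hC
  rcases C.eq_empty_or_nonempty with rfl | ⟨c₀, hc₀⟩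
  · have : variation d u ∅ ≤ 0 := variation_le fun n τ _ h => absurd (h 0) (by simp)
    rw [nonpos_iff_eq_zero.1 this, add_zero]; exact variation_mono hB
  have : Nonempty {τ : ℕ → ℝ // Monotone τ ∧ ∀ i, τ i ∈ B} :=
    ⟨⟨fun _ => b₀, monotone_const, fun _ => hb₀⟩⟩
  have : Nonempty {τ : ℕ → ℝ // Monotone τ ∧ ∀ i, τ i ∈ C} :=
    ⟨⟨fun _ => c₀, monotone_const, fun _ => hc₀⟩⟩
  refine ENNReal.iSup_add_iSup_le fun n m => ENNReal.iSup_add_iSup_le fun σ τ => ?_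
  have h := sum_le_variation (d := d) (u := u) (A := A) (n + 1 + m)
    (τ := fun i => if i ≤ n then σ.1 i else τ.1 (i - (n + 1)))
    (by
      intro i j hij
      dsimp only
      split_ifs with h1 h2 h2
      · exact σ.2.1 hij
      · exact hBC _ (σ.2.2 _) _ (τ.2.2 _)
      · omega
      · exact τ.2.1 (by omega))
    (by
      intro i
      split_ifs
      · exact hB (σ.2.2 _)
      · exact hC (τ.2.2 _))
  refine le_trans ?_ h
  rw [Finset.sum_range_add, Finset.sum_range_succ]
  refine add_le_add (le_trans (le_of_eq ?_) (le_self_add)) (le_of_eq ?_)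
  · refine Finset.sum_congr rfl fun i hi => ?_
    have := Finset.mem_range.1 hi
    rw [if_pos (by omega), if_pos (by omega)]
  · refine Finset.sum_congr rfl fun i hi => ?_
    rw [if_neg (by omega), if_neg (by omega), show n + 1 + i - (n + 1) = i by omega,
      show n + 1 + i + 1 - (n + 1) = i + 1 by omega]

theorem variation_le_add (htri : ∀ x y z, d x z ≤ d x y + d y z)
    {A : Set ℝ} {r : ℝ} (hr : r ∈ A) :
    variation d u A ≤ variation d u (A ∩ Iic r) + variation d u (A ∩ Ici r) := by
  refine variation_le fun n τ hτ hA => ?_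
  have h1 := sum_le_variation (d := d) (u := u) (A := A ∩ Iic r) n (τ := fun i => min (τ i) r)
    (fun i j hij => min_le_min_right _ (hτ hij))
    (fun i => ⟨by rcases min_choice (τ i) r with h | h <;> rw [h]; exacts [hA i, hr],
      mem_Iic.2 (min_le_right _ _)⟩)
  have h2 := sum_le_variation (d := d) (u := u) (A := A ∩ Ici r) n (τ := fun i => max (τ i) r)
    (fun i j hij => max_le_max_right _ (hτ hij))
    (fun i => ⟨by rcases max_choice (τ i) r with h | h <;> rw [h]; exacts [hA i, hr],
      mem_Ici.2 (le_max_right _ _)⟩)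
  refine le_trans ?_ (add_le_add h1 h2)
  rw [← Finset.sum_add_distrib]
  refine Finset.sum_le_sum fun i _ => ?_
  have hi := hτ (Nat.le_succ i)
  rcases le_total (τ (i + 1)) r with h | h
  · rw [min_eq_left h, min_eq_left (hi.trans h)]; exact le_self_add
  · rcases le_total (τ i) r with h' | h'
    · rw [min_eq_left h', min_eq_right h, max_eq_left h, max_eq_right h']; exact htri _ _ _
    · rw [max_eq_left h, max_eq_left h']; exact le_add_self

theorem variation_Icc_add (htri : ∀ x y z, d x z ≤ d x y + d y z)
    {a b c : ℝ} (hab : a ≤ b) (hbc : b ≤ c) :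
    variation d u (Icc a b) + variation d u (Icc b c) = variation d u (Icc a c) := by
  refine le_antisymm (variation_add_le (Icc_subset_Icc_right hbc) (Icc_subset_Icc_left hab)
    fun x hx y hy => hx.2.trans hy.1) ?_
  refine (variation_le_add htri (A := Icc a c) (r := b) ⟨hab, hbc⟩).trans (add_le_add ?_ ?_)
  · exact variation_mono fun x hx => ⟨hx.1.1, hx.2⟩
  · exact variation_mono fun x hx => ⟨hx.2, hx.1.2⟩

theorem variation_subsingleton (hself : ∀ x, d x x = 0) {A : Set ℝ} (hA : A.Subsingleton) :
    variation d u A = 0 := by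
  refine nonpos_iff_eq_zero.1 (variation_le fun n τ _ h => ?_)
  refine le_of_eq (Finset.sum_eq_zero fun i _ => ?_)
  rw [hA (h i) (h (i + 1)), hself]

/-- A bound on all pairs by increments of `W` is superadditive: the weights `g` of finitely many
points between `r` and `s` can be added to it. -/
theorem dist_add_sum_le_of_forall_lt (htri : ∀ x y z, d x z ≤ d x y + d y z)
    (hself : ∀ x, d x x = 0)
    {A : Set ℝ} {g : ℝ → ℝ≥0∞} {W : ℝ → ℝ} (hW : MonotoneOn W A)
    (h : ∀ r ∈ A, ∀ s ∈ A, r < s → d (u r) (u s) + g r ≤ ENNReal.ofReal (W s - W r)) :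
    ∀ (k : ℕ) (S : Finset ℝ), S.card = k → ∀ r ∈ A, ∀ s ∈ A, r ≤ s →
      (∀ x ∈ S, x ∈ A ∧ r ≤ x ∧ x < s) →
      d (u r) (u s) + ∑ x ∈ S, g x ≤ ENNReal.ofReal (W s - W r) := by
  intro k
  induction k with
  | zero =>
    intro S hS r hr s hs hrs _
    rw [Finset.card_eq_zero.1 hS]
    rcases hrs.lt_or_eq with hlt | rfl
    · simpa using le_trans le_self_add (h r hr s hs hlt)
    · simp [hself]
  | succ k ih =>
    intro S hS r hr s hs hrs hmem
    have hne : S.Nonempty := Finset.card_pos.1 (by omega)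
    set m := S.max' hne with hm
    have hmS : m ∈ S := S.max'_mem hne
    obtain ⟨hmA, hrm, hms⟩ := hmem m hmS
    have h1 := ih (S.erase m) (by rw [Finset.card_erase_of_mem hmS]; omega) r hr m hmA hrm
      (fun x hx => ⟨(hmem x (Finset.mem_of_mem_erase hx)).1,
        (hmem x (Finset.mem_of_mem_erase hx)).2.1,
        lt_of_le_of_ne (S.le_max' x (Finset.mem_of_mem_erase hx)) (Finset.ne_of_mem_erase hx)⟩)
    have h2 := h m hmA s hs hms
    rw [← Finset.add_sum_erase S g hmS]
    calc d (u r) (u s) + (g m + ∑ x ∈ S.erase m, g x)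
        ≤ (d (u r) (u m) + d (u m) (u s)) + (g m + ∑ x ∈ S.erase m, g x) :=
          add_le_add_left (htri _ _ _) _
      _ = (d (u r) (u m) + ∑ x ∈ S.erase m, g x) + (d (u m) (u s) + g m) := by ring
      _ ≤ _ := add_le_add h1 h2
      _ = ENNReal.ofReal (W s - W r) := by
        rw [← ENNReal.ofReal_add (sub_nonneg.2 (hW hr hmA hrm)) (sub_nonneg.2 (hW hmA hs hms.le))]
        congr 1; ring

/-- If each increment of `u` over `r < s`, together with a weight charged to its left end point
`r`, is controlled by the increment of `W`, then so is the total variation together with the sum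
of all the weights. -/
theorem variation_add_tsum_le (htri : ∀ x y z, d x z ≤ d x y + d y z)
    (hself : ∀ x, d x x = 0)
    {A : Set ℝ} {a b : ℝ} (ha : IsLeast A a) (hb : IsGreatest A b)
    {g : ℝ → ℝ≥0∞} {W : ℝ → ℝ} (hW : MonotoneOn W A)
    (h : ∀ r ∈ A, ∀ s ∈ A, r < s → d (u r) (u s) + g r ≤ ENNReal.ofReal (W s - W r)) :
    variation d u A + ∑' x : (A \ {b} : Set ℝ), g x ≤ ENNReal.ofReal (W b - W a) := by
  have key := dist_add_sum_le_of_forall_lt htri hself hW h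
  have part : ∀ (S : Finset ℝ) (τ : ℕ → ℝ), Monotone τ → (∀ i, τ i ∈ A) → ∀ n,
      (∀ x ∈ S, x ∈ A ∧ τ 0 ≤ x ∧ x < τ n) →
      ∑ i ∈ Finset.range n, d (u (τ i)) (u (τ (i + 1))) + ∑ x ∈ S, g x
        ≤ ENNReal.ofReal (W (τ n) - W (τ 0)) := by
    intro S τ hτ hA n
    induction n generalizing S with
    | zero =>
      intro hS
      have : S = ∅ := Finset.eq_empty_of_forall_notMem fun x hx =>
        absurd (hS x hx).2.1 (not_le.2 (hS x hx).2.2)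
      simp [this]
    | succ n ih =>
      intro hS
      have h1 := ih (S.filter (· < τ n)) (fun x hx => by
        rw [Finset.mem_filter] at hx
        exact ⟨(hS x hx.1).1, (hS x hx.1).2.1, hx.2⟩)
      have h2 := key _ (S.filter (¬ · < τ n)) rfl (τ n) (hA n) (τ (n + 1)) (hA _)
        (hτ (Nat.le_succ n)) (fun x hx => by
        rw [Finset.mem_filter, not_lt] at hx
        exact ⟨(hS x hx.1).1, hx.2, (hS x hx.1).2.2⟩)
      rw [Finset.sum_range_succ, ← Finset.sum_filter_add_sum_filter_not S (· < τ n) g]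
      calc _ = (∑ i ∈ Finset.range n, d (u (τ i)) (u (τ (i + 1)))
                + ∑ x ∈ S.filter (· < τ n), g x)
              + (d (u (τ n)) (u (τ (n + 1))) + ∑ x ∈ S.filter (¬ · < τ n), g x) := by ring
        _ ≤ _ := add_le_add h1 h2
        _ = _ := by
          rw [← ENNReal.ofReal_add (sub_nonneg.2 (hW (hA _) (hA _) (hτ (Nat.zero_le n))))
            (sub_nonneg.2 (hW (hA _) (hA _) (hτ (Nat.le_succ n))))]
          congr 1; ring
  rw [ENNReal.tsum_eq_iSup_sum]
  have : Nonempty {τ : ℕ → ℝ // Monotone τ ∧ ∀ i, τ i ∈ A} :=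
    ⟨⟨fun _ => a, monotone_const, fun _ => ha.1⟩⟩
  unfold variation
  rw [ENNReal.iSup_add]
  refine iSup_le fun n => ?_
  refine ENNReal.iSup_add_iSup_le fun σ S => ?_
  -- the partition is extended by the end points `a` and `b`
  have h1 := part (S.map (Function.Embedding.subtype _))
    (fun i => if i = 0 then a else if i ≤ n + 1 then σ.1 (i - 1) else b)
    (by
      intro i j hij
      dsimp only
      split_ifs with h1 h2 h3 h4 h5 h6
      · exact le_rfl
      · exact ha.2 (σ.2.2 _)
      · exact ha.2 hb.1
      · omega
      · exact σ.2.1 (by omega)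
      · exact hb.2 (σ.2.2 _)
      · omega
      · omega
      · exact le_rfl)
    (by
      intro i
      split_ifs
      exacts [ha.1, σ.2.2 _, hb.1]) (n + 2)
    (by
      intro x hx
      simp only [Finset.mem_map, Function.Embedding.subtype_apply] at hx
      obtain ⟨y, -, rfl⟩ := hx
      refine ⟨y.2.1, by simpa using ha.2 y.2.1, ?_⟩
      simpa using lt_of_le_of_ne (hb.2 y.2.1) y.2.2)
  simp only [Finset.sum_map, Function.Embedding.subtype_apply] at h1
  refine le_trans (add_le_add_left ?_ _) (h1.trans (le_of_eq (by simp)))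
  rw [show n + 2 = n + 1 + 1 from rfl, Finset.sum_range_succ, Finset.sum_range_succ']
  refine le_trans (le_trans (le_of_eq ?_) le_self_add) le_self_add
  refine Finset.sum_congr rfl fun i hi => ?_
  have := Finset.mem_range.1 hi
  simp only [Nat.add_eq_zero_iff, one_ne_zero, and_false, if_false]
  rw [if_pos (by omega), if_pos (by omega)]
  simp

end Variation

/-! ### Lower semicontinuous functions along sequences -/

theorem add_liminf_le_liminf_add {f g : ℕ → ℝ≥0∞} :
    liminf f atTop + liminf g atTop ≤ liminf (fun n => f n + g n) atTop := by
  rw [liminf_eq_iSup_iInf_of_nat, liminf_eq_iSup_iInf_of_nat, liminf_eq_iSup_iInf_of_nat,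
    ENNReal.iSup_add_iSup_of_monotone]
  · refine iSup_mono fun n => le_iInf fun i => le_iInf fun hi => ?_
    exact add_le_add (iInf_le_of_le i (iInf_le _ hi)) (iInf_le_of_le i (iInf_le _ hi))
  · exact fun n m hnm =>
      le_iInf fun i => le_iInf fun hi => iInf_le_of_le i (iInf_le _ (hnm.trans hi))
  · exact fun n m hnm =>
      le_iInf fun i => le_iInf fun hi => iInf_le_of_le i (iInf_le _ (hnm.trans hi))

section Lsc

variable {X ι : Type*} [TopologicalSpace X]

theorem le_liminf_of_tendsto {f : X → ℝ≥0∞} (hf : LowerSemicontinuous f) {l : Filter ι}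
    {x : ι → X} {y : X} (hx : Tendsto x l (𝓝 y)) : f y ≤ liminf (fun n => f (x n)) l := by
  refine le_of_forall_lt fun a ha => ?_
  obtain ⟨b, hab, hb⟩ := exists_between ha
  exact hab.trans_le (le_liminf_of_le (by isBoundedDefault)
    ((hx.eventually (hf y b hb)).mono fun n hn => hn.le))

theorem le_of_tendsto_of_lsc {f : X → ℝ≥0∞} (hf : LowerSemicontinuous f) {l : Filter ι} [l.NeBot]
    {x : ι → X} {y : X} (hx : Tendsto x l (𝓝 y)) {c : ι → ℝ≥0∞} {C : ℝ≥0∞}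
    (hc : Tendsto c l (𝓝 C)) (h : ∀ᶠ n in l, f (x n) ≤ c n) : f y ≤ C :=
  (le_liminf_of_tendsto hf hx).trans ((liminf_le_liminf h).trans hc.liminf_eq.le)

end Lsc

/-! ### The viscous correction -/

/-- The extension to `[0, ∞]` of a function `h` on `[0, ∞)`, with the value `sup h` at `∞`, in
the form in which it enters `correction`. -/
noncomputable def gauge (h : ℝ≥0 → ℝ≥0) (a : ℝ≥0∞) : ℝ≥0∞ :=
  ⨆ (r : ℝ≥0) (_ : (r : ℝ≥0∞) ≤ a), (h r : ℝ≥0∞)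

section Gauge

variable {h : ℝ≥0 → ℝ≥0}

theorem correction_eq {X : Type*} (h : ℝ≥0 → ℝ≥0) (d : X → X → ℝ≥0∞) (x y : X) :
    correction h d x y = gauge h (d x y) := rfl

theorem gauge_mono (h : ℝ≥0 → ℝ≥0) : Monotone (gauge h) := fun _ _ hab =>
  iSup_le fun r => iSup_le fun hr => le_iSup_of_le r (le_iSup_of_le (hr.trans hab) le_rfl)

theorem gauge_coe (h_mono : Monotone h) (r : ℝ≥0) : gauge h r = h r := by
  refine le_antisymm (iSup_le fun s => iSup_le fun hs => ?_) ?_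
  · exact_mod_cast h_mono (by exact_mod_cast hs)
  · exact le_iSup_of_le r (le_iSup_of_le le_rfl le_rfl)

theorem continuous_gauge (h_mono : Monotone h) (h_cont : Continuous h) :
    Continuous (gauge h) := by
  rw [continuous_iff_continuousAt]
  intro a
  induction a using ENNReal.recTopCoe with
  | top =>
    rw [ContinuousAt]
    refine tendsto_order.2 ⟨fun b hb => ?_, fun b hb => ?_⟩
    · obtain ⟨r, hr⟩ := lt_iSup_iff.1 hb
      obtain ⟨-, hr⟩ := lt_iSup_iff.1 hr
      filter_upwards [lt_mem_nhds (ENNReal.coe_lt_top (r := r))] with a ha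
      exact hr.trans_le (le_iSup_of_le r (le_iSup_of_le ha.le le_rfl))
    · exact Eventually.of_forall fun a => (gauge_mono h le_top).trans_lt hb
  | coe r =>
    rw [ContinuousAt, ENNReal.nhds_coe, tendsto_map'_iff]
    have : gauge h ∘ ((↑) : ℝ≥0 → ℝ≥0∞) = fun r => (h r : ℝ≥0∞) :=
      funext fun r => gauge_coe h_mono r
    rw [this, gauge_coe h_mono]
    exact (ENNReal.continuous_coe.comp h_cont).continuousAt

theorem gauge_zero (h_mono : Monotone h) (h_cont : Continuous h)
    (h_zero : Tendsto (fun r : ℝ≥0 => h r / r) (𝓝[>] 0) (𝓝 0)) : gauge h 0 = 0 := by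
  have h1 : Tendsto (fun r : ℝ≥0 => h r / r * r) (𝓝[>] 0) (𝓝 (0 * 0)) :=
    h_zero.mul (tendsto_id.mono_left nhdsWithin_le_nhds)
  have h2 : Tendsto h (𝓝[>] 0) (𝓝 (h 0)) := (h_cont.tendsto 0).mono_left nhdsWithin_le_nhds
  have h3 : h 0 = 0 := by
    have := tendsto_nhds_unique (h2.congr' (f₂ := fun r : ℝ≥0 => h r / r * r) (by
      filter_upwards [self_mem_nhdsWithin] with r hr
      rw [div_mul_cancel₀ _ (ne_of_gt hr)])) h1
    simpa using this
  have := gauge_coe h_mono 0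
  simpa [h3] using this

/-- The correction is superlinear at the origin. -/
theorem exists_gauge_le_mul (h_mono : Monotone h) (h_cont : Continuous h)
    (h_zero : Tendsto (fun r : ℝ≥0 => h r / r) (𝓝[>] 0) (𝓝 0)) {ε : ℝ≥0} (hε : 0 < ε) :
    ∀ᶠ a in 𝓝 (0 : ℝ≥0∞), gauge h a ≤ ε * a := by
  have h1 : ∀ᶠ r : ℝ≥0 in 𝓝[>] 0, h r / r < ε := h_zero.eventually (gt_mem_nhds hε)
  rw [← ENNReal.coe_zero, ENNReal.nhds_coe, eventually_map]
  rw [eventually_nhdsWithin_iff] at h1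
  filter_upwards [h1] with r hr
  rcases eq_or_lt_of_le (zero_le : 0 ≤ r) with h0 | h0
  · rw [← h0]; simp [gauge_zero h_mono h_cont h_zero]
  · rw [gauge_coe h_mono]
    have := (hr h0).le
    rw [div_le_iff₀ h0] at this
    exact_mod_cast this

end Gauge

/-! ### The standing assumptions -/

/-- A rate-independent system with a correction of the form `h(d)`: all the standing assumptions of
the visco-energetic theory for one space `Z`, except for the separation of points. It covers both
the system on `F × Z`, whose quasi-distance ignores the first factor, and its reduction to `Z`.
The conditional upper semicontinuity of the power is required on sublevels only: this is all that
the reduced power inherits, because the minimizers range in a compact set only on sublevels. -/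
structure IsPreSystem {Z : Type*} [TopologicalSpace Z] (T : ℝ) (z₀ : Z) (F₀ C_P : ℝ)
    (d : Z → Z → ℝ≥0∞) (E P : ℝ → Z → ℝ) (h : ℝ≥0 → ℝ≥0) : Prop where
  T_pos : 0 < T
  C_pos : 0 < C_P
  dist : IsQuasiDistance d z₀
  lscCompact : LscCompact T z₀ F₀ d E
  left_continuous : ∀ (C : ℝ) (x : ℕ → Z) (y : Z),
    (∀ n, perturbedEnergy z₀ F₀ d E 0 (x n) ≤ C) → Tendsto x atTop (𝓝 y) →
      ∀ v, Tendsto (fun n => d (x n) v) atTop (𝓝 (d y v))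
  eventually_left_quotient : ∀ {t : ℝ}, t ∈ Ioc 0 T → ∀ (x : Z) {c : ℝ}, c < P t x →
    ∀ᶠ s in 𝓝[<] t, c * (t - s) < E t x - E s x
  eventually_right_quotient : ∀ {t : ℝ}, t ∈ Ico 0 T → ∀ (x : Z) {c : ℝ}, P t x < c →
    ∀ᶠ s in 𝓝[>] t, E s x - E t x < c * (s - t)
  bound : ∀ t ∈ Icc 0 T, ∀ x, |P t x| ≤ C_P * perturbedEnergy z₀ F₀ d E t x
  eventually_power_lt : ∀ {C : ℝ} {p : ℕ → ℝ × Z} {q : ℝ × Z},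
    (∀ n, p n ∈ sublevel T z₀ F₀ d E C) → Tendsto p atTop (𝓝 q) →
    Tendsto (fun n => E (p n).1 (p n).2) atTop (𝓝 (E q.1 q.2)) →
      ∀ {c : ℝ}, P q.1 q.2 < c → ∀ᶠ n in atTop, P (p n).1 (p n).2 < c
  h_mono : Monotone h
  h_cont : Continuous h
  h_zero : Tendsto (fun r : ℝ≥0 => h r / r) (𝓝[>] 0) (𝓝 0)

/-- The assumptions on the power, in the form of `IsPreSystem`. -/
theorem IsPreSystem.of_powerControl {Z : Type*} [TopologicalSpace Z] {T : ℝ} {z₀ : Z}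
    {F₀ C_P : ℝ} {d : Z → Z → ℝ≥0∞} {E P : ℝ → Z → ℝ} {h : ℝ≥0 → ℝ≥0} (T_pos : 0 < T)
    (C_pos : 0 < C_P) (dist : IsQuasiDistance d z₀) (lscCompact : LscCompact T z₀ F₀ d E)
    (power : PowerControl T z₀ F₀ C_P d E P) (h_mono : Monotone h) (h_cont : Continuous h)
    (h_zero : Tendsto (fun r : ℝ≥0 => h r / r) (𝓝[>] 0) (𝓝 0)) :
    IsPreSystem T z₀ F₀ C_P d E P h where
  T_pos := T_pos
  C_pos := C_pos
  dist := dist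
  lscCompact := lscCompact
  left_continuous := power.left_continuous
  eventually_left_quotient := by
    intro t ht x c hc
    have h1 := power.left_quotient t ⟨ht.1.le, ht.2⟩ x
    have h2 := eventually_lt_of_lt_liminf (lt_of_lt_of_le (EReal.coe_lt_coe_iff.2 hc) h1)
    rw [nhdsWithin_Ico_eq_nhdsLT ht.1] at h2
    filter_upwards [h2, self_mem_nhdsWithin] with s hs hst
    have hst : 0 < t - s := sub_pos.2 hst
    rwa [EReal.coe_lt_coe_iff, lt_div_iff₀ hst] at hs
  eventually_right_quotient := by
    intro t ht x c hc
    have h1 := power.right_quotient t ⟨ht.1, ht.2.le⟩ x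
    have h2 := eventually_lt_of_limsup_lt (lt_of_le_of_lt h1 (EReal.coe_lt_coe_iff.2 hc))
    rw [nhdsWithin_Ioc_eq_nhdsGT ht.2] at h2
    filter_upwards [h2, self_mem_nhdsWithin] with s hs hst
    have hst : 0 < s - t := sub_pos.2 hst
    rwa [EReal.coe_lt_coe_iff, div_lt_iff₀ hst] at hs
  bound := power.bound
  eventually_power_lt := by
    intro C p q hp hpq hE c hc
    have h0 : q.1 ∈ Icc 0 T := isClosed_Icc.mem_of_tendsto
      ((continuous_fst.tendsto _).comp hpq) (Eventually.of_forall fun n => (hp n).1)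
    have h1 := power.conditional_usc (fun n => (p n).1) (fun n => (p n).2) q.1 q.2
      (fun n => (hp n).1) h0 ((continuous_fst.tendsto _).comp hpq)
      ((continuous_snd.tendsto _).comp hpq) hE
    have h2 := eventually_lt_of_limsup_lt (lt_of_le_of_lt h1 (EReal.coe_lt_coe_iff.2 hc))
    exact h2.mono fun n hn => EReal.coe_lt_coe_iff.1 hn
  h_mono := h_mono
  h_cont := h_cont
  h_zero := h_zero

/-- A rate-independent system whose quasi-distance separates the points of the space. -/
structure IsSystem {Z : Type*} [TopologicalSpace Z] (T : ℝ) (z₀ : Z) (F₀ C_P : ℝ)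
    (d : Z → Z → ℝ≥0∞) (E P : ℝ → Z → ℝ) (h : ℝ≥0 → ℝ≥0) : Prop
    extends IsPreSystem T z₀ F₀ C_P d E P h where
  sep : Separates d

namespace IsPreSystem

variable {Z : Type*} [TopologicalSpace Z] {T : ℝ} {z₀ : Z} {F₀ C_P : ℝ}
  {d : Z → Z → ℝ≥0∞} {E P : ℝ → Z → ℝ} {h : ℝ≥0 → ℝ≥0}

theorem correction_lsc (S : IsPreSystem T z₀ F₀ C_P d E P h) :
    LowerSemicontinuous fun p : Z × Z => correction h d p.1 p.2 :=
  (continuous_gauge S.h_mono S.h_cont).comp_lowerSemicontinuous S.dist.lsc (gauge_mono h)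

theorem correction_self (S : IsPreSystem T z₀ F₀ C_P d E P h) (x : Z) : correction h d x x = 0 := by
  rw [correction_eq, S.dist.self_eq_zero, gauge_zero S.h_mono S.h_cont S.h_zero]

theorem perturbedEnergy_nonneg (S : IsPreSystem T z₀ F₀ C_P d E P h) {t : ℝ} (ht : t ∈ Icc 0 T)
    (x : Z) : 0 ≤ perturbedEnergy z₀ F₀ d E t x := by
  have := (abs_nonneg _).trans (S.bound t ht x)
  exact nonneg_of_mul_nonneg_right this S.C_pos

theorem mem_sublevel_of_tendsto [T2Space Z] (S : IsPreSystem T z₀ F₀ C_P d E P h) {C : ℝ}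
    {p : ℕ → ℝ × Z} {q : ℝ × Z} (hp : ∀ n, p n ∈ sublevel T z₀ F₀ d E C)
    (hq : Tendsto p atTop (𝓝 q)) : q ∈ sublevel T z₀ F₀ d E C := by
  obtain ⟨l, hl, φ, hφ, hlim⟩ := S.lscCompact.compact C hp
  rwa [tendsto_nhds_unique (hq.comp hφ.tendsto_atTop) hlim]

theorem eventually_lt_energy [T2Space Z] (S : IsPreSystem T z₀ F₀ C_P d E P h) {C : ℝ}
    {p : ℕ → ℝ × Z} {q : ℝ × Z} (hp : ∀ n, p n ∈ sublevel T z₀ F₀ d E C)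
    (hq : Tendsto p atTop (𝓝 q)) {a : ℝ} (ha : a < E q.1 q.2) :
    ∀ᶠ n in atTop, a < E (p n).1 (p n).2 := by
  have h1 := S.lscCompact.lsc C q (S.mem_sublevel_of_tendsto hp hq) a ha
  exact (tendsto_nhdsWithin_iff.2 ⟨hq, Eventually.of_forall hp⟩).eventually h1

theorem energy_le_of_tendsto [T2Space Z] (S : IsPreSystem T z₀ F₀ C_P d E P h) {C : ℝ}
    {p : ℕ → ℝ × Z} {q : ℝ × Z} (hp : ∀ n, p n ∈ sublevel T z₀ F₀ d E C)
    (hq : Tendsto p atTop (𝓝 q)) {c : ℕ → ℝ} {B : ℝ} (hc : Tendsto c atTop (𝓝 B))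
    (hle : ∀ᶠ n in atTop, E (p n).1 (p n).2 ≤ c n) : E q.1 q.2 ≤ B := by
  refine le_of_forall_lt fun a ha => ?_
  obtain ⟨b, hab, hb⟩ := exists_between ha
  refine hab.trans_le (ge_of_tendsto hc ?_)
  filter_upwards [S.eventually_lt_energy hp hq hb, hle] with n h1 h2
  exact h1.le.trans h2

theorem exists_energy_lower_bound (S : IsPreSystem T z₀ F₀ C_P d E P h) (C : ℝ) :
    ∃ m, ∀ p ∈ sublevel T z₀ F₀ d E C, m ≤ E p.1 p.2 := by
  by_contra hcon
  push Not at hcon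
  choose p hp hlt using fun n : ℕ => hcon (-n)
  obtain ⟨l, hl, φ, hφ, hlim⟩ := S.lscCompact.compact C hp
  have h1 := S.lscCompact.lsc C l hl (E l.1 l.2 - 1) (by linarith)
  have h2 := (tendsto_nhdsWithin_iff.2 ⟨hlim, Eventually.of_forall fun n => hp (φ n)⟩).eventually h1
  have h3 : Tendsto (fun n => (φ n : ℝ)) atTop atTop :=
    tendsto_natCast_atTop_atTop.comp hφ.tendsto_atTop
  obtain ⟨n, h4, h5⟩ := (h2.and (h3.eventually_ge_atTop (1 - E l.1 l.2))).exists
  have := hlt (φ n)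
  simp only [Function.comp] at h4
  linarith

/-! ### Regularity of the energy in time -/

theorem eventually_sub_le_energy (S : IsPreSystem T z₀ F₀ C_P d E P h) {t : ℝ} (ht : t ∈ Icc 0 T)
    (x : Z) {η : ℝ} (hη : 0 < η) : ∀ᶠ s in 𝓝[Icc 0 T] t, E t x - η ≤ E s x := by
  set C := perturbedEnergy z₀ F₀ d E t x with hC
  have h1 := S.lscCompact.lsc C (t, x) ⟨ht, le_rfl⟩ (E t x - η) (by simpa using hη)
  have h2 : Tendsto (fun s => (s, x)) (𝓝[{s | (s, x) ∈ sublevel T z₀ F₀ d E C}] t)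
      (𝓝[sublevel T z₀ F₀ d E C] (t, x)) := by
    refine tendsto_nhdsWithin_iff.2 ⟨?_, ?_⟩
    · exact ((continuous_id.prodMk continuous_const).tendsto t).mono_left nhdsWithin_le_nhds
    · filter_upwards [self_mem_nhdsWithin] with s hs using hs
  have h3 := h2.eventually h1
  rw [eventually_nhdsWithin_iff] at h3 ⊢
  filter_upwards [h3] with s hs hsT
  by_cases hmem : (s, x) ∈ sublevel T z₀ F₀ d E C
  · exact (hs hmem).le
  · have : C < perturbedEnergy z₀ F₀ d E s x := by
      by_contra hle
      exact hmem ⟨hsT, not_lt.1 hle⟩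
    simp only [hC, perturbedEnergy] at this
    linarith

/-- The perturbed functional plus one (so that it is strictly positive) grows at most
exponentially, forward in time. -/
theorem growth_forward (S : IsPreSystem T z₀ F₀ C_P d E P h) (x : Z) {s t : ℝ} (hs : 0 ≤ s)
    (hst : s ≤ t) (ht : t ≤ T) :
    perturbedEnergy z₀ F₀ d E t x + 1 ≤
      (perturbedEnergy z₀ F₀ d E s x + 1) * Real.exp (C_P * (t - s)) := by
  set G : ℝ → ℝ := fun r => perturbedEnergy z₀ F₀ d E r x + 1 with hG
  have hGE : ∀ r r', G r - G r' = E r x - E r' x := fun r r' => by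
    simp only [hG, perturbedEnergy]; ring
  have hpos : ∀ r ∈ Icc s t, 0 < G r := fun r hr => by
    have := S.perturbedEnergy_nonneg ⟨hs.trans hr.1, hr.2.trans ht⟩ x
    simp only [hG]; linarith
  have key : G t * Real.exp (-(C_P * t)) ≤ G s * Real.exp (-(C_P * s)) := by
    refine le_of_eventually_right_of_eventually_left hst (f := fun r => G r * Real.exp (-(C_P * r)))
      (fun r hr => ?_) (fun r hr η hη => ?_)
    · have hr' : r ∈ Ico 0 T := ⟨hs.trans hr.1, hr.2.trans_le ht⟩
      have hc : P r x < C_P * G r := by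
        have h1 := (le_abs_self _).trans (S.bound r ⟨hr'.1, hr'.2.le⟩ x)
        have : C_P * G r = C_P * perturbedEnergy z₀ F₀ d E r x + C_P := by simp only [hG]; ring
        linarith [S.C_pos]
      filter_upwards [S.eventually_right_quotient hr' x hc, self_mem_nhdsWithin] with r' h1 hr'
      have hlt : r < r' := hr'
      rw [← hGE] at h1
      have h2 : G r' ≤ G r * Real.exp (C_P * (r' - r)) := by
        have := Real.add_one_le_exp (C_P * (r' - r))
        nlinarith [hpos r ⟨hr.1, hr.2.le⟩]
      calc G r' * Real.exp (-(C_P * r'))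
          ≤ G r * Real.exp (C_P * (r' - r)) * Real.exp (-(C_P * r')) :=
            mul_le_mul_of_nonneg_right h2 (Real.exp_pos _).le
        _ = G r * Real.exp (-(C_P * r)) := by
            rw [mul_assoc, ← Real.exp_add]; congr 2; ring
    · have hr' : r ∈ Icc 0 T := ⟨hs.trans hr.1.le, hr.2.trans ht⟩
      have h0 : 0 < G r := hpos r ⟨hr.1.le, hr.2⟩
      have hsub : 𝓝[<] r ≤ 𝓝[Icc 0 T] r := by
        rw [← nhdsWithin_Ico_eq_nhdsLT (lt_of_le_of_lt hs hr.1)]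
        exact nhdsWithin_mono _ fun y hy => ⟨hy.1, hy.2.le.trans hr'.2⟩
      have hcont : Tendsto (fun y : ℝ => (G r - η / 2) * Real.exp (-(C_P * y))) (𝓝[<] r)
          (𝓝 ((G r - η / 2) * Real.exp (-(C_P * r)))) := by
        refine Tendsto.mono_left (Continuous.tendsto ?_ r) nhdsWithin_le_nhds
        fun_prop
      have hexp : Real.exp (-(C_P * r)) ≤ 1 := by
        rw [Real.exp_le_one_iff]; nlinarith [S.C_pos, hr'.1]
      have hlt : G r * Real.exp (-(C_P * r)) - η < (G r - η / 2) * Real.exp (-(C_P * r)) := by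
        nlinarith [Real.exp_pos (-(C_P * r))]
      filter_upwards [hsub (S.eventually_sub_le_energy hr' x (half_pos hη)),
        hcont.eventually (lt_mem_nhds hlt)] with y h1 h2
      have h3 : G r - η / 2 ≤ G y := by have := hGE r y; linarith
      exact h2.le.trans (mul_le_mul_of_nonneg_right h3 (Real.exp_pos _).le)
  have h1 := mul_le_mul_of_nonneg_right key (Real.exp_pos (C_P * t)).le
  rw [mul_assoc, ← Real.exp_add, mul_assoc, ← Real.exp_add] at h1
  have e1 : -(C_P * t) + C_P * t = 0 := by ring
  have e2 : -(C_P * s) + C_P * t = C_P * (t - s) := by ring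
  rwa [e1, e2, Real.exp_zero, mul_one] at h1

/-- The growth estimate backwards in time: Gronwall's lemma for the left difference quotients, with
lower semicontinuity in time from the right. -/
theorem growth_backward (S : IsPreSystem T z₀ F₀ C_P d E P h) (x : Z) {s t : ℝ} (hs : 0 ≤ s)
    (hst : s ≤ t) (ht : t ≤ T) :
    perturbedEnergy z₀ F₀ d E s x + 1 ≤
      (perturbedEnergy z₀ F₀ d E t x + 1) * Real.exp (C_P * (t - s)) := by
  set G : ℝ → ℝ := fun r => perturbedEnergy z₀ F₀ d E r x + 1 with hG
  have hGE : ∀ r r', G r - G r' = E r x - E r' x := fun r r' => by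
    simp only [hG, perturbedEnergy]; ring
  have hpos : ∀ r ∈ Icc s t, 0 < G r := fun r hr => by
    have := S.perturbedEnergy_nonneg ⟨hs.trans hr.1, hr.2.trans ht⟩ x
    simp only [hG]; linarith
  have key : G s * Real.exp (C_P * s) ≤ G t * Real.exp (C_P * t) := by
    refine le_of_eventually_left_of_eventually_right hst (f := fun r => G r * Real.exp (C_P * r))
      (fun r hr => ?_) (fun r hr η hη => ?_)
    · have hr' : r ∈ Ioc 0 T := ⟨lt_of_le_of_lt hs hr.1, hr.2.trans ht⟩
      have hc : -(C_P * G r) < P r x := by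
        have h1 := (neg_le_abs _).trans (S.bound r ⟨hr'.1.le, hr'.2⟩ x)
        have : C_P * G r = C_P * perturbedEnergy z₀ F₀ d E r x + C_P := by simp only [hG]; ring
        linarith [S.C_pos]
      filter_upwards [S.eventually_left_quotient hr' x hc, self_mem_nhdsWithin] with r' h1 hr'
      have hlt : r' < r := hr'
      rw [← hGE] at h1
      have h2 : G r' ≤ G r * Real.exp (C_P * (r - r')) := by
        have := Real.add_one_le_exp (C_P * (r - r'))
        nlinarith [hpos r ⟨hr.1.le, hr.2⟩]
      calc G r' * Real.exp (C_P * r')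
          ≤ G r * Real.exp (C_P * (r - r')) * Real.exp (C_P * r') :=
            mul_le_mul_of_nonneg_right h2 (Real.exp_pos _).le
        _ = G r * Real.exp (C_P * r) := by
            rw [mul_assoc, ← Real.exp_add]; congr 2; ring
    · have hr' : r ∈ Icc 0 T := ⟨hs.trans hr.1, hr.2.le.trans ht⟩
      have h0 : 0 < G r := hpos r ⟨hr.1, hr.2.le⟩
      have hsub : 𝓝[>] r ≤ 𝓝[Icc 0 T] r := by
        rw [← nhdsWithin_Ioc_eq_nhdsGT (lt_of_lt_of_le hr.2 ht)]
        exact nhdsWithin_mono _ fun y hy => ⟨hr'.1.trans hy.1.le, hy.2⟩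
      set ρ := η * Real.exp (-(C_P * r)) with hρ
      have hρ0 : 0 < ρ := by positivity
      have hcont : Tendsto (fun y : ℝ => (G r - ρ / 2) * Real.exp (C_P * y)) (𝓝[>] r)
          (𝓝 ((G r - ρ / 2) * Real.exp (C_P * r))) := by
        refine Tendsto.mono_left (Continuous.tendsto ?_ r) nhdsWithin_le_nhds
        fun_prop
      have hlt : G r * Real.exp (C_P * r) - η < (G r - ρ / 2) * Real.exp (C_P * r) := by
        have : ρ * Real.exp (C_P * r) = η := by
          rw [hρ, mul_assoc, ← Real.exp_add]; simp
        nlinarith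
      filter_upwards [hsub (S.eventually_sub_le_energy hr' x (half_pos hρ0)),
        hcont.eventually (lt_mem_nhds hlt)] with y h1 h2
      have h3 : G r - ρ / 2 ≤ G y := by have := hGE r y; linarith
      exact h2.le.trans (mul_le_mul_of_nonneg_right h3 (Real.exp_pos _).le)
  have h1 := mul_le_mul_of_nonneg_right key (Real.exp_pos (-(C_P * s))).le
  rw [mul_assoc, ← Real.exp_add, mul_assoc, ← Real.exp_add] at h1
  have e1 : C_P * s + -(C_P * s) = 0 := by ring
  have e2 : C_P * t + -(C_P * s) = C_P * (t - s) := by ring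
  rwa [e1, e2, Real.exp_zero, mul_one] at h1

/-- The perturbed energy of a fixed state grows at most exponentially in time, in both directions.
-/
theorem growth (S : IsPreSystem T z₀ F₀ C_P d E P h) (x : Z) {s t : ℝ} (hs : s ∈ Icc 0 T)
    (ht : t ∈ Icc 0 T) :
    perturbedEnergy z₀ F₀ d E t x + 1 ≤
      (perturbedEnergy z₀ F₀ d E s x + 1) * Real.exp (C_P * |t - s|) := by
  rcases le_total s t with hst | hst
  · rw [abs_of_nonneg (sub_nonneg.2 hst)]; exact S.growth_forward x hs.1 hst ht.2
  · rw [abs_sub_comm, abs_of_nonneg (sub_nonneg.2 hst)]; exact S.growth_backward x ht.1 hst hs.2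

theorem perturbedEnergy_le_of_mem (S : IsPreSystem T z₀ F₀ C_P d E P h) {x : Z} {s t C : ℝ}
    (hs : (s, x) ∈ sublevel T z₀ F₀ d E C) (ht : t ∈ Icc 0 T) :
    perturbedEnergy z₀ F₀ d E t x + 1 ≤ (C + 1) * Real.exp (C_P * T) := by
  refine (S.growth x hs.1 ht).trans ?_
  have h0 := S.perturbedEnergy_nonneg hs.1 x
  have h1 : |t - s| ≤ T := by
    rw [abs_le]; constructor <;> linarith [hs.1.1, hs.1.2, ht.1, ht.2]
  have h2 := hs.2
  simp only at h0 h2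
  have h3 := S.C_pos.le
  have h4 : 0 ≤ C + 1 := by linarith
  gcongr

/-- The energies of the states of a sublevel are Lipschitz in time with a common constant. -/
theorem energy_sub_le (S : IsPreSystem T z₀ F₀ C_P d E P h) {C : ℝ} :
    ∃ L : ℝ≥0, ∀ x, (∃ r, (r, x) ∈ sublevel T z₀ F₀ d E C) →
      ∀ s ∈ Icc 0 T, ∀ t ∈ Icc 0 T, |E t x - E s x| ≤ L * |t - s| := by
  refine ⟨Real.toNNReal ((C + 1) * Real.exp (C_P * T) * C_P * Real.exp (C_P * T)),
    fun x ⟨r, hr⟩ => ?_⟩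
  have key : ∀ s ∈ Icc 0 T, ∀ t ∈ Icc 0 T, E t x - E s x ≤
      (C + 1) * Real.exp (C_P * T) * C_P * Real.exp (C_P * T) * |t - s| := by
    intro s hs t ht
    have h1 := S.growth x hs ht
    have h2 := S.perturbedEnergy_le_of_mem hr hs
    have h0 := S.perturbedEnergy_nonneg hs x
    have h3 : E t x - E s x =
        (perturbedEnergy z₀ F₀ d E t x + 1) - (perturbedEnergy z₀ F₀ d E s x + 1) := by
      simp only [perturbedEnergy]; ring
    set y := C_P * |t - s| with hy
    have hy0 : 0 ≤ y := mul_nonneg S.C_pos.le (abs_nonneg _)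
    have habs : |t - s| ≤ T := by
      rw [abs_le]; constructor <;> linarith [hs.1, hs.2, ht.1, ht.2]
    have h4 : Real.exp y - 1 ≤ y * Real.exp (C_P * T) := by
      have h5 := Real.add_one_le_exp (-y)
      have h6 : Real.exp y * Real.exp (-y) = 1 := by rw [← Real.exp_add]; simp
      have h7 : Real.exp y ≤ Real.exp (C_P * T) :=
        Real.exp_le_exp.2 (mul_le_mul_of_nonneg_left habs S.C_pos.le)
      nlinarith [Real.exp_pos y]
    rw [h3]
    calc _ ≤ (perturbedEnergy z₀ F₀ d E s x + 1) * (Real.exp y - 1) := by linarith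
      _ ≤ ((C + 1) * Real.exp (C_P * T)) * (y * Real.exp (C_P * T)) := by
        apply mul_le_mul h2 h4 _ (le_trans (by linarith) h2)
        linarith [Real.add_one_le_exp y]
      _ = _ := by rw [hy]; ring
  intro s hs t ht
  refine le_trans ?_ (mul_le_mul_of_nonneg_right (Real.le_coe_toNNReal _) (abs_nonneg _))
  rw [abs_le']
  refine ⟨key s hs t ht, ?_⟩
  have := key t ht s hs
  rw [abs_sub_comm] at this
  linarith

theorem energy_lipschitz (S : IsPreSystem T z₀ F₀ C_P d E P h) (x : Z) :
    ∃ L : ℝ≥0, LipschitzOnWith L (fun t => E t x) (Icc 0 T) := by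
  obtain ⟨L, hL⟩ := S.energy_sub_le (C := perturbedEnergy z₀ F₀ d E 0 x)
  refine ⟨L, LipschitzOnWith.of_dist_le_mul fun t ht s hs => ?_⟩
  rw [Real.dist_eq, Real.dist_eq]
  exact hL x ⟨0, ⟨le_rfl, S.T_pos.le⟩, le_rfl⟩ s hs t ht

theorem tendsto_energy_time (S : IsPreSystem T z₀ F₀ C_P d E P h) (x : Z) {ι : Type*} {l : Filter ι}
    {s : ι → ℝ} {t : ℝ} (hs : ∀ᶠ i in l, s i ∈ Icc 0 T) (ht : t ∈ Icc 0 T)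
    (hst : Tendsto s l (𝓝 t)) :
    Tendsto (fun i => E (s i) x) l (𝓝 (E t x)) := by
  obtain ⟨L, hL⟩ := S.energy_lipschitz x
  exact (hL.continuousOn t ht).tendsto.comp (tendsto_nhdsWithin_iff.2 ⟨hst, hs⟩)

/-- Wherever `E(·,x)` is differentiable, the two one-sided quotients squeeze the derivative to the
power. -/
theorem ae_deriv_energy (S : IsPreSystem T z₀ F₀ C_P d E P h) (x : Z) :
    ∀ᵐ t, t ∈ Ioo 0 T → deriv (fun t => E t x) t = P t x := by
  obtain ⟨L, hL⟩ := S.energy_lipschitz x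
  have hac : AbsolutelyContinuousOnInterval (fun t => E t x) 0 T :=
    LipschitzOnWith.absolutelyContinuousOnInterval (K := L) (by rwa [uIcc_of_le S.T_pos.le])
  filter_upwards [hac.ae_differentiableAt] with t ht htT
  have hd := (ht (by rw [uIcc_of_le S.T_pos.le]; exact ⟨htT.1.le, htT.2.le⟩)).hasDerivAt
  set D := deriv (fun t => E t x) t
  have hs := hasDerivAt_iff_tendsto_slope_left_right.1 hd
  refine le_antisymm ?_ ?_
  · refine le_of_forall_gt fun c hc => ?_
    obtain ⟨c', hc', hcc⟩ := exists_between hc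
    refine lt_of_le_of_lt (le_of_tendsto hs.2 ?_) hcc
    filter_upwards [S.eventually_right_quotient ⟨htT.1.le, htT.2⟩ x hc', self_mem_nhdsWithin]
      with s h1 h2
    rw [slope_def_field]
    have h2 : 0 < s - t := sub_pos.2 h2
    rw [div_le_iff₀ h2]; exact h1.le
  · refine le_of_forall_lt fun c hc => ?_
    obtain ⟨c', hcc, hc'⟩ := exists_between hc
    refine lt_of_lt_of_le hcc (ge_of_tendsto hs.1 ?_)
    filter_upwards [S.eventually_left_quotient ⟨htT.1, htT.2.le⟩ x hc', self_mem_nhdsWithin]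
      with s h1 h2
    have h2 : 0 < t - s := sub_pos.2 h2
    rw [slope_comm, slope_def_field, le_div_iff₀ h2]; exact h1.le

/-- The energy of a fixed state is absolutely continuous in time. -/
theorem energy_sub_eq_integral (S : IsPreSystem T z₀ F₀ C_P d E P h) (x : Z) {s t : ℝ} (hs : 0 ≤ s)
    (hst : s ≤ t) (ht : t ≤ T) :
    IntervalIntegrable (fun r => deriv (fun t => E t x) r) volume s t ∧
    E t x - E s x = ∫ r in s..t, deriv (fun t => E t x) r := by
  obtain ⟨L, hL⟩ := S.energy_lipschitz x
  have hac : AbsolutelyContinuousOnInterval (fun t => E t x) s t :=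
    LipschitzOnWith.absolutelyContinuousOnInterval (K := L)
      (by rw [uIcc_of_le hst]; exact hL.mono (Icc_subset_Icc hs ht))
  exact ⟨hac.intervalIntegrable_deriv, hac.integral_deriv_eq_sub.symm⟩

/-! ### Limits of distances and residuals -/

theorem tendsto_dist_left (S : IsPreSystem T z₀ F₀ C_P d E P h) {C : ℝ}
    {p : ℕ → ℝ × Z} {y : Z} (hp : ∀ n, p n ∈ sublevel T z₀ F₀ d E C)
    (hq : Tendsto (fun n => (p n).2) atTop (𝓝 y)) (v : Z) :
    Tendsto (fun n => d (p n).2 v) atTop (𝓝 (d y v)) :=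
  S.left_continuous ((C + 1) * Real.exp (C_P * T)) (fun n => (p n).2) y
    (fun n => (le_add_of_nonneg_right zero_le_one).trans
      (S.perturbedEnergy_le_of_mem (hp n) ⟨le_rfl, S.T_pos.le⟩)) hq v

theorem tendsto_correction_left (S : IsPreSystem T z₀ F₀ C_P d E P h) {C : ℝ}
    {p : ℕ → ℝ × Z} {y : Z} (hp : ∀ n, p n ∈ sublevel T z₀ F₀ d E C)
    (hq : Tendsto (fun n => (p n).2) atTop (𝓝 y)) (v : Z) :
    Tendsto (fun n => correction h d (p n).2 v) atTop (𝓝 (correction h d y v)) :=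
  ((continuous_gauge S.h_mono S.h_cont).tendsto _).comp (S.tendsto_dist_left hp hq v)

/-- The residual stability function is lower semicontinuous along sequences of bounded energy. -/
theorem residual_le_of_tendsto [T2Space Z] (S : IsPreSystem T z₀ F₀ C_P d E P h) {C : ℝ}
    {p : ℕ → ℝ × Z} {q : ℝ × Z} (hp : ∀ n, p n ∈ sublevel T z₀ F₀ d E C)
    (hq : Tendsto p atTop (𝓝 q)) :
    residual E d (correction h d) q.1 q.2 ≤
      liminf (fun n => residual E d (correction h d) (p n).1 (p n).2) atTop := by
  refine iSup_le fun y => tsub_le_iff_right.2 ?_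
  have hq1 := (continuous_fst.tendsto q).comp hq
  have hq2 := (continuous_snd.tendsto q).comp hq
  have hD := (S.tendsto_dist_left hp hq2 y).add (S.tendsto_correction_left hp hq2 y)
  have hE : Tendsto (fun n => E (p n).1 y) atTop (𝓝 (E q.1 y)) :=
    S.tendsto_energy_time y (Eventually.of_forall fun n => (hp n).1)
      (S.mem_sublevel_of_tendsto hp hq).1 hq1
  have key : ∀ ε > 0, ENNReal.ofReal (E q.1 q.2 - ε - E q.1 y) ≤
      liminf (fun n => residual E d (correction h d) (p n).1 (p n).2) atTop +
        (d q.2 y + correction h d q.2 y) := by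
    intro ε hε
    have h1 : Tendsto (fun n => ENNReal.ofReal (E q.1 q.2 - ε - E (p n).1 y)) atTop
        (𝓝 (ENNReal.ofReal (E q.1 q.2 - ε - E q.1 y))) :=
      (ENNReal.continuous_ofReal.tendsto _).comp (tendsto_const_nhds.sub hE)
    rw [← h1.liminf_eq]
    by_cases htop : liminf (fun n => residual E d (correction h d) (p n).1 (p n).2) atTop = ⊤
    · rw [htop, top_add]; exact le_top
    by_cases htop' : d q.2 y + correction h d q.2 y = ⊤
    · rw [htop', add_top]; exact le_top
    -- a subsequence realises the lower limit of the residuals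
    refine le_of_forall_gt fun b hb => ?_
    obtain ⟨b₁, b₂, hb₁, hb₂, hb⟩ : ∃ b₁ b₂ : ℝ≥0∞,
        liminf (fun n => residual E d (correction h d) (p n).1 (p n).2) atTop < b₁ ∧
        d q.2 y + correction h d q.2 y < b₂ ∧ b₁ + b₂ < b := by
      have hne : b - (liminf (fun n => residual E d (correction h d) (p n).1 (p n).2) atTop +
        (d q.2 y + correction h d q.2 y)) ≠ 0 := (tsub_pos_of_lt hb).ne'
      obtain ⟨c, hc0, hc⟩ := exists_between (tsub_pos_of_lt hb)
      have hchalf : c / 2 ≠ 0 := (ENNReal.half_pos hc0.ne').ne'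
      refine ⟨_, _, ENNReal.lt_add_right htop hchalf, ENNReal.lt_add_right htop' hchalf, ?_⟩
      rw [add_add_add_comm, ENNReal.add_halves]
      exact lt_tsub_iff_left.1 hc
    have hfreq := frequently_lt_of_liminf_lt (by isBoundedDefault) hb₁
    have hev := (hD.eventually (gt_mem_nhds hb₂)).and (S.eventually_lt_energy hp hq
      (show E q.1 q.2 - ε < E q.1 q.2 by linarith))
    refine lt_of_le_of_lt (liminf_le_of_frequently_le ((hfreq.and_eventually hev).mono
      fun n ⟨hn1, hn2, hn3⟩ => ?_) (by isBoundedDefault)) hb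
    have h2 : ENNReal.ofReal (E (p n).1 (p n).2 - E (p n).1 y) -
        (d (p n).2 y + correction h d (p n).2 y) ≤ residual E d (correction h d) (p n).1 (p n).2 :=
      le_iSup (fun y => ENNReal.ofReal (E (p n).1 (p n).2 - E (p n).1 y) -
        (d (p n).2 y + correction h d (p n).2 y)) y
    refine (ENNReal.ofReal_le_ofReal (by linarith)).trans ((tsub_le_iff_right.1 h2).trans ?_)
    exact add_le_add hn1.le hn2.le
  have hlim : Tendsto (fun ε : ℝ => ENNReal.ofReal (E q.1 q.2 - ε - E q.1 y)) (𝓝[>] 0)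
      (𝓝 (ENNReal.ofReal (E q.1 q.2 - 0 - E q.1 y))) := by
    refine Tendsto.mono_left (Continuous.tendsto ?_ 0) nhdsWithin_le_nhds
    exact ENNReal.continuous_ofReal.comp (by fun_prop)
  rw [sub_zero] at hlim
  refine le_of_tendsto hlim ?_
  filter_upwards [self_mem_nhdsWithin] with ε hε using key ε hε

end IsPreSystem

theorem ofReal_sub_le_residual_add {Z : Type*} {E : ℝ → Z → ℝ} {d δ : Z → Z → ℝ≥0∞} (t : ℝ)
    (x y : Z) :
    ENNReal.ofReal (E t x - E t y) ≤ residual E d δ t x + (d x y + δ x y) :=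
  tsub_le_iff_right.1 (le_iSup (fun y => ENNReal.ofReal (E t x - E t y) - (d x y + δ x y)) y)

/-! ### The jump dissipation cost -/

theorem IsTransition.sInf_mem {Z : Type*} [TopologicalSpace Z] {d : Z → Z → ℝ≥0∞} {A : Set ℝ}
    {θ : ℝ → Z} {x y : Z} (hθ : IsTransition d A θ x y) : sInf A ∈ A :=
  hθ.compact.sInf_mem hθ.nonempty

theorem IsTransition.sSup_mem {Z : Type*} [TopologicalSpace Z] {d : Z → Z → ℝ≥0∞} {A : Set ℝ}
    {θ : ℝ → Z} {x y : Z} (hθ : IsTransition d A θ x y) : sSup A ∈ A :=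
  hθ.compact.sSup_mem hθ.nonempty

theorem dist_le_jumpCost {Z : Type*} [TopologicalSpace Z] (E : ℝ → Z → ℝ) (d δ : Z → Z → ℝ≥0∞)
    (t : ℝ) (x y : Z) : d x y ≤ jumpCost E d δ t x y := by
  refine le_iInf fun A => le_iInf fun θ => le_iInf fun hθ => ?_
  have h1 := dist_le_variation (d := d) (u := θ) hθ.sInf_mem hθ.sSup_mem
    (csInf_le hθ.compact.bddBelow hθ.sSup_mem)
  rw [hθ.start, hθ.finish] at h1
  exact h1.trans (le_trans le_self_add le_self_add)

theorem jumpCost_self {Z : Type*} [TopologicalSpace Z] (E : ℝ → Z → ℝ) {d : Z → Z → ℝ≥0∞}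
    (hself : ∀ x, d x x = 0) (δ : Z → Z → ℝ≥0∞) (t : ℝ) (x : Z) : jumpCost E d δ t x x = 0 := by
  refine nonpos_iff_eq_zero.1 ?_
  have hθ : IsTransition d {0} (fun _ => x) x x :=
    { nonempty := singleton_nonempty 0
      compact := isCompact_singleton
      continuous := continuousOn_const
      d_continuous := fun ε _ => ⟨1, one_pos, fun _ _ _ _ _ _ => by rw [hself]; exact zero_le⟩
      start := rfl
      finish := rfl }
  have h0 : jumpCost E d δ t x x ≤ transitionCost E d δ t (fun _ => x) {0} :=
    iInf_le_of_le {0} (iInf_le_of_le (fun _ => x) (iInf_le_of_le hθ le_rfl))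
  refine h0.trans ?_
  have h1 : IsEmpty (holes ({0} : Set ℝ)) := ⟨fun I => by
    have h1 : I.1.1 = 0 := I.2.1
    have h2 : I.1.2 = 0 := I.2.2.1
    exact absurd I.2.2.2.1 (by simp [h1, h2])⟩
  have h2 : IsEmpty (({0} : Set ℝ) \ {sSup {0}} : Set ℝ) := ⟨fun s => by
    have := s.2; simp at this⟩
  simp [transitionCost, variation_subsingleton hself subsingleton_singleton]

theorem incrementalCost_self {Z : Type*} [TopologicalSpace Z] (E : ℝ → Z → ℝ) {d : Z → Z → ℝ≥0∞}
    (hself : ∀ x, d x x = 0) (δ : Z → Z → ℝ≥0∞) (t : ℝ) (x : Z) :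
    incrementalCost E d δ t x x = 0 := by
  simp [incrementalCost, jumpCost_self E hself]

theorem dist_add_incrementalCost {Z : Type*} [TopologicalSpace Z] (E : ℝ → Z → ℝ)
    (d δ : Z → Z → ℝ≥0∞) (t : ℝ) (x y : Z) :
    d x y + incrementalCost E d δ t x y = jumpCost E d δ t x y :=
  add_tsub_cancel_of_le (dist_le_jumpCost E d δ t x y)

/-- The part of the transition cost that is accumulated up to the parameter `s`. -/
noncomputable def partialCost {Z : Type*} (E : ℝ → Z → ℝ) (d δ : Z → Z → ℝ≥0∞) (t : ℝ)
    (θ : ℝ → Z) (A : Set ℝ) (s : ℝ) : ℝ≥0∞ :=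
  variation d θ (A ∩ Iic s)
    + ∑' I : ℝ × ℝ, (holes A ∩ {I | I.2 ≤ s}).indicator (fun I => δ (θ I.1) (θ I.2)) I
    + ∑' r : ℝ, (A ∩ Iio s).indicator (fun r => residual E d δ t (θ r)) r

section PartialCost

variable {Z : Type*} {E : ℝ → Z → ℝ} {d δ : Z → Z → ℝ≥0∞} {t : ℝ} {θ : ℝ → Z} {A : Set ℝ}

theorem partialCost_mono : Monotone (partialCost E d δ t θ A) := fun r s hrs => by
  refine add_le_add (add_le_add (variation_mono ?_) (ENNReal.tsum_le_tsum fun I => ?_))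
    (ENNReal.tsum_le_tsum fun r => ?_)
  · exact inter_subset_inter_right _ (Iic_subset_Iic.2 hrs)
  · exact indicator_le_indicator_of_subset
      (inter_subset_inter_right _ fun I hI => le_trans hI hrs) (fun _ => zero_le) I
  · exact indicator_le_indicator_of_subset
      (inter_subset_inter_right _ (Iio_subset_Iio hrs)) (fun _ => zero_le) r

theorem partialCost_le (hA : BddAbove A) {s : ℝ} (hs : s ∈ A) :
    partialCost E d δ t θ A s ≤ transitionCost E d δ t θ A := by
  unfold partialCost transitionCost
  rw [tsum_subtype (holes A) (fun I => δ (θ I.1) (θ I.2)),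
    tsum_subtype (A \ {sSup A}) (fun s => residual E d δ t (θ s))]
  refine add_le_add (add_le_add (variation_mono inter_subset_left)
    (ENNReal.tsum_le_tsum fun I => ?_)) (ENNReal.tsum_le_tsum fun r => ?_)
  · exact indicator_le_indicator_of_subset inter_subset_left (fun _ => zero_le) I
  · exact indicator_le_indicator_of_subset (s := A ∩ Iio s) (t := A \ {sSup A})
      (fun r hr => ⟨hr.1, fun h => absurd (le_csSup hA hs) (by
        rw [← (h : r = sSup A)]; exact not_le.2 hr.2)⟩) (fun _ => zero_le) r

theorem tsum_indicator_add_le {ι : Type*} {B C : Set ι} {i : ι} {f : ι → ℝ≥0∞} (hBC : B ⊆ C)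
    (hi : i ∈ C) (hiB : i ∉ B) : ∑' j, B.indicator f j + f i ≤ ∑' j, C.indicator f j := by
  classical
  rw [← tsum_pi_single i (f i), ← ENNReal.tsum_add]
  refine ENNReal.tsum_le_tsum fun j => ?_
  by_cases hj : j = i
  · subst hj; simp [hi, hiB]
  · simp only [ne_eq, hj, not_false_eq_true, Pi.single_eq_of_ne, add_zero]
    exact indicator_le_indicator_of_subset hBC (fun _ => zero_le) j

theorem variation_inter_Iic_add_le {r s : ℝ} (hr : r ∈ A) (hs : s ∈ A) (hrs : r ≤ s) :
    variation d θ (A ∩ Iic r) + d (θ r) (θ s) ≤ variation d θ (A ∩ Iic s) := by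
  refine le_trans (add_le_add_right (dist_le_variation (A := A ∩ Icc r s) ⟨hr, le_rfl, hrs⟩
    ⟨hs, hrs, le_rfl⟩ hrs) _) (variation_add_le (A := A ∩ Iic s) ?_ ?_ ?_)
  · exact inter_subset_inter_right _ (Iic_subset_Iic.2 hrs)
  · exact inter_subset_inter_right _ fun x hx => hx.2
  · exact fun x hx y hy => le_trans hx.2 hy.2.1

/-- Away from holes, the cost accumulated between two points contains their distance and the
residual of the first one. -/
theorem partialCost_add_le {r s : ℝ} (hr : r ∈ A) (hs : s ∈ A) (hrs : r < s) :
    partialCost E d δ t θ A r + (d (θ r) (θ s) + residual E d δ t (θ r)) ≤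
      partialCost E d δ t θ A s := by
  unfold partialCost
  calc _ = (variation d θ (A ∩ Iic r) + d (θ r) (θ s)) +
        ∑' I : ℝ × ℝ, (holes A ∩ {I | I.2 ≤ r}).indicator (fun I => δ (θ I.1) (θ I.2)) I +
        (∑' r' : ℝ, (A ∩ Iio r).indicator (fun r => residual E d δ t (θ r)) r' +
          residual E d δ t (θ r)) := by ring
    _ ≤ _ := by
      refine add_le_add (add_le_add (variation_inter_Iic_add_le hr hs hrs.le)
        (ENNReal.tsum_le_tsum fun I => ?_))
        (tsum_indicator_add_le (f := fun r => residual E d δ t (θ r))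
          (inter_subset_inter_right _ (Iio_subset_Iio hrs.le)) ⟨hr, hrs⟩ fun h => lt_irrefl r h.2)
      exact indicator_le_indicator_of_subset
        (inter_subset_inter_right _ fun I hI => le_trans hI hrs.le) (fun _ => zero_le) I

/-- Across a hole, the accumulated cost grows also by the correction. -/
theorem partialCost_add_le_of_hole {r s : ℝ} (hI : (r, s) ∈ holes A) :
    partialCost E d δ t θ A r + (residual E d δ t (θ r) + (d (θ r) (θ s) + δ (θ r) (θ s))) ≤
      partialCost E d δ t θ A s := by
  obtain ⟨hr, hs, hrs, -⟩ := id hI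
  simp only at hr hs hrs
  unfold partialCost
  calc _ = (variation d θ (A ∩ Iic r) + d (θ r) (θ s)) +
        (∑' I : ℝ × ℝ, (holes A ∩ {I | I.2 ≤ r}).indicator (fun I => δ (θ I.1) (θ I.2)) I +
          δ (θ r) (θ s)) +
        (∑' r' : ℝ, (A ∩ Iio r).indicator (fun r => residual E d δ t (θ r)) r' +
          residual E d δ t (θ r)) := by ring
    _ ≤ _ := by
      refine add_le_add (add_le_add (variation_inter_Iic_add_le hr hs hrs.le) ?_)
        (tsum_indicator_add_le (f := fun r => residual E d δ t (θ r))
          (inter_subset_inter_right _ (Iio_subset_Iio hrs.le)) ⟨hr, hrs⟩ fun h => lt_irrefl r h.2)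
      exact tsum_indicator_add_le (i := (r, s)) (f := fun I : ℝ × ℝ => δ (θ I.1) (θ I.2))
        (inter_subset_inter_right _ fun I hI => le_trans hI hrs.le) ⟨hI, le_refl s⟩
        fun h => absurd h.2 (not_le.2 hrs)

end PartialCost

namespace IsPreSystem

variable {Z : Type*} [TopologicalSpace Z] {T : ℝ} {z₀ : Z} {F₀ C_P : ℝ}
  {d : Z → Z → ℝ≥0∞} {E P : ℝ → Z → ℝ} {h : ℝ≥0 → ℝ≥0}

/-- Lower semicontinuity of the energy along families at bounded distance from `z₀`. -/
theorem eventually_sub_le_energy_of_tendsto [T2Space Z] (S : IsPreSystem T z₀ F₀ C_P d E P h)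
    {ι : Type*} {l : Filter ι} [l.IsCountablyGenerated] {t : ι → ℝ} {x : ι → Z} {s : ℝ} {y : Z}
    (ht : ∀ᶠ i in l, t i ∈ Icc 0 T) (hts : Tendsto t l (𝓝 s)) (hxy : Tendsto x l (𝓝 y))
    {D : ℝ≥0∞} (hD : D ≠ ⊤) (hx : ∀ᶠ i in l, d z₀ (x i) ≤ D) {η : ℝ} (hη : 0 < η) :
    ∀ᶠ i in l, E s y - η ≤ E (t i) (x i) := by
  by_contra hcon
  have hfr : ∃ᶠ i in l, ¬ (E s y - η ≤ E (t i) (x i)) := not_eventually.1 hcon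
  obtain ⟨k, hk, hk2⟩ := exists_seq_forall_of_frequently (hfr.and_eventually (ht.and hx))
  have hp : ∀ n, (t (k n), x (k n)) ∈ sublevel T z₀ F₀ d E (E s y - η + D.toReal + F₀) := by
    intro n
    obtain ⟨h1, h2, h3⟩ := hk2 n
    refine ⟨h2, ?_⟩
    have := ENNReal.toReal_mono hD h3
    simp only [perturbedEnergy]
    linarith [not_le.1 h1]
  obtain ⟨n, hn⟩ := (S.eventually_lt_energy hp ((hts.comp hk).prodMk_nhds (hxy.comp hk))
    (show E s y - η < E s y by linarith)).exists
  exact (hk2 n).1 hn.le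

/-- The energy released by a jump is at most its cost. Along a transition the sum of the
energy and of the cost accumulated so far is essentially nondecreasing: across a hole this is the
definition of the residual, elsewhere the correction is negligible with respect to the distance. -/
theorem ofReal_energy_sub_le_jumpCost [T2Space Z] (S : IsPreSystem T z₀ F₀ C_P d E P h) {t : ℝ}
    (ht : t ∈ Icc 0 T) (x y : Z) (hx : d z₀ x ≠ ⊤) :
    ENNReal.ofReal (E t x - E t y) ≤ jumpCost E d (correction h d) t x y := by
  refine le_iInf fun A => le_iInf fun θ => le_iInf fun hθ => ?_
  by_cases htop : transitionCost E d (correction h d) t θ A = ⊤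
  · rw [htop]; exact le_top
  set δ := correction h d with hδ
  set a := sInf A with ha
  set b := sSup A with hb
  have haA : IsLeast A a := ⟨hθ.sInf_mem, fun s hs => csInf_le hθ.compact.bddBelow hs⟩
  have hbA : IsGreatest A b := ⟨hθ.sSup_mem, fun s hs => le_csSup hθ.compact.bddAbove hs⟩
  set Q := partialCost E d δ t θ A with hQ
  set V : ℝ → ℝ≥0∞ := fun s => variation d θ (A ∩ Iic s) with hV
  have hQtop : ∀ s ∈ A, Q s ≠ ⊤ := fun s hs =>
    ne_top_of_le_ne_top htop (partialCost_le hθ.compact.bddAbove hs)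
  have hVQ : ∀ s, V s ≤ Q s := fun s => le_trans le_self_add le_self_add
  have hVtop : ∀ s ∈ A, V s ≠ ⊤ := fun s hs => ne_top_of_le_ne_top (hQtop s hs) (hVQ s)
  have hbound : ∀ s ∈ A, d z₀ (θ s) ≤ d z₀ x + Q b := fun s hs => by
    refine (S.dist.triangle z₀ x (θ s)).trans (add_le_add_right ?_ _)
    rw [← hθ.start]
    refine (dist_le_variation (A := A ∩ Iic b) ⟨haA.1, haA.2 hbA.1⟩ ⟨hs, hbA.2 hs⟩
      (haA.2 hs)).trans (hVQ b)
  have key : ∀ ε : ℝ≥0, 0 < ε → E t (θ a) + ((Q a).toReal + ε * (V a).toReal) ≤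
      E t (θ b) + ((Q b).toReal + ε * (V b).toReal) := by
    intro ε hε
    refine le_of_forall_left_of_forall_right hθ.compact.isClosed haA hbA
      (f := fun s => E t (θ s) + ((Q s).toReal + ε * (V s).toReal)) (fun s hs has => ?_)
      (fun s hs hsb η hη => ?_)
    · -- a radius below which the correction is negligible, and the corresponding modulus of `θ`
      obtain ⟨ρ, hρ, hρε⟩ := ENNReal.nhds_zero_basis_Iic.eventually_iff.1
        (exists_gauge_le_mul S.h_mono S.h_cont S.h_zero hε)
      obtain ⟨η, hη, hθη⟩ := hθ.d_continuous ρ hρ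
      -- either `A` has points near `s` on its left, or a hole ends at `s`
      by_cases hlim : ∃ s₀ ∈ A, s - η ≤ s₀ ∧ s₀ < s
      · obtain ⟨s₀, hs₀, h1, h2⟩ := hlim
        refine ⟨s₀, hs₀, h2, fun r hr hsr hrs => ?_⟩
        have h3 : δ (θ r) (θ s) ≤ ε * d (θ r) (θ s) :=
          hρε (hθη r hr s hs hrs.le (by linarith))
        have h4 := ofReal_sub_le_residual_add (E := E) (d := d) (δ := δ) t (θ r) (θ s)
        have h5 : Q r + (d (θ r) (θ s) + residual E d δ t (θ r)) ≤ Q s :=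
          partialCost_add_le hr hs hrs
        have h6 : V r + d (θ r) (θ s) ≤ V s := variation_inter_Iic_add_le hr hs hrs.le
        have hfin : d (θ r) (θ s) ≠ ⊤ :=
          ne_top_of_le_ne_top (hVtop s hs) (le_trans le_add_self h6)
        have hR : residual E d δ t (θ r) ≠ ⊤ :=
          ne_top_of_le_ne_top (hQtop s hs) (le_trans (le_add_self.trans le_add_self) h5)
        have h7 : E t (θ r) - E t (θ s) ≤ (residual E d δ t (θ r)).toReal +
            ((d (θ r) (θ s)).toReal + ε * (d (θ r) (θ s)).toReal) := by
          have h8 : ENNReal.ofReal (E t (θ r) - E t (θ s)) ≤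
              residual E d δ t (θ r) + (d (θ r) (θ s) + ε * d (θ r) (θ s)) :=
            h4.trans (add_le_add_right (add_le_add_right h3 _) _)
          have hεd : (ε : ℝ≥0∞) * d (θ r) (θ s) ≠ ⊤ := ENNReal.mul_ne_top ENNReal.coe_ne_top hfin
          have h9 := ENNReal.toReal_mono
            (ENNReal.add_ne_top.2 ⟨hR, ENNReal.add_ne_top.2 ⟨hfin, hεd⟩⟩) h8
          rw [ENNReal.toReal_add hR (ENNReal.add_ne_top.2 ⟨hfin, hεd⟩),
            ENNReal.toReal_add hfin hεd, ENNReal.toReal_mul, ENNReal.coe_toReal] at h9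
          refine le_trans ?_ h9
          rw [ENNReal.toReal_ofReal']
          exact le_max_left _ _
        have h5' := ENNReal.toReal_mono (hQtop s hs) h5
        have h6' := ENNReal.toReal_mono (hVtop s hs) h6
        rw [ENNReal.toReal_add (hQtop r hr) (ENNReal.add_ne_top.2 ⟨hfin, hR⟩),
          ENNReal.toReal_add hfin hR] at h5'
        rw [ENNReal.toReal_add (hVtop r hr) hfin] at h6'
        have h10 : (ε : ℝ) * ((V r).toReal + (d (θ r) (θ s)).toReal) ≤ ε * (V s).toReal :=
          mul_le_mul_of_nonneg_left h6' ε.2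
        linarith
      · push Not at hlim
        have hne : (A ∩ Iic (s - η)).Nonempty := by
          refine ⟨a, haA.1, ?_⟩
          by_contra hn
          exact absurd (hlim a haA.1 (not_le.1 hn).le) (not_le.2 has)
        have hcomp : IsCompact (A ∩ Iic (s - η)) := hθ.compact.inter_right isClosed_Iic
        obtain ⟨r, hr⟩ := hcomp.exists_isGreatest hne
        have hrs : r < s := lt_of_le_of_lt hr.1.2 (by linarith)
        have hnone : ∀ r' ∈ A, r < r' → s ≤ r' := by
          intro r' hr' hlt
          by_contra hn
          have : r' ≤ s - η := by
            by_contra hn'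
            exact hn (hlim r' hr' (not_le.1 hn').le)
          exact absurd (hr.2 ⟨hr', this⟩) (not_le.2 hlt)
        have hI : (r, s) ∈ holes A := by
          refine ⟨hr.1.1, hs, hrs, ?_⟩
          rw [Set.disjoint_left]
          intro r' h1 h2
          exact absurd (hnone r' h2 h1.1) (not_le.2 h1.2)
        refine ⟨r, hr.1.1, hrs, fun r' hr' h1 h2 => ?_⟩
        have hrr : r' = r := by
          by_contra hne'
          exact absurd (hnone r' hr' (lt_of_le_of_ne h1 (Ne.symm hne'))) (not_le.2 h2)
        subst hrr
        have h5 : Q r' + (residual E d δ t (θ r') + (d (θ r') (θ s) + δ (θ r') (θ s))) ≤ Q s :=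
          partialCost_add_le_of_hole hI
        have h4 := ofReal_sub_le_residual_add (E := E) (d := d) (δ := δ) t (θ r') (θ s)
        have hfin : residual E d δ t (θ r') + (d (θ r') (θ s) + δ (θ r') (θ s)) ≠ ⊤ :=
          ne_top_of_le_ne_top (hQtop s hs) (le_trans le_add_self h5)
        have h4' := ENNReal.toReal_mono hfin h4
        rw [ENNReal.toReal_ofReal'] at h4'
        have h5' := ENNReal.toReal_mono (hQtop s hs) h5
        rw [ENNReal.toReal_add (hQtop r' hr') hfin] at h5'
        have h6 : (ε : ℝ) * (V r').toReal ≤ ε * (V s).toReal :=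
          mul_le_mul_of_nonneg_left (ENNReal.toReal_mono (hVtop s hs)
            (variation_mono (inter_subset_inter_right _ (Iic_subset_Iic.2 h2.le)))) ε.2
        have := (le_max_left _ _).trans h4'
        linarith
    · have h1 := S.eventually_sub_le_energy_of_tendsto (l := 𝓝[A] s) (t := fun _ => t) (x := θ)
        (Eventually.of_forall fun _ => ht) tendsto_const_nhds (hθ.continuous s hs)
        (ENNReal.add_ne_top.2 ⟨hx, hQtop b hbA.1⟩)
        (by filter_upwards [self_mem_nhdsWithin] with r hr using hbound r hr) hη
      rw [eventually_nhdsWithin_iff] at h1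
      obtain ⟨ρ, hρ, hball⟩ := Metric.eventually_nhds_iff.1 h1
      refine ⟨s + ρ, by linarith, fun r hr hsr hrs => ?_⟩
      have h2 : E t (θ s) - η ≤ E t (θ r) :=
        hball (by rw [Real.dist_eq, abs_of_pos (sub_pos.2 hsr)]; linarith) hr
      have h3 : (Q s).toReal ≤ (Q r).toReal :=
        ENNReal.toReal_mono (hQtop r hr) (partialCost_mono hsr.le)
      have h4 : (ε : ℝ) * (V s).toReal ≤ ε * (V r).toReal :=
        mul_le_mul_of_nonneg_left (ENNReal.toReal_mono (hVtop r hr)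
          (variation_mono (inter_subset_inter_right _ (Iic_subset_Iic.2 hsr.le)))) ε.2
      linarith
  have hlimit : E t (θ a) + ((Q a).toReal + 0 * (V a).toReal) ≤
      E t (θ b) + ((Q b).toReal + 0 * (V b).toReal) := by
    refine le_of_tendsto_of_tendsto (b := 𝓝[>] (0 : ℝ≥0))
      (f := fun ε : ℝ≥0 => E t (θ a) + ((Q a).toReal + ε * (V a).toReal))
      (g := fun ε : ℝ≥0 => E t (θ b) + ((Q b).toReal + ε * (V b).toReal)) ?_ ?_ ?_
    · refine Tendsto.mono_left (Continuous.tendsto' ?_ _ _ (by simp)) nhdsWithin_le_nhds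
      fun_prop
    · refine Tendsto.mono_left (Continuous.tendsto' ?_ _ _ (by simp)) nhdsWithin_le_nhds
      fun_prop
    · filter_upwards [self_mem_nhdsWithin] with ε hε using key ε hε
  rw [hθ.start, hθ.finish] at hlimit
  refine le_trans ?_ (partialCost_le hθ.compact.bddAbove hbA.1)
  refine ENNReal.ofReal_le_of_le_toReal ?_
  have : 0 ≤ (Q a).toReal := ENNReal.toReal_nonneg
  have hgoal : E t x - E t y ≤ (Q b).toReal := by linarith
  exact hgoal

end IsPreSystem

/-! ### Compactness of parametrized chains -/

/-- In a sequentially compact set, closeness in either direction with respect to a lower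
semicontinuous separating distance implies convergence. -/
theorem tendsto_of_min_dist_tendsto {Y : Type*} [TopologicalSpace Y] {K : Set Y}
    (hK : IsSeqCompact K) {D : Y → Y → ℝ≥0∞} (hD : LowerSemicontinuous fun p : Y × Y => D p.1 p.2)
    (hsep : ∀ x y, D x y = 0 → x = y) {ι : Type*} {l : Filter ι} [l.IsCountablyGenerated]
    {y : ι → Y} {w : Y} (hy : ∀ᶠ i in l, y i ∈ K) {ε : ι → ℝ≥0∞} (hε : Tendsto ε l (𝓝 0))
    (hle : ∀ᶠ i in l, min (D (y i) w) (D w (y i)) ≤ ε i) : Tendsto y l (𝓝 w) := by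
  refine tendsto_of_subseq_tendsto fun ns hns => ?_
  obtain ⟨n₀, hn₀⟩ := eventually_atTop.1 (hns.eventually hy)
  obtain ⟨v, -, φ, hφ, hlim⟩ := hK (x := fun n => y (ns (n + n₀))) fun n => hn₀ _ (by omega)
  have hφ' : Tendsto (fun n => ns (φ n + n₀)) atTop l :=
    hns.comp ((tendsto_add_atTop_nat n₀).comp hφ.tendsto_atTop)
  refine ⟨fun n => φ n + n₀, ?_⟩
  have hl : LowerSemicontinuous fun v => min (D v w) (D w v) := by
    refine LowerSemicontinuous.inf ?_ ?_
    · exact hD.comp (continuous_id.prodMk continuous_const)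
    · exact hD.comp (continuous_const.prodMk continuous_id)
  have h0 : min (D v w) (D w v) ≤ 0 :=
    le_of_tendsto_of_lsc hl hlim (hε.comp hφ') (hφ'.eventually hle)
  have : v = w := by
    rcases min_le_iff.1 h0 with h | h
    · exact hsep _ _ (nonpos_iff_eq_zero.1 h)
    · exact (hsep _ _ (nonpos_iff_eq_zero.1 h)).symm
  rw [← this]; exact hlim

open Classical in
/-- Compactness of chains `y n 0, y n 1, …, y n (N n)` parametrized by real nodes `s n k` in such a
way that distances are controlled by increments of the parameter. Along a subsequence the sets of
nodes converge to a closed set `A` in the sense of Kuratowski, and the points converge to a limit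
curve `θ` on `A`. -/
theorem exists_limit_chain {Y : Type*} [TopologicalSpace Y] {K : Set Y}
    (hK : IsSeqCompact K) {D : Y → Y → ℝ≥0∞} (hD : LowerSemicontinuous fun p : Y × Y => D p.1 p.2)
    (hsep : ∀ x y, D x y = 0 → x = y) {N : ℕ → ℕ} {s : ℕ → ℕ → ℝ} {y : ℕ → ℕ → Y} {M : ℝ}
    (hs_mono : ∀ n, Monotone (s n)) (hs_zero : ∀ n, s n 0 = 0) (hs_le : ∀ n k, s n k ≤ M)
    (hy : ∀ n k, y n k ∈ K)
    (hle : ∀ n j k, j ≤ k → D (y n j) (y n k) ≤ ENNReal.ofReal (s n k - s n j)) :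
    ∃ φ : ℕ → ℕ, StrictMono φ ∧ ∃ (A : Set ℝ) (θ : ℝ → Y), IsClosed A ∧
      (∀ (ψ k : ℕ → ℕ) (r : ℝ), Tendsto ψ atTop atTop → (∀ᶠ i in atTop, k i ≤ N (φ (ψ i))) →
        Tendsto (fun i => s (φ (ψ i)) (k i)) atTop (𝓝 r) →
        r ∈ A ∧ Tendsto (fun i => y (φ (ψ i)) (k i)) atTop (𝓝 (θ r))) ∧
      (∀ r ∈ A, ∃ k : ℕ → ℕ, (∀ n, k n ≤ N (φ n)) ∧
        Tendsto (fun n => s (φ n) (k n)) atTop (𝓝 r)) := by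
  -- a dense sequence of nonnegative parameters, and the last node before each of them
  set q : ℕ → ℝ := fun i => |TopologicalSpace.denseSeq ℝ i| with hq
  have hqd : ∀ a b : ℝ, 0 ≤ a → a < b → ∃ i, a < q i ∧ q i < b := by
    intro a b ha hab
    obtain ⟨i, hi⟩ := (TopologicalSpace.denseRange_denseSeq ℝ).exists_mem_open isOpen_Ioo
      (nonempty_Ioo.2 hab)
    refine ⟨i, ?_, ?_⟩ <;> simp only [hq] <;>
      rw [abs_of_pos (lt_of_le_of_lt ha hi.1)]
    exacts [hi.1, hi.2]
  set κ : ℕ → ℕ → ℕ := fun i n => Nat.findGreatest (fun k => s n k ≤ q i) (N n) with hκ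
  have hκN : ∀ i n, κ i n ≤ N n := fun i n => Nat.findGreatest_le _
  have hκq : ∀ i n, s n (κ i n) ≤ q i := fun i n =>
    Nat.findGreatest_spec (P := fun k => s n k ≤ q i) (m := 0) (Nat.zero_le _)
      (by rw [hs_zero]; exact abs_nonneg _)
  have hκmax : ∀ i n k, k ≤ N n → s n k ≤ q i → k ≤ κ i n := fun i n k hk hsk =>
    Nat.le_findGreatest hk hsk
  have hs0 : ∀ n k, 0 ≤ s n k := fun n k => (hs_zero n).symm.le.trans (hs_mono n (Nat.zero_le k))
  obtain ⟨φ₁, hφ₁, hlim₁⟩ := exists_common_subseq hK (fun i n => y n (κ i n)) fun i n => hy _ _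
  obtain ⟨φ₂, hφ₂, hlim₂⟩ := exists_common_subseq
    (isCompact_Icc (a := (0 : ℝ)) (b := M)).isSeqCompact
    (fun i n => s (φ₁ n) (κ i (φ₁ n))) fun i n => ⟨hs0 _ _, hs_le _ _⟩
  choose L hLK hL using hlim₁
  choose σ hσM hσ using hlim₂
  have hL' : ∀ i, Tendsto (fun n => y (φ₁ (φ₂ n)) (κ i (φ₁ (φ₂ n)))) atTop (𝓝 (L i)) := fun i =>
    (hL i).comp hφ₂.tendsto_atTop
  have hσq : ∀ i, σ i ≤ q i := fun i => le_of_tendsto (hσ i) (Eventually.of_forall fun n => hκq _ _)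
  -- the limit curve at `r` is a limit of the points `L i` as `q i` decreases to `r`
  have hw : ∀ r : ℝ, 0 ≤ r → ∃ w, ∃ i : ℕ → ℕ, (∀ m, r < q (i m)) ∧
      Tendsto (fun m => q (i m)) atTop (𝓝 r) ∧ Tendsto (fun m => L (i m)) atTop (𝓝 w) := by
    intro r hr
    choose i hi1 hi2 using fun m : ℕ => hqd r (r + 1 / (m + 1)) hr
      (by linarith [Nat.one_div_pos_of_nat (α := ℝ) (n := m)])
    obtain ⟨w, -, χ, hχ, hw⟩ := hK (x := fun m => L (i m)) fun m => hLK _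
    refine ⟨w, i ∘ χ, fun m => hi1 _, ?_, hw⟩
    have h1 : Tendsto (fun m => q (i m)) atTop (𝓝 r) := by
      refine tendsto_of_tendsto_of_tendsto_of_le_of_le tendsto_const_nhds ?_
        (fun m => (hi1 m).le) (fun m => (hi2 m).le)
      simpa using tendsto_one_div_add_atTop_nhds_zero_nat.const_add r
    exact h1.comp hχ.tendsto_atTop
  have : Nonempty Y := ⟨y 0 0⟩
  choose! θ i hi1 hi2 hi3 using hw
  refine ⟨φ₁ ∘ φ₂, hφ₁.comp hφ₂, {r | 0 ≤ r ∧ ∀ i, r < q i → r ≤ σ i}, θ, ?_, ?_, ?_⟩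
  · have : {r : ℝ | 0 ≤ r ∧ ∀ i, r < q i → r ≤ σ i} = Ici 0 ∩ ⋂ i, (Ici (q i) ∪ Iic (σ i)) := by
      ext r
      simp only [mem_ofPred_eq, mem_inter_iff, mem_Ici, mem_iInter, mem_union, mem_Iic]
      refine and_congr_right fun _ => forall_congr' fun i => ?_
      exact imp_iff_not_or.trans (by rw [not_lt])
    rw [this]
    exact isClosed_Ici.inter (isClosed_iInter fun i => isClosed_Ici.union isClosed_Iic)
  · intro ψ k r hψ hk hr
    have hr0 : 0 ≤ r := ge_of_tendsto hr (Eventually.of_forall fun _ => hs0 _ _)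
    have hlarge : ∀ j, r < q j → ∀ᶠ m in atTop, k m ≤ κ j (φ₁ (φ₂ (ψ m))) := fun j hj => by
      filter_upwards [hk, hr.eventually (gt_mem_nhds hj)] with m h1 h2
      exact hκmax _ _ _ h1 h2.le
    refine ⟨⟨hr0, fun j hj => ?_⟩, ?_⟩
    · refine le_of_tendsto_of_tendsto hr ((hσ j).comp hψ) ?_
      filter_upwards [hlarge j hj] with m hm using hs_mono _ hm
    · refine tendsto_of_subseq_tendsto fun ns hns => ?_
      obtain ⟨v, -, χ, hχ, hv⟩ := hK (x := fun m => y (φ₁ (φ₂ (ψ (ns m)))) (k (ns m)))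
        fun m => hy _ _
      refine ⟨χ, ?_⟩
      have hsub : Tendsto (fun m => ns (χ m)) atTop atTop := hns.comp hχ.tendsto_atTop
      have h1 : ∀ j, r < q j → D v (L j) ≤ ENNReal.ofReal (q j - r) := by
        intro j hj
        refine le_of_tendsto_of_lsc hD (hv.prodMk_nhds (((hL' j).comp hψ).comp hsub))
          (ENNReal.tendsto_ofReal (tendsto_const_nhds.sub (hr.comp hsub))) ?_
        filter_upwards [hsub.eventually (hlarge j hj)] with m hm
        exact (hle _ _ _ hm).trans (ENNReal.ofReal_le_ofReal
          (sub_le_sub_right (hκq j _) _))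
      have h2 : D v (θ r) ≤ 0 := by
        have h3 : Tendsto (fun m => ENNReal.ofReal (q (i r m) - r)) atTop (𝓝 0) := by
          have := ENNReal.tendsto_ofReal ((hi2 r hr0).sub_const r)
          simpa using this
        exact le_of_tendsto_of_lsc hD (tendsto_const_nhds.prodMk_nhds (hi3 r hr0)) h3
          (Eventually.of_forall fun m => h1 _ (hi1 r hr0 m))
      rw [← hsep _ _ (nonpos_iff_eq_zero.1 h2)]
      exact hv
  · rintro r ⟨hr0, hr⟩
    choose k hkN hk using fun n => Finset.exists_min_image
      (Finset.range (N (φ₁ (φ₂ n)) + 1)) (fun k => |s (φ₁ (φ₂ n)) k - r|) ⟨0, by simp⟩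
    refine ⟨k, fun n => Nat.lt_succ_iff.1 (Finset.mem_range.1 (hkN n)), ?_⟩
    rw [Metric.tendsto_nhds]
    intro ε hε
    obtain ⟨j, hj1, hj2⟩ := hqd r (r + ε) hr0 (by linarith)
    have h1 : |σ j - r| < ε := by
      rw [abs_lt]; constructor <;> linarith [hr j hj1, hσq j]
    have h2 : Tendsto (fun n => |s (φ₁ (φ₂ n)) (κ j (φ₁ (φ₂ n))) - r|) atTop (𝓝 |σ j - r|) :=
      ((hσ j).sub_const r).abs
    filter_upwards [h2.eventually (gt_mem_nhds h1)] with n hn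
    rw [Real.dist_eq]
    exact lt_of_le_of_lt (hk n _ (Finset.mem_range.2 (Nat.lt_succ_iff.2 (hκN _ _)))) hn

/-! ### The incremental minimization scheme -/

namespace IsPreSystem

variable {Z : Type*} [TopologicalSpace Z] {T : ℝ} {z₀ : Z} {F₀ C_P : ℝ}
  {d : Z → Z → ℝ≥0∞} {E P : ℝ → Z → ℝ} {h : ℝ≥0 → ℝ≥0}

/-- Existence of a minimizer `x'` of `E(t,·) + d(x,·) + δ(x,·)`. The energy it releases pays for the
distance, the correction and the residual. -/
theorem exists_incremental_minimizer [T2Space Z] (S : IsPreSystem T z₀ F₀ C_P d E P h) {t : ℝ}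
    (ht : t ∈ Icc 0 T) (x : Z) : ∃ x',
      0 ≤ E t x - E t x' ∧
      d x x' + correction h d x x' + residual E d (correction h d) t x ≤
        ENNReal.ofReal (E t x - E t x') ∧
      ∀ y, d x y + correction h d x y ≠ ⊤ →
        E t x' ≤ E t y + (d x y + correction h d x y).toReal := by
  set D : Z → Z → ℝ≥0∞ := fun x y => d x y + correction h d x y with hDdef
  have hDlsc : LowerSemicontinuous fun y => D x y :=
    (S.dist.lsc.add S.correction_lsc).comp (continuous_const.prodMk continuous_id)
  have hDself : D x x = 0 := by simp [hDdef, S.dist.self_eq_zero, S.correction_self]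
  set V : Set ℝ := {v | ∃ y, D x y ≠ ⊤ ∧ v = E t y + (D x y).toReal} with hV
  have hpert : ∀ y, D x y ≠ ⊤ → perturbedEnergy z₀ F₀ d E t y ≤
      E t y + (D x y).toReal + (d z₀ x).toReal + F₀ := by
    intro y hy
    have h1 : d z₀ y ≤ d z₀ x + D x y :=
      (S.dist.triangle z₀ x y).trans (add_le_add_right le_self_add _)
    have h2 := ENNReal.toReal_mono (ENNReal.add_ne_top.2 ⟨S.dist.finite_from x, hy⟩) h1
    rw [ENNReal.toReal_add (S.dist.finite_from x) hy] at h2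
    simp only [perturbedEnergy]; linarith
  have hVne : V.Nonempty := ⟨_, x, by simp [hDself], rfl⟩
  have hVbdd : BddBelow V := ⟨-(d z₀ x).toReal - F₀, by
    rintro v ⟨y, hy, rfl⟩
    linarith [hpert y hy, S.perturbedEnergy_nonneg ht y]⟩
  set m := sInf V with hm
  have hex : ∀ n : ℕ, ∃ y, D x y ≠ ⊤ ∧ E t y + (D x y).toReal < m + 1 / (n + 1) := by
    intro n
    obtain ⟨v, ⟨y, hy, rfl⟩, hlt⟩ := exists_lt_of_csInf_lt hVne
      (show sInf V < m + 1 / (n + 1) by linarith [Nat.one_div_pos_of_nat (α := ℝ) (n := n)])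
    exact ⟨y, hy, hlt⟩
  choose y hyD hy using hex
  have hlim0 : Tendsto (fun n : ℕ => 1 / ((n : ℝ) + 1)) atTop (𝓝 0) :=
    tendsto_one_div_add_atTop_nhds_zero_nat
  have hsub : ∀ n, (t, y n) ∈ sublevel T z₀ F₀ d E (m + 1 + (d z₀ x).toReal + F₀) := by
    intro n
    refine ⟨ht, (hpert _ (hyD n)).trans ?_⟩
    have : 1 / ((n : ℝ) + 1) ≤ 1 := by
      rw [div_le_one (by positivity)]; linarith [Nat.cast_nonneg (α := ℝ) n]
    linarith [hy n]
  obtain ⟨⟨t', x'⟩, -, φ, hφ, hlim⟩ := S.lscCompact.compact _ hsub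
  have hx' : Tendsto (fun n => y (φ n)) atTop (𝓝 x') := (continuous_snd.tendsto _).comp hlim
  have ht' : t' = t :=
    tendsto_nhds_unique ((continuous_fst.tendsto _).comp hlim) tendsto_const_nhds
  subst ht'
  have hineq : ∀ ε > 0, 0 ≤ m - E t' x' + ε ∧ D x x' ≤ ENNReal.ofReal (m - E t' x' + ε) := by
    intro ε hε
    have h1 := S.eventually_lt_energy (fun n => hsub (φ n)) hlim
      (show E t' x' - ε < E t' x' by linarith)
    have h2 : Tendsto (fun n => m + 1 / ((φ n : ℝ) + 1) - E t' x' + ε) atTop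
        (𝓝 (m + 0 - E t' x' + ε)) :=
      (((hlim0.comp hφ.tendsto_atTop).const_add m).sub_const _).add_const ε
    rw [add_zero] at h2
    have h3 : ∀ᶠ n in atTop, (D x (y (φ n))).toReal ≤ m + 1 / ((φ n : ℝ) + 1) - E t' x' + ε := by
      filter_upwards [h1] with n hn
      linarith [hy (φ n)]
    refine ⟨ge_of_tendsto h2 (h3.mono fun n hn => ENNReal.toReal_nonneg.trans hn), ?_⟩
    refine le_of_tendsto_of_lsc hDlsc hx' (ENNReal.tendsto_ofReal h2) (h3.mono fun n hn => ?_)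
    rw [← ENNReal.ofReal_toReal (hyD (φ n))]
    exact ENNReal.ofReal_le_ofReal hn
  have hDfin : D x x' ≠ ⊤ := ne_top_of_le_ne_top ENNReal.ofReal_ne_top (hineq 1 one_pos).2
  have hmin : E t' x' + (D x x').toReal ≤ m := by
    refine le_of_forall_pos_le_add fun ε hε => ?_
    have := ENNReal.toReal_le_of_le_ofReal (hineq ε hε).1 (hineq ε hε).2
    linarith
  have hmin' : ∀ z, D x z ≠ ⊤ → E t' x' + (D x x').toReal ≤ E t' z + (D x z).toReal :=
    fun z hz => hmin.trans (csInf_le hVbdd ⟨z, hz, rfl⟩)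
  have hself := hmin' x (by simp [hDself])
  rw [hDself, ENNReal.toReal_zero, add_zero] at hself
  have hD0 : 0 ≤ (D x x').toReal := ENNReal.toReal_nonneg
  refine ⟨x', by linarith, ?_, fun z hz => by linarith [hmin' z hz]⟩
  have hres : residual E d (correction h d) t' x ≤
      ENNReal.ofReal (E t' x - E t' x' - (D x x').toReal) := by
    refine iSup_le fun z => ?_
    by_cases hz : D x z = ⊤
    · have : d x z + correction h d x z = ⊤ := hz
      rw [this, ENNReal.sub_top]; exact zero_le
    · rw [tsub_le_iff_right]
      change _ ≤ _ + D x z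
      rw [← ENNReal.ofReal_toReal hz, ← ENNReal.ofReal_add (by linarith) ENNReal.toReal_nonneg]
      exact ENNReal.ofReal_le_ofReal (by linarith [hmin' z hz])
  refine (add_le_add (ENNReal.ofReal_toReal hDfin).symm.le hres).trans ?_
  rw [← ENNReal.ofReal_add hD0 (by linarith)]
  exact ENNReal.ofReal_le_ofReal (by linarith)

end IsPreSystem

/-- A discrete solution issuing from `z` with mesh size `τ`: times `t k`, states `x k`, and the
parameter `s k` which is the sum of the elapsed time and of the energy released by the incremental
minimization steps so far. The sublevel `C` and the parameter bound `M` do not depend on the mesh;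
time stays at `T` from step `N` on. -/
structure IsScheme {Z : Type*} [TopologicalSpace Z] (T : ℝ) (z₀ : Z) (F₀ : ℝ)
    (d δ : Z → Z → ℝ≥0∞) (E : ℝ → Z → ℝ) (z : Z) (C M τ : ℝ) (N : ℕ) (t s : ℕ → ℝ) (x : ℕ → Z) :
    Prop where
  t_zero : t 0 = 0
  t_mono : Monotone t
  t_step : ∀ k, t (k + 1) - t k ≤ τ
  t_last : t N = T
  x_zero : x 0 = z
  s_zero : s 0 = 0
  s_le : ∀ k, s k ≤ M
  mem : ∀ k, (t k, x k) ∈ sublevel T z₀ F₀ d E C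
  mem_succ : ∀ k, (t (k + 1), x k) ∈ sublevel T z₀ F₀ d E C
  t_le_s : ∀ k, t (k + 1) - t k ≤ s (k + 1) - s k
  step : ∀ k, ENNReal.ofReal (t (k + 1) - t k) +
    (d (x k) (x (k + 1)) + δ (x k) (x (k + 1)) + residual E d δ (t (k + 1)) (x k)) ≤
      ENNReal.ofReal (s (k + 1) - s k)
  minimal : ∀ k y, d (x k) y + δ (x k) y ≠ ⊤ →
    E (t (k + 1)) (x (k + 1)) ≤ E (t (k + 1)) y + (d (x k) y + δ (x k) y).toReal
  balance : ∀ k, E (t k) (x k) + (s k - t k) =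
    E 0 z + ∑ i ∈ Finset.range k, (E (t (i + 1)) (x i) - E (t i) (x i))

namespace IsPreSystem

variable {Z : Type*} [TopologicalSpace Z] {T : ℝ} {z₀ : Z} {F₀ C_P : ℝ}
  {d : Z → Z → ℝ≥0∞} {E P : ℝ → Z → ℝ} {h : ℝ≥0 → ℝ≥0}

/-- Incremental minimization on uniform time grids. The growth estimate keeps all nodes in one
sublevel `C`, on which the energy is bounded below and Lipschitz in time; this bounds the parameter
by some `M`. Neither bound depends on the mesh. -/
theorem exists_scheme [T2Space Z] (S : IsPreSystem T z₀ F₀ C_P d E P h) (z : Z) :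
    ∃ C M : ℝ, ∀ n : ℕ, ∃ (t s : ℕ → ℝ) (x : ℕ → Z),
      IsScheme T z₀ F₀ d (correction h d) E z C M (T / (n + 1)) (n + 1) t s x := by
  set G₀ := perturbedEnergy z₀ F₀ d E 0 z + 1 with hG₀
  set C := G₀ * Real.exp (C_P * T) with hC
  have hG0 : 0 < G₀ := by
    have := S.perturbedEnergy_nonneg ⟨le_rfl, S.T_pos.le⟩ z
    linarith
  obtain ⟨m, hm⟩ := S.exists_energy_lower_bound C
  obtain ⟨L, hL⟩ := S.energy_sub_le (C := C)
  refine ⟨C, T + (E 0 z - m + L * T), fun n => ?_⟩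
  set τ := T / ((n : ℝ) + 1) with hτ
  have hτ0 : 0 < τ := div_pos S.T_pos (by positivity)
  set t : ℕ → ℝ := fun k => min (k * τ) T with ht
  have htm : Monotone t := fun j k hjk =>
    min_le_min_right _ (mul_le_mul_of_nonneg_right (by exact_mod_cast hjk) hτ0.le)
  have htmem : ∀ k, t k ∈ Icc 0 T := fun k =>
    ⟨le_min (by positivity) S.T_pos.le, min_le_right _ _⟩
  have ht0 : t 0 = 0 := by simp [ht, S.T_pos.le]
  choose! f hf0 hf1 hf2 using fun (r : ℝ) (hr : r ∈ Icc 0 T) => S.exists_incremental_minimizer hr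
  let x : ℕ → Z := fun k => Nat.rec z (fun k x => f (t (k + 1)) x) k
  have hx : ∀ k, x (k + 1) = f (t (k + 1)) (x k) := fun k => rfl
  set a : ℕ → ℝ := fun k => E (t (k + 1)) (x k) - E (t (k + 1)) (x (k + 1)) with ha
  have ha0 : ∀ k, 0 ≤ a k := fun k => hf0 _ (htmem _) _
  set s : ℕ → ℝ := fun k => t k + ∑ i ∈ Finset.range k, a i with hs
  have hgrow : ∀ k, perturbedEnergy z₀ F₀ d E (t k) (x k) + 1 ≤ G₀ * Real.exp (C_P * t k) ∧
      perturbedEnergy z₀ F₀ d E (t (k + 1)) (x k) + 1 ≤ G₀ * Real.exp (C_P * t (k + 1)) := by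
    have hstep : ∀ k, perturbedEnergy z₀ F₀ d E (t k) (x k) + 1 ≤ G₀ * Real.exp (C_P * t k) →
        perturbedEnergy z₀ F₀ d E (t (k + 1)) (x k) + 1 ≤ G₀ * Real.exp (C_P * t (k + 1)) := by
      intro k hk
      refine (S.growth_forward (x k) (htmem k).1 (htm (Nat.le_succ k)) (htmem _).2).trans ?_
      refine (mul_le_mul_of_nonneg_right hk (Real.exp_pos _).le).trans (le_of_eq ?_)
      rw [mul_assoc, ← Real.exp_add]; congr 2; ring
    intro k
    induction k with
    | zero =>
      have h0 : perturbedEnergy z₀ F₀ d E (t 0) (x 0) + 1 ≤ G₀ * Real.exp (C_P * t 0) := by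
        rw [ht0, mul_zero, Real.exp_zero, mul_one]
        exact hG₀.ge
      exact ⟨h0, hstep 0 h0⟩
    | succ k ih =>
      have h0 : perturbedEnergy z₀ F₀ d E (t (k + 1)) (x (k + 1)) + 1 ≤
          G₀ * Real.exp (C_P * t (k + 1)) := by
        refine le_trans ?_ ih.2
        have h1 : d (x k) (x (k + 1)) ≤ ENNReal.ofReal (a k) :=
          le_trans (le_trans le_self_add le_self_add) (hf1 _ (htmem (k + 1)) (x k))
        have h2 := ENNReal.toReal_mono (ENNReal.add_ne_top.2
          ⟨S.dist.finite_from (x k), ENNReal.ofReal_ne_top⟩)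
          ((S.dist.triangle z₀ (x k) (x (k + 1))).trans (add_le_add_right h1 _))
        rw [ENNReal.toReal_add (S.dist.finite_from (x k)) ENNReal.ofReal_ne_top,
          ENNReal.toReal_ofReal (ha0 k)] at h2
        simp only [ha] at h2
        simp only [perturbedEnergy]
        linarith
      exact ⟨h0, hstep _ h0⟩
  have hexp : ∀ k, G₀ * Real.exp (C_P * t k) ≤ C := fun k =>
    mul_le_mul_of_nonneg_left (Real.exp_le_exp.2
      (mul_le_mul_of_nonneg_left (htmem k).2 S.C_pos.le)) hG0.le
  have hmem : ∀ k, (t k, x k) ∈ sublevel T z₀ F₀ d E C := fun k =>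
    ⟨htmem k, by have := (hgrow k).1; have := hexp k; simp only; linarith⟩
  have hmem' : ∀ k, (t (k + 1), x k) ∈ sublevel T z₀ F₀ d E C := fun k =>
    ⟨htmem _, by have := (hgrow k).2; have := hexp (k + 1); simp only; linarith⟩
  have hbal : ∀ k, E (t k) (x k) + (s k - t k) =
      E 0 z + ∑ i ∈ Finset.range k, (E (t (i + 1)) (x i) - E (t i) (x i)) := by
    intro k
    induction k with
    | zero => simp [hs, ht0, x]
    | succ k ih =>
      simp only [hs, Finset.sum_range_succ] at ih ⊢
      simp only [ha] at ih ⊢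
      linarith
  refine ⟨t, s, x, ht0, htm, fun k => ?_, ?_, rfl, by simp [hs, ht0], fun k => ?_, hmem, hmem',
    fun k => ?_, fun k => ?_, fun k y hy => hf2 _ (htmem _) _ y hy, hbal⟩
  · simp only [ht]
    push_cast
    rcases le_total ((k : ℝ) * τ) T with h1 | h1
    · rw [min_eq_left h1]; linarith [min_le_left (((k : ℝ) + 1) * τ) T]
    · rw [min_eq_right h1]; linarith [min_le_right (((k : ℝ) + 1) * τ) T]
  · simp only [ht, hτ]
    push_cast
    rw [mul_div_cancel₀ _ (by positivity), min_self]
  · have h1 : ∑ i ∈ Finset.range k, (E (t (i + 1)) (x i) - E (t i) (x i)) ≤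
        ∑ i ∈ Finset.range k, L * (t (i + 1) - t i) := Finset.sum_le_sum fun i _ => by
      have := hL (x i) ⟨_, hmem i⟩ (t i) (htmem i) (t (i + 1)) (htmem _)
      rw [abs_of_nonneg (sub_nonneg.2 (htm (Nat.le_succ i)))] at this
      exact (le_abs_self _).trans this
    rw [← Finset.mul_sum, Finset.sum_range_sub, ht0, sub_zero] at h1
    have h2 : (L : ℝ) * t k ≤ L * T := mul_le_mul_of_nonneg_left (htmem k).2 L.2
    have h3 := hm _ (hmem k)
    simp only at h3
    linarith [hbal k, (htmem k).2]
  · simp only [hs, Finset.sum_range_succ]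
    linarith [ha0 k]
  · refine (add_le_add_right (hf1 _ (htmem (k + 1)) (x k)) _).trans ?_
    rw [← ENNReal.ofReal_add (sub_nonneg.2 (htm (Nat.le_succ k))) (hf0 _ (htmem _) _)]
    refine ENNReal.ofReal_le_ofReal (le_of_eq ?_)
    simp only [hs, Finset.sum_range_succ, ha, hx]
    ring

end IsPreSystem

/-- Each point of a closed set below another one is either the left end point of a hole, or a limit
of points of the set from the right. -/
theorem exists_hole_or_forall_exists {B : Set ℝ} (hB : IsClosed B) {r s : ℝ} (hr : r ∈ B)
    (hs : s ∈ B) (hrs : r < s) :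
    (∃ b, (r, b) ∈ holes B) ∨ ∀ ε > 0, ∃ r' ∈ B, r < r' ∧ r' < r + ε := by
  by_cases hcase : ∀ ε > 0, ∃ r' ∈ B, r < r' ∧ r' < r + ε
  · exact Or.inr hcase
  left
  push Not at hcase
  obtain ⟨ε, hε, H⟩ := hcase
  have hne : (B ∩ Ici (r + ε)).Nonempty := ⟨s, hs, H s hs hrs⟩
  have hbd : BddBelow (B ∩ Ici (r + ε)) := ⟨r + ε, fun x hx => hx.2⟩
  have hmem := (hB.inter isClosed_Ici).csInf_mem hne hbd
  set b := sInf (B ∩ Ici (r + ε))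
  refine ⟨b, hr, hmem.1, lt_of_lt_of_le (by linarith) hmem.2, ?_⟩
  rw [Set.disjoint_left]
  intro x hx hxB
  exact absurd (csInf_le hbd ⟨hxB, H x hxB hx.1⟩) (not_le.2 hx.2)

/-! ### Limits of the discrete solutions -/

/-- The distance on `ℝ × Z` that adds the elapsed time to the distance of the states. -/
noncomputable def timeDist {Z : Type*} (d : Z → Z → ℝ≥0∞) (p q : ℝ × Z) : ℝ≥0∞ :=
  ENNReal.ofReal |q.1 - p.1| + d p.2 q.2

/-- A limit `(A, θ)` of the parametrized discrete solutions `(t n, s n, x n)` along vanishing mesh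
sizes: `A` is the limit of the sets of nodes, and `θ r = (time, state)` is the limit of the values
at nodes that converge to `r`. -/
structure IsLimitCurve {Z : Type*} [TopologicalSpace Z] (T : ℝ) (z₀ : Z) (F₀ : ℝ)
    (d δ : Z → Z → ℝ≥0∞) (E : ℝ → Z → ℝ) (z : Z) (C M : ℝ) (τ : ℕ → ℝ) (N : ℕ → ℕ)
    (t s : ℕ → ℕ → ℝ) (x : ℕ → ℕ → Z) (A : Set ℝ) (θ : ℝ → ℝ × Z) : Prop where
  scheme : ∀ n, IsScheme T z₀ F₀ d δ E z C M (τ n) (N n) (t n) (s n) (x n)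
  mesh : Tendsto τ atTop (𝓝 0)
  closed : IsClosed A
  limit : ∀ (ψ k : ℕ → ℕ) (r : ℝ), Tendsto ψ atTop atTop → (∀ᶠ i in atTop, k i ≤ N (ψ i)) →
    Tendsto (fun i => s (ψ i) (k i)) atTop (𝓝 r) →
    r ∈ A ∧ Tendsto (fun i => (t (ψ i) (k i), x (ψ i) (k i))) atTop (𝓝 (θ r))
  approx : ∀ r ∈ A, ∃ k : ℕ → ℕ, (∀ n, k n ≤ N n) ∧ Tendsto (fun n => s n (k n)) atTop (𝓝 r)

namespace IsScheme

variable {Z : Type*} [TopologicalSpace Z] {T : ℝ} {z₀ : Z} {F₀ : ℝ}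
  {d δ : Z → Z → ℝ≥0∞} {E : ℝ → Z → ℝ} {z : Z} {C M τ : ℝ} {N : ℕ} {t s : ℕ → ℝ} {x : ℕ → Z}

theorem s_mono (H : IsScheme T z₀ F₀ d δ E z C M τ N t s x) : Monotone s :=
  monotone_nat_of_le_succ fun k => by
    linarith [H.t_le_s k, H.t_mono (Nat.le_succ k)]

theorem s_nonneg (H : IsScheme T z₀ F₀ d δ E z C M τ N t s x) (k : ℕ) : 0 ≤ s k :=
  H.s_zero.symm.le.trans (H.s_mono (Nat.zero_le k))

theorem chain (H : IsScheme T z₀ F₀ d δ E z C M τ N t s x) (hself : ∀ x, d x x = 0)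
    (htri : ∀ x y z, d x z ≤ d x y + d y z) {j k : ℕ} (hjk : j ≤ k) :
    timeDist d (t j, x j) (t k, x k) ≤ ENNReal.ofReal (s k - s j) := by
  induction k, hjk using Nat.le_induction with
  | base => simp [timeDist, hself]
  | succ k hjk ih =>
    have h1 := H.t_mono hjk
    have h2 := H.t_mono (Nat.le_succ k)
    simp only [timeDist, abs_of_nonneg (sub_nonneg.2 h1),
      abs_of_nonneg (sub_nonneg.2 (h1.trans h2))] at ih ⊢
    have h3 : ENNReal.ofReal (t (k + 1) - t k) + d (x k) (x (k + 1)) ≤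
        ENNReal.ofReal (s (k + 1) - s k) :=
      (add_le_add_right (le_self_add.trans le_self_add) _).trans (H.step k)
    calc ENNReal.ofReal (t (k + 1) - t j) + d (x j) (x (k + 1))
        ≤ (ENNReal.ofReal (t k - t j) + ENNReal.ofReal (t (k + 1) - t k)) +
          (d (x j) (x k) + d (x k) (x (k + 1))) := by
          refine add_le_add ?_ (htri _ _ _)
          rw [← ENNReal.ofReal_add (sub_nonneg.2 h1) (sub_nonneg.2 h2)]
          exact ENNReal.ofReal_le_ofReal (by linarith)
      _ = (ENNReal.ofReal (t k - t j) + d (x j) (x k)) +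
          (ENNReal.ofReal (t (k + 1) - t k) + d (x k) (x (k + 1))) := by ring
      _ ≤ _ := add_le_add ih h3
      _ = _ := by
        rw [← ENNReal.ofReal_add (sub_nonneg.2 (H.s_mono hjk))
          (sub_nonneg.2 (H.s_mono (Nat.le_succ k)))]
        congr 1; ring

/-- Consecutive nodes that enclose the time `r`. -/
theorem exists_node (H : IsScheme T z₀ F₀ d δ E z C M τ N t s x) {r : ℝ} (hr : r ∈ Icc 0 T)
    (hN : N ≠ 0) : ∃ k < N, t k ≤ r ∧ r ≤ t (k + 1) := by
  classical
  obtain ⟨k, hk⟩ : ∃ k, k = Nat.findGreatest (fun k => t k ≤ r) (N - 1) := ⟨_, rfl⟩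
  have hk1 : t k ≤ r := by
    rw [hk]
    exact Nat.findGreatest_spec (P := fun k => t k ≤ r) (m := 0) (Nat.zero_le _)
      (by rw [H.t_zero]; exact hr.1)
  have hkN : k ≤ N - 1 := by rw [hk]; exact Nat.findGreatest_le _
  refine ⟨k, by omega, hk1, ?_⟩
  by_contra hlt
  rcases Nat.lt_or_ge k (N - 1) with h | h
  · have := Nat.le_findGreatest (P := fun k => t k ≤ r) (m := k + 1) (n := N - 1) (by omega)
      (not_le.1 hlt).le
    omega
  · have h3 : k + 1 = N := by omega
    rw [h3, H.t_last] at hlt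
    exact hlt hr.2

end IsScheme

namespace IsSystem

variable {Z : Type*} [TopologicalSpace Z] {T : ℝ} {z₀ : Z} {F₀ C_P : ℝ}
  {d : Z → Z → ℝ≥0∞} {E P : ℝ → Z → ℝ} {h : ℝ≥0 → ℝ≥0}

theorem timeDist_lsc (S : IsSystem T z₀ F₀ C_P d E P h) :
    LowerSemicontinuous fun p : (ℝ × Z) × (ℝ × Z) => timeDist d p.1 p.2 := by
  refine LowerSemicontinuous.add (Continuous.lowerSemicontinuous ?_) ?_
  · exact ENNReal.continuous_ofReal.comp (by fun_prop)
  · exact S.dist.lsc.comp ((continuous_snd.comp continuous_fst).prodMk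
      (continuous_snd.comp continuous_snd))

theorem timeDist_sep (S : IsSystem T z₀ F₀ C_P d E P h) (p q : ℝ × Z) (hpq : timeDist d p q = 0) :
    p = q := by
  obtain ⟨h1, h2⟩ := add_eq_zero.1 hpq
  rw [ENNReal.ofReal_eq_zero] at h1
  have h3 : q.1 - p.1 = 0 := abs_eq_zero.1 (le_antisymm h1 (abs_nonneg _))
  exact Prod.ext (by linarith) (S.sep _ _ h2)

/-- Compactness of the discrete solutions: along a subsequence of meshes they have a limit curve. -/
theorem exists_limitCurve [T2Space Z] (S : IsSystem T z₀ F₀ C_P d E P h) (z : Z) :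
    ∃ C M τ N t s x A θ, (∀ n, N n ≠ 0) ∧
      IsLimitCurve T z₀ F₀ d (correction h d) E z C M τ N t s x A θ := by
  obtain ⟨C, M, H⟩ := S.exists_scheme z
  choose t s x H using H
  obtain ⟨φ, hφ, A, θ, hA, h1, h2⟩ := exists_limit_chain (S.lscCompact.compact C)
    S.timeDist_lsc S.timeDist_sep (N := fun n => n + 1) (s := s) (y := fun n k => (t n k, x n k))
    (fun n => (H n).s_mono) (fun n => (H n).s_zero) (fun n => (H n).s_le) (fun n => (H n).mem)
    (fun n j k hjk => (H n).chain S.dist.self_eq_zero S.dist.triangle hjk)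
  refine ⟨C, M, fun n => T / (φ n + 1), fun n => φ n + 1, fun n => t (φ n), fun n => s (φ n),
    fun n => x (φ n), A, θ, fun n => Nat.succ_ne_zero _, fun n => H (φ n), ?_, hA, h1, h2⟩
  have := (tendsto_one_div_add_atTop_nhds_zero_nat (𝕜 := ℝ)).comp hφ.tendsto_atTop
  simpa [Function.comp_def, div_eq_mul_inv] using this.const_mul T

end IsSystem

/-! ### Structure of the limit curve -/

namespace IsLimitCurve

variable {Z : Type*} [TopologicalSpace Z] {T : ℝ} {z₀ : Z} {F₀ C_P : ℝ}
  {d : Z → Z → ℝ≥0∞} {E P : ℝ → Z → ℝ} {h : ℝ≥0 → ℝ≥0} {z : Z} {C M : ℝ} {τ : ℕ → ℝ} {N : ℕ → ℕ}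
  {t s : ℕ → ℕ → ℝ} {x : ℕ → ℕ → Z} {A : Set ℝ} {θ : ℝ → ℝ × Z}

theorem subset_Icc (L : IsLimitCurve T z₀ F₀ d (correction h d) E z C M τ N t s x A θ) :
    A ⊆ Icc 0 M := fun r hr => by
  obtain ⟨k, -, hk⟩ := L.approx r hr
  exact isClosed_Icc.mem_of_tendsto hk
    (Eventually.of_forall fun n => ⟨(L.scheme n).s_nonneg _, (L.scheme n).s_le _⟩)

theorem isCompact (L : IsLimitCurve T z₀ F₀ d (correction h d) E z C M τ N t s x A θ) :
    IsCompact A :=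
  isCompact_Icc.of_isClosed_subset L.closed L.subset_Icc

theorem limit_id (L : IsLimitCurve T z₀ F₀ d (correction h d) E z C M τ N t s x A θ)
    {k : ℕ → ℕ} {r : ℝ} (hk : ∀ᶠ n in atTop, k n ≤ N n)
    (hr : Tendsto (fun n => s n (k n)) atTop (𝓝 r)) :
    r ∈ A ∧ Tendsto (fun n => (t n (k n), x n (k n))) atTop (𝓝 (θ r)) :=
  L.limit id k r tendsto_id hk hr

theorem zero_mem [T2Space Z] (L : IsLimitCurve T z₀ F₀ d (correction h d) E z C M τ N t s x A θ) :
    0 ∈ A ∧ θ 0 = (0, z) := by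
  obtain ⟨h1, h2⟩ := L.limit_id (k := fun _ => 0) (r := 0)
    (Eventually.of_forall fun n => Nat.zero_le _) (by simp [(L.scheme _).s_zero])
  refine ⟨h1, tendsto_nhds_unique h2 ?_⟩
  simp only [(L.scheme _).t_zero, (L.scheme _).x_zero]
  exact tendsto_const_nhds

theorem mem_sublevel [T2Space Z]
    (L : IsLimitCurve T z₀ F₀ d (correction h d) E z C M τ N t s x A θ)
    (S : IsSystem T z₀ F₀ C_P d E P h) {r : ℝ} (hr : r ∈ A) :
    θ r ∈ sublevel T z₀ F₀ d E C := by
  obtain ⟨k, hkN, hk⟩ := L.approx r hr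
  exact S.mem_sublevel_of_tendsto (fun n => (L.scheme n).mem (k n))
    (L.limit_id (Eventually.of_forall hkN) hk).2

theorem chain (L : IsLimitCurve T z₀ F₀ d (correction h d) E z C M τ N t s x A θ)
    (S : IsSystem T z₀ F₀ C_P d E P h) {r r' : ℝ} (hr : r ∈ A) (hr' : r' ∈ A) (hrr : r ≤ r') :
    (θ r).1 ≤ (θ r').1 ∧ timeDist d (θ r) (θ r') ≤ ENNReal.ofReal (r' - r) := by
  rcases hrr.eq_or_lt with rfl | hlt
  · simp [timeDist, S.dist.self_eq_zero]
  obtain ⟨k, hkN, hk⟩ := L.approx r hr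
  obtain ⟨k', hkN', hk'⟩ := L.approx r' hr'
  have h1 := (L.limit_id (Eventually.of_forall hkN) hk).2
  have h2 := (L.limit_id (Eventually.of_forall hkN') hk').2
  have hev : ∀ᶠ n in atTop, k n ≤ k' n := by
    filter_upwards [hk.eventually_lt hk' hlt] with n hn
    by_contra hcon
    exact absurd ((L.scheme n).s_mono (not_le.1 hcon).le) (not_le.2 hn)
  refine ⟨le_of_tendsto_of_tendsto ((continuous_fst.tendsto _).comp h1)
    ((continuous_fst.tendsto _).comp h2) ?_, ?_⟩
  · filter_upwards [hev] with n hn using (L.scheme n).t_mono hn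
  · refine le_of_tendsto_of_lsc S.timeDist_lsc (h1.prodMk_nhds h2)
      (ENNReal.tendsto_ofReal (hk'.sub hk)) ?_
    filter_upwards [hev] with n hn
    exact (L.scheme n).chain S.dist.self_eq_zero S.dist.triangle hn

theorem dist_le (L : IsLimitCurve T z₀ F₀ d (correction h d) E z C M τ N t s x A θ)
    (S : IsSystem T z₀ F₀ C_P d E P h) {r r' : ℝ} (hr : r ∈ A) (hr' : r' ∈ A) (hrr : r ≤ r') :
    d (θ r).2 (θ r').2 ≤ ENNReal.ofReal (r' - r - ((θ r').1 - (θ r).1)) := by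
  obtain ⟨h1, h2⟩ := L.chain S hr hr' hrr
  rw [timeDist, abs_of_nonneg (sub_nonneg.2 h1)] at h2
  rw [ENNReal.ofReal_sub _ (sub_nonneg.2 h1)]
  exact ENNReal.le_sub_of_add_le_left ENNReal.ofReal_ne_top h2

theorem time_sub_le (L : IsLimitCurve T z₀ F₀ d (correction h d) E z C M τ N t s x A θ)
    (S : IsSystem T z₀ F₀ C_P d E P h) {r r' : ℝ} (hr : r ∈ A) (hr' : r' ∈ A) (hrr : r ≤ r') :
    (θ r').1 - (θ r).1 ≤ r' - r := by
  obtain ⟨h1, h2⟩ := L.chain S hr hr' hrr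
  rw [timeDist, abs_of_nonneg (sub_nonneg.2 h1)] at h2
  exact (ENNReal.ofReal_le_ofReal_iff (sub_nonneg.2 hrr)).1 (le_self_add.trans h2)

theorem tendsto_comp [T2Space Z]
    (L : IsLimitCurve T z₀ F₀ d (correction h d) E z C M τ N t s x A θ)
    (S : IsSystem T z₀ F₀ C_P d E P h) {ι : Type*} {l : Filter ι} [l.IsCountablyGenerated]
    {a : ι → ℝ} {r : ℝ} (ha : ∀ᶠ i in l, a i ∈ A) (hr : r ∈ A) (har : Tendsto a l (𝓝 r)) :
    Tendsto (fun i => θ (a i)) l (𝓝 (θ r)) := by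
  have hε : Tendsto (fun i => ENNReal.ofReal |a i - r|) l (𝓝 0) := by
    have := ENNReal.tendsto_ofReal (har.sub_const r).abs
    simpa using this
  refine tendsto_of_min_dist_tendsto (S.lscCompact.compact C) S.timeDist_lsc S.timeDist_sep
    (ha.mono fun i hi => L.mem_sublevel S hi) hε ?_
  filter_upwards [ha] with i hi
  rcases le_total (a i) r with hle | hle
  · rw [abs_sub_comm, abs_of_nonneg (sub_nonneg.2 hle)]
    exact (min_le_left _ _).trans (L.chain S hi hr hle).2
  · rw [abs_of_nonneg (sub_nonneg.2 hle)]
    exact (min_le_right _ _).trans (L.chain S hr hi hle).2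

theorem continuousOn [T2Space Z]
    (L : IsLimitCurve T z₀ F₀ d (correction h d) E z C M τ N t s x A θ)
    (S : IsSystem T z₀ F₀ C_P d E P h) : ContinuousOn θ A := fun _ hr =>
  L.tendsto_comp S self_mem_nhdsWithin hr nhdsWithin_le_nhds

/-- A sequence of nodes whose parameters have only one possible limit point converges. -/
theorem tendsto_node (L : IsLimitCurve T z₀ F₀ d (correction h d) E z C M τ N t s x A θ)
    {k : ℕ → ℕ} (hk : ∀ᶠ n in atTop, k n ≤ N n) {r₀ : ℝ}
    (H : ∀ (ψ : ℕ → ℕ) (r : ℝ), Tendsto ψ atTop atTop → r ∈ A →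
      Tendsto (fun i => s (ψ i) (k (ψ i))) atTop (𝓝 r) →
      Tendsto (fun i => (t (ψ i) (k (ψ i)), x (ψ i) (k (ψ i)))) atTop (𝓝 (θ r)) → r = r₀) :
    Tendsto (fun n => s n (k n)) atTop (𝓝 r₀) := by
  refine tendsto_of_subseq_tendsto fun ns hns => ?_
  obtain ⟨r, -, φ, hφ, hlim⟩ := (isCompact_Icc (a := (0 : ℝ)) (b := M)).isSeqCompact
    (x := fun i => s (ns i) (k (ns i))) fun i => ⟨(L.scheme _).s_nonneg _, (L.scheme _).s_le _⟩
  have hψ : Tendsto (fun i => ns (φ i)) atTop atTop := hns.comp hφ.tendsto_atTop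
  obtain ⟨h1, h2⟩ :=
    L.limit (fun i => ns (φ i)) (fun i => k (ns (φ i))) r hψ (hψ.eventually hk) hlim
  have := H _ r hψ h1 hlim h2
  subst this
  exact ⟨φ, hlim⟩

/-- The limit curve passes through every time, because the mesh sizes vanish. -/
theorem exists_time_eq [T2Space Z]
    (L : IsLimitCurve T z₀ F₀ d (correction h d) E z C M τ N t s x A θ) (hN : ∀ n, N n ≠ 0)
    {r : ℝ} (hr : r ∈ Icc 0 T) : ∃ a ∈ A, (θ a).1 = r := by
  choose k hkN hk1 hk2 using fun n => (L.scheme n).exists_node hr (hN n)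
  obtain ⟨a, -, φ, hφ, hlim⟩ := (isCompact_Icc (a := (0 : ℝ)) (b := M)).isSeqCompact
    (x := fun i => s i (k i)) fun i => ⟨(L.scheme _).s_nonneg _, (L.scheme _).s_le _⟩
  obtain ⟨h1, h2⟩ := L.limit φ (fun i => k (φ i)) a hφ.tendsto_atTop
    (Eventually.of_forall fun i => (hkN _).le) hlim
  refine ⟨a, h1, tendsto_nhds_unique ((continuous_fst.tendsto _).comp h2) ?_⟩
  have h3 : Tendsto (fun n => r - τ (φ n)) atTop (𝓝 r) := by
    simpa using (L.mesh.comp hφ.tendsto_atTop).const_sub r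
  refine tendsto_of_tendsto_of_tendsto_of_le_of_le h3 tendsto_const_nhds (fun n => ?_)
    (fun n => hk1 _)
  have := (L.scheme (φ n)).t_step (k (φ n))
  have := hk2 (φ n)
  simp only [Function.comp]
  linarith

theorem tendsto_time_succ
    (L : IsLimitCurve T z₀ F₀ d (correction h d) E z C M τ N t s x A θ)
    {k : ℕ → ℕ} {a : ℝ} (h1 : Tendsto (fun n => t n (k n)) atTop (𝓝 a)) :
    Tendsto (fun n => t n (k n + 1)) atTop (𝓝 a) := by
  have h2 : Tendsto (fun n => t n (k n) + τ n) atTop (𝓝 a) := by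
    simpa using h1.add L.mesh
  refine tendsto_of_tendsto_of_tendsto_of_le_of_le h1 h2
    (fun n => (L.scheme n).t_mono (Nat.le_succ _)) (fun n => ?_)
  have := (L.scheme n).t_step (k n)
  simp only
  linarith

/-- Across a hole of the limit parameter set the time is frozen, and the length of the hole pays
for the distance, the correction and the residual. -/
theorem hole [T2Space Z] (L : IsLimitCurve T z₀ F₀ d (correction h d) E z C M τ N t s x A θ)
    (S : IsSystem T z₀ F₀ C_P d E P h) {a b : ℝ} (hab : (a, b) ∈ holes A) :
    (θ a).1 = (θ b).1 ∧
    d (θ a).2 (θ b).2 + correction h d (θ a).2 (θ b).2 +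
      residual E d (correction h d) (θ b).1 (θ a).2 ≤ ENNReal.ofReal (b - a) := by
  classical
  obtain ⟨ha, hb, hlt, hdisj⟩ := hab
  simp only at ha hb hlt hdisj
  have hnone : ∀ r ∈ A, a ≤ r → r ≤ b → r = a ∨ r = b := by
    intro r hr h1 h2
    by_contra hcon
    push Not at hcon
    exact Set.disjoint_left.1 hdisj
      ⟨lt_of_le_of_ne h1 (Ne.symm hcon.1), lt_of_le_of_ne h2 hcon.2⟩ hr
  obtain ⟨ka, hkaN, hka⟩ := L.approx a ha
  obtain ⟨kb, hkbN, hkb⟩ := L.approx b hb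
  set q := (a + b) / 2 with hq
  -- the last node before the middle of the hole, and its successor
  obtain ⟨j, hj⟩ : ∃ j : ℕ → ℕ, j = fun n => Nat.findGreatest (fun k => s n k ≤ q) (N n) := ⟨_, rfl⟩
  have ha0 := (L.subset_Icc ha).1
  have hjN : ∀ n, j n ≤ N n := fun n => by rw [hj]; exact Nat.findGreatest_le _
  have hjq : ∀ n, s n (j n) ≤ q := fun n => by
    rw [hj]
    exact Nat.findGreatest_spec (P := fun k => s n k ≤ q) (m := 0) (Nat.zero_le _)
      (by rw [(L.scheme n).s_zero]; linarith)
  have hjmax : ∀ n k, k ≤ N n → s n k ≤ q → k ≤ j n := fun n k h1 h2 => by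
    rw [hj]; exact Nat.le_findGreatest h1 h2
  have hkaj : ∀ᶠ n in atTop, ka n ≤ j n := by
    filter_upwards [hka.eventually (gt_mem_nhds (show a < q by linarith))] with n hn
    exact hjmax n _ (hkaN n) hn.le
  have hjkb : ∀ᶠ n in atTop, j n + 1 ≤ kb n := by
    filter_upwards [hkb.eventually (lt_mem_nhds (show q < b by linarith))] with n hn
    by_contra hcon
    have := (L.scheme n).s_mono (show kb n ≤ j n by omega)
    linarith [hjq n]
  have hjs : ∀ᶠ n in atTop, q < s n (j n + 1) := by
    filter_upwards [hjkb] with n hn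
    by_contra hcon
    have := hjmax n (j n + 1) (hn.trans (hkbN n)) (not_lt.1 hcon)
    omega
  have hj1 : Tendsto (fun n => s n (j n)) atTop (𝓝 a) := by
    refine L.tendsto_node (Eventually.of_forall hjN) fun ψ r hψ hr hlim _ => ?_
    have h1 : r ≤ q := le_of_tendsto hlim (Eventually.of_forall fun i => hjq _)
    have h2 : a ≤ r := le_of_tendsto_of_tendsto (hka.comp hψ) hlim
      ((hψ.eventually hkaj).mono fun i hi => (L.scheme _).s_mono hi)
    rcases hnone r hr h2 (by linarith) with h3 | h3
    · exact h3
    · linarith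
  have hj1N : ∀ᶠ n in atTop, j n + 1 ≤ N n := hjkb.mono fun n hn => hn.trans (hkbN n)
  have hj2 : Tendsto (fun n => s n (j n + 1)) atTop (𝓝 b) := by
    refine L.tendsto_node (k := fun n => j n + 1) hj1N fun ψ r hψ hr hlim _ => ?_
    have h1 : q ≤ r := ge_of_tendsto hlim ((hψ.eventually hjs).mono fun i hi => hi.le)
    have h2 : r ≤ b := le_of_tendsto_of_tendsto hlim (hkb.comp hψ)
      ((hψ.eventually hjkb).mono fun i hi => (L.scheme _).s_mono hi)
    rcases hnone r hr (by linarith) h2 with h3 | h3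
    · linarith
    · exact h3
  have hθa := (L.limit_id (Eventually.of_forall hjN) hj1).2
  have hθb := (L.limit_id (k := fun n => j n + 1) hj1N hj2).2
  have hta : Tendsto (fun n => t n (j n)) atTop (𝓝 (θ a).1) := (continuous_fst.tendsto _).comp hθa
  have htb : Tendsto (fun n => t n (j n + 1)) atTop (𝓝 (θ b).1) :=
    (continuous_fst.tendsto _).comp hθb
  have hxa : Tendsto (fun n => x n (j n)) atTop (𝓝 (θ a).2) := (continuous_snd.tendsto _).comp hθa
  have hxb : Tendsto (fun n => x n (j n + 1)) atTop (𝓝 (θ b).2) :=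
    (continuous_snd.tendsto _).comp hθb
  refine ⟨tendsto_nhds_unique (L.tendsto_time_succ hta) htb, ?_⟩
  have h1 := S.residual_le_of_tendsto (p := fun n => (t n (j n + 1), x n (j n)))
    (q := ((θ b).1, (θ a).2)) (C := C) (fun n => (L.scheme n).mem_succ _) (htb.prodMk_nhds hxa)
  have h2 := le_liminf_of_tendsto S.dist.lsc (hxa.prodMk_nhds hxb)
  have h3 := le_liminf_of_tendsto S.correction_lsc (hxa.prodMk_nhds hxb)
  refine (add_le_add ((add_le_add h2 h3).trans add_liminf_le_liminf_add) h1).trans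
    (add_liminf_le_liminf_add.trans ?_)
  rw [← (ENNReal.tendsto_ofReal (hj2.sub hj1)).liminf_eq]
  exact liminf_le_liminf (Eventually.of_forall fun n =>
    le_add_self.trans ((L.scheme n).step (j n)))

/-- The limit of the dissipation of the next minimization step bounds the residual at each point
that is followed by another one. -/
theorem residual_le [T2Space Z]
    (L : IsLimitCurve T z₀ F₀ d (correction h d) E z C M τ N t s x A θ)
    (S : IsSystem T z₀ F₀ C_P d E P h) {a b : ℝ} (ha : a ∈ A) (hb : b ∈ A) (hab : a < b) :
    residual E d (correction h d) (θ a).1 (θ a).2 ≤ ENNReal.ofReal (b - a) := by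
  obtain ⟨k, hkN, hk⟩ := L.approx a ha
  obtain ⟨k', hkN', hk'⟩ := L.approx b hb
  have h1 := (L.limit_id (Eventually.of_forall hkN) hk).2
  have hta : Tendsto (fun n => t n (k n)) atTop (𝓝 (θ a).1) := (continuous_fst.tendsto _).comp h1
  have hxa : Tendsto (fun n => x n (k n)) atTop (𝓝 (θ a).2) := (continuous_snd.tendsto _).comp h1
  refine (S.residual_le_of_tendsto (p := fun n => (t n (k n + 1), x n (k n))) (q := θ a) (C := C)
    (fun n => (L.scheme n).mem_succ _) ((L.tendsto_time_succ hta).prodMk_nhds hxa)).trans ?_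
  rw [← (ENNReal.tendsto_ofReal (hk'.sub hk)).liminf_eq]
  refine liminf_le_liminf ?_
  filter_upwards [hk.eventually_lt hk' hab] with n hn
  have hlt : k n + 1 ≤ k' n := by
    by_contra hcon
    exact absurd ((L.scheme n).s_mono (show k' n ≤ k n by omega)) (not_le.2 hn)
  refine le_trans ?_ (ENNReal.ofReal_le_ofReal
    (sub_le_sub_right ((L.scheme n).s_mono hlt) (s n (k n))))
  exact le_trans (le_add_self.trans le_add_self) ((L.scheme n).step (k n))

/-- The set of parameters at which the limit curve is at time `r`. -/
def fiber (A : Set ℝ) (θ : ℝ → ℝ × Z) (r : ℝ) : Set ℝ := {a ∈ A | (θ a).1 = r}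

theorem isCompact_fiber [T2Space Z]
    (L : IsLimitCurve T z₀ F₀ d (correction h d) E z C M τ N t s x A θ)
    (S : IsSystem T z₀ F₀ C_P d E P h) (r : ℝ) : IsCompact (fiber A θ r) := by
  have : fiber A θ r = A ∩ (fun a => (θ a).1) ⁻¹' {r} := rfl
  refine L.isCompact.of_isClosed_subset ?_ fun a ha => ha.1
  rw [this]
  exact (continuous_fst.comp_continuousOn (L.continuousOn S)).preimage_isClosed_of_isClosed
    L.closed isClosed_singleton

/-- A fiber of the limit curve over a time `r` is a transition at that time: its cost is at most the
length of the parameter interval which it spans. -/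
theorem jumpCost_le [T2Space Z]
    (L : IsLimitCurve T z₀ F₀ d (correction h d) E z C M τ N t s x A θ)
    (S : IsSystem T z₀ F₀ C_P d E P h) {r : ℝ} (hne : (fiber A θ r).Nonempty) :
    jumpCost E d (correction h d) r (θ (sInf (fiber A θ r))).2 (θ (sSup (fiber A θ r))).2 ≤
      ENNReal.ofReal (sSup (fiber A θ r) - sInf (fiber A θ r)) := by
  set B := fiber A θ r with hB
  have hBc : IsCompact B := L.isCompact_fiber S r
  have hBA : B ⊆ A := fun a ha => ha.1
  have hord : ∀ a ∈ B, ∀ b ∈ B, ∀ c ∈ A, a ≤ c → c ≤ b → c ∈ B := fun a ha b hb c hc h1 h2 =>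
    ⟨hc, le_antisymm (((L.chain S hc (hBA hb) h2).1).trans hb.2.le)
      (ha.2.symm.le.trans (L.chain S (hBA ha) hc h1).1)⟩
  have hmin : IsLeast B (sInf B) := hBc.isLeast_sInf hne
  have hmax : IsGreatest B (sSup B) := hBc.isGreatest_sSup hne
  have hdist : ∀ a ∈ B, ∀ b ∈ B, a ≤ b → d (θ a).2 (θ b).2 ≤ ENNReal.ofReal (b - a) :=
    fun a ha b hb hab => (L.dist_le S (hBA ha) (hBA hb) hab).trans (le_of_eq (by
      rw [ha.2, hb.2, sub_self, sub_zero]))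
  have htrans : IsTransition d B (fun a => (θ a).2) (θ (sInf B)).2 (θ (sSup B)).2 :=
    { nonempty := hne
      compact := hBc
      continuous := (continuous_snd.comp_continuousOn (L.continuousOn S)).mono hBA
      d_continuous := by
        intro ε hε
        obtain ⟨η, hη, hηε⟩ : ∃ η : ℝ, 0 < η ∧ ENNReal.ofReal η ≤ ε := by
          obtain ⟨c, hc0, hc⟩ := exists_between hε
          exact ⟨c.toReal, ENNReal.toReal_pos hc0.ne' hc.ne_top, by
            rw [ENNReal.ofReal_toReal hc.ne_top]; exact hc.le⟩
        exact ⟨η, hη, fun a ha b hb hab hb' => (hdist a ha b hb hab).trans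
          ((ENNReal.ofReal_le_ofReal (by linarith)).trans hηε)⟩
      start := rfl
      finish := rfl }
  have h0 : jumpCost E d (correction h d) r (θ (sInf B)).2 (θ (sSup B)).2 ≤
      transitionCost E d (correction h d) r (fun a => (θ a).2) B :=
    iInf_le_of_le B (iInf_le_of_le (fun a => (θ a).2) (iInf_le_of_le htrans le_rfl))
  refine h0.trans ?_
  set G : ℝ → ℝ≥0∞ := fun a => ⨆ (b : ℝ) (_ : (a, b) ∈ holes B), correction h d (θ a).2 (θ b).2
    with hG
  have key := variation_add_tsum_le (u := fun a => (θ a).2) S.dist.triangle S.dist.self_eq_zero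
    hmin hmax (g := fun a => G a + residual E d (correction h d) r (θ a).2) (W := fun a => a)
    (fun a _ b _ hab => hab) (fun a ha b hb hab => by
      rcases exists_hole_or_forall_exists hBc.isClosed ha hb hab with ⟨c, hc⟩ | hlim
      · have hcb : c ≤ b := by
          by_contra hcon
          exact Set.disjoint_left.1 hc.2.2.2 ⟨hab, not_le.1 hcon⟩ hb
        have hcB : c ∈ B := hc.2.1
        have hac : a < c := hc.2.2.1
        have hGa : G a ≤ correction h d (θ a).2 (θ c).2 := by
          refine iSup_le fun c' => iSup_le fun hc' => ?_
          have : c' = c := by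
            have h1 : a < c' := hc'.2.2.1
            have h2 : c' ∈ B := hc'.2.1
            refine le_antisymm ?_ ?_ <;> by_contra hcon
            · exact Set.disjoint_left.1 hc'.2.2.2 ⟨hac, not_le.1 hcon⟩ hcB
            · exact Set.disjoint_left.1 hc.2.2.2 ⟨h1, not_le.1 hcon⟩ h2
          rw [this]
        have hcA : (a, c) ∈ holes A := by
          refine ⟨hBA ha, hBA hcB, hac, ?_⟩
          rw [Set.disjoint_left]
          intro e he heA
          exact Set.disjoint_left.1 hc.2.2.2 he (hord a ha c hcB e heA he.1.le he.2.le)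
        have h1 := (L.hole S hcA).2
        rw [hcB.2] at h1
        calc d (θ a).2 (θ b).2 + (G a + residual E d (correction h d) r (θ a).2)
            ≤ (d (θ a).2 (θ c).2 + d (θ c).2 (θ b).2) +
              (correction h d (θ a).2 (θ c).2 + residual E d (correction h d) r (θ a).2) :=
              add_le_add (S.dist.triangle _ _ _) (add_le_add_left hGa _)
          _ = (d (θ a).2 (θ c).2 + correction h d (θ a).2 (θ c).2 +
              residual E d (correction h d) r (θ a).2) + d (θ c).2 (θ b).2 := by ring
          _ ≤ ENNReal.ofReal (c - a) + ENNReal.ofReal (b - c) :=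
              add_le_add h1 (hdist c hcB b hb hcb)
          _ = ENNReal.ofReal (b - a) := by
              rw [← ENNReal.ofReal_add (sub_nonneg.2 hac.le) (sub_nonneg.2 hcb)]
              congr 1; ring
      · have hG0 : G a = 0 := by
          refine nonpos_iff_eq_zero.1 (iSup_le fun c => iSup_le fun hc => ?_)
          have hac : a < c := hc.2.2.1
          obtain ⟨e, he, h1, h2⟩ := hlim (c - a) (sub_pos.2 hac)
          exact absurd he (Set.disjoint_left.1 hc.2.2.2 ⟨h1, by linarith⟩)
        have hR0 : residual E d (correction h d) r (θ a).2 = 0 := by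
          refine nonpos_iff_eq_zero.1 (le_of_forall_gt fun c hc => ?_)
          obtain ⟨c', hc'0, hc'⟩ := exists_between hc
          obtain ⟨e, he, h1, h2⟩ := hlim c'.toReal (ENNReal.toReal_pos hc'0.ne' hc'.ne_top)
          have h3 := L.residual_le S (hBA ha) (hBA he) h1
          rw [ha.2] at h3
          refine lt_of_le_of_lt (h3.trans ?_) hc'
          exact ENNReal.ofReal_le_of_le_toReal (by linarith)
        simp only [hG0, hR0, add_zero]
        exact hdist a ha b hb hab.le)
  refine le_trans ?_ key
  rw [ENNReal.tsum_add, ← add_assoc]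
  refine add_le_add_left (add_le_add_right ?_ _) _
  let f : holes B → (B \ {sSup B} : Set ℝ) := fun I => ⟨I.1.1, I.2.1, fun hcon =>
    absurd (hmax.2 I.2.2.1) (not_le.2 (lt_of_eq_of_lt (Eq.symm hcon) I.2.2.2.1))⟩
  have hf : Function.Injective f := by
    intro I J hIJ
    have h1 : I.1.1 = J.1.1 := congrArg Subtype.val hIJ
    have hI := I.2.2.2
    have hJ := J.2.2.2
    refine Subtype.ext (Prod.ext h1 (le_antisymm ?_ ?_)) <;> by_contra hcon
    · exact Set.disjoint_left.1 hI.2 ⟨h1 ▸ hJ.1, not_le.1 hcon⟩ J.2.2.1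
    · exact Set.disjoint_left.1 hJ.2 ⟨h1 ▸ hI.1, not_le.1 hcon⟩ I.2.2.1
  refine le_trans (ENNReal.tsum_le_tsum fun I => ?_)
    (ENNReal.tsum_comp_le_tsum_of_injective hf fun a => G a)
  exact le_iSup_of_le I.1.2 (le_iSup_of_le I.2 le_rfl)

end IsLimitCurve

/-! ### Stable states and one-sided limits -/

/-- Stability of the state `x` at time `t`, for the quasi-distance `d + δ`. -/
def StableAt {Z : Type*} (E : ℝ → Z → ℝ) (d δ : Z → Z → ℝ≥0∞) (t : ℝ) (x : Z) : Prop :=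
  ∀ y, d x y + δ x y ≠ ⊤ → E t x ≤ E t y + (d x y + δ x y).toReal

theorem stableAt_iff {Z : Type*} {E : ℝ → Z → ℝ} {d δ : Z → Z → ℝ≥0∞} {t : ℝ} {x : Z} :
    StableAt E d δ t x ↔
      ∀ y, (E t x : EReal) ≤ (E t y : EReal) + ((d x y + δ x y : ℝ≥0∞) : EReal) := by
  refine forall_congr' fun y => ?_
  by_cases hy : d x y + δ x y = ⊤
  · simp [hy]
  · rw [← EReal.coe_ennreal_toReal hy, ← EReal.coe_add, EReal.coe_le_coe_iff]
    simp [hy]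

theorem leftLimit_eq {X : Type*} [TopologicalSpace X] [T2Space X] {u : ℝ → X} {t : ℝ} {l : X}
    (ht : 0 < t) (hl : Tendsto u (𝓝[<] t) (𝓝 l)) : leftLimit u t = l := by
  have hex : 0 < t ∧ ∃ l, Tendsto u (𝓝[<] t) (𝓝 l) := ⟨ht, l, hl⟩
  rw [leftLimit, dif_pos hex]
  exact tendsto_nhds_unique hex.2.choose_spec hl

theorem rightLimit_eq {X : Type*} [TopologicalSpace X] [T2Space X] {T : ℝ} {u : ℝ → X} {t : ℝ}
    {l : X} (ht : t < T) (hl : Tendsto u (𝓝[>] t) (𝓝 l)) : rightLimit T u t = l := by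
  have hex : t < T ∧ ∃ l, Tendsto u (𝓝[>] t) (𝓝 l) := ⟨ht, l, hl⟩
  rw [rightLimit, dif_pos hex]
  exact tendsto_nhds_unique hex.2.choose_spec hl

namespace IsPreSystem

variable {Z : Type*} [TopologicalSpace Z] {T : ℝ} {z₀ : Z} {F₀ C_P : ℝ}
  {d : Z → Z → ℝ≥0∞} {E P : ℝ → Z → ℝ} {h : ℝ≥0 → ℝ≥0}

/-- Limits of approximate minimizers: if `p n` is minimal for `E + D(w n, ·)` with respect to a
previous state `w n` that has the same limit `q`, then the energies converge and `q` is stable. -/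
theorem tendsto_energy_of_minimal [T2Space Z] (S : IsPreSystem T z₀ F₀ C_P d E P h) {C : ℝ}
    {p w : ℕ → ℝ × Z} {q : ℝ × Z} (hp : ∀ n, p n ∈ sublevel T z₀ F₀ d E C)
    (hw : ∀ n, w n ∈ sublevel T z₀ F₀ d E C) (hpq : Tendsto p atTop (𝓝 q))
    (hwq : Tendsto (fun n => (w n).2) atTop (𝓝 q.2))
    (hmin : ∀ᶠ n in atTop, ∀ y, d (w n).2 y + correction h d (w n).2 y ≠ ⊤ →
      E (p n).1 (p n).2 ≤ E (p n).1 y + (d (w n).2 y + correction h d (w n).2 y).toReal) :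
    Tendsto (fun n => E (p n).1 (p n).2) atTop (𝓝 (E q.1 q.2)) ∧
      StableAt E d (correction h d) q.1 q.2 := by
  have hq := S.mem_sublevel_of_tendsto hp hpq
  have hD : ∀ y, Tendsto (fun n => d (w n).2 y + correction h d (w n).2 y) atTop
      (𝓝 (d q.2 y + correction h d q.2 y)) := fun y =>
    (S.tendsto_dist_left hw hwq y).add (S.tendsto_correction_left hw hwq y)
  have hE : ∀ y, Tendsto (fun n => E (p n).1 y) atTop (𝓝 (E q.1 y)) := fun y =>
    S.tendsto_energy_time y (Eventually.of_forall fun n => (hp n).1) hq.1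
      ((continuous_fst.tendsto _).comp hpq)
  have key : ∀ y, d q.2 y + correction h d q.2 y ≠ ⊤ →
      Tendsto (fun n => E (p n).1 y + (d (w n).2 y + correction h d (w n).2 y).toReal) atTop
        (𝓝 (E q.1 y + (d q.2 y + correction h d q.2 y).toReal)) ∧
      ∀ᶠ n in atTop, E (p n).1 (p n).2 ≤
        E (p n).1 y + (d (w n).2 y + correction h d (w n).2 y).toReal := by
    intro y hy
    refine ⟨(hE y).add ((ENNReal.tendsto_toReal hy).comp (hD y)), ?_⟩
    filter_upwards [hmin, (hD y).eventually (gt_mem_nhds (lt_top_iff_ne_top.2 hy))] with n h1 h2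
    exact h1 y h2.ne
  have hself : d q.2 q.2 + correction h d q.2 q.2 = 0 := by
    rw [S.dist.self_eq_zero, S.correction_self, add_zero]
  refine ⟨?_, fun y hy => S.energy_le_of_tendsto hp hpq (key y hy).1 (key y hy).2⟩
  obtain ⟨h1, h2⟩ := key q.2 (by rw [hself]; exact ENNReal.zero_ne_top)
  rw [hself, ENNReal.toReal_zero, add_zero] at h1
  rw [tendsto_order]
  refine ⟨fun a ha => S.eventually_lt_energy hp hpq ha, fun a ha => ?_⟩
  filter_upwards [h1.eventually (gt_mem_nhds ha), h2] with n h3 h4 using lt_of_le_of_lt h4 h3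

theorem tendsto_energy_of_stable [T2Space Z] (S : IsPreSystem T z₀ F₀ C_P d E P h) {C : ℝ}
    {p : ℕ → ℝ × Z} {q : ℝ × Z} (hp : ∀ n, p n ∈ sublevel T z₀ F₀ d E C)
    (hpq : Tendsto p atTop (𝓝 q))
    (hst : ∀ᶠ n in atTop, StableAt E d (correction h d) (p n).1 (p n).2) :
    Tendsto (fun n => E (p n).1 (p n).2) atTop (𝓝 (E q.1 q.2)) ∧
      StableAt E d (correction h d) q.1 q.2 :=
  S.tendsto_energy_of_minimal hp hp hpq ((continuous_snd.tendsto _).comp hpq) hst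

theorem abs_power_le (S : IsPreSystem T z₀ F₀ C_P d E P h) {C : ℝ} {p : ℝ × Z}
    (hp : p ∈ sublevel T z₀ F₀ d E C) : |P p.1 p.2| ≤ C_P * C :=
  (S.bound p.1 hp.1 p.2).trans (mul_le_mul_of_nonneg_left hp.2 S.C_pos.le)

end IsPreSystem

theorem eventually_mem_Icc_left {T r : ℝ} (hr : r ∈ Ioc 0 T) :
    ∀ᶠ r' in 𝓝[<] r, r' ∈ Icc 0 T ∧ 0 < r' := by
  filter_upwards [self_mem_nhdsWithin, nhdsWithin_le_nhds (lt_mem_nhds hr.1)] with r' h1 h2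
  have h1 : r' < r := h1
  exact ⟨⟨h2.le, h1.le.trans hr.2⟩, h2⟩

theorem eventually_mem_Icc_right {T r : ℝ} (hr : r ∈ Ico 0 T) :
    ∀ᶠ r' in 𝓝[>] r, r' ∈ Icc 0 T ∧ 0 < r' := by
  filter_upwards [self_mem_nhdsWithin, nhdsWithin_le_nhds (gt_mem_nhds hr.2)] with r' h1 h2
  have h1 : r < r' := h1
  exact ⟨⟨hr.1.trans h1.le, h2.le⟩, lt_of_le_of_lt hr.1 h1⟩

/-- The augmented variation of a left-continuous curve charges each jump to the left end of the
interval that follows it. -/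
theorem augmentedVariation_eq_of_leftLimit {Z : Type*} [TopologicalSpace Z] {T : ℝ}
    {d δ : Z → Z → ℝ≥0∞} {E : ℝ → Z → ℝ} {u : ℝ → Z} (hself : ∀ x, d x x = 0)
    (hu : ∀ r ∈ Icc 0 T, leftLimit u r = u r) {r : ℝ} (hr : r ∈ Icc 0 T) :
    augmentedVariation T E d δ u 0 r = variation d u (Icc 0 r) +
      ∑' r' : ℝ, (Ico 0 r).indicator
        (fun r' => incrementalCost E d δ r' (u r') (rightLimit T u r')) r' := by
  unfold augmentedVariation jumpVariation
  congr 1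
  set g : ℝ → ℝ≥0∞ := fun r' => incrementalCost E d δ r' (u r') (rightLimit T u r') with hg
  split_ifs with h0
  · rw [hu r hr, incrementalCost_self E hself, add_zero,
      tsum_subtype (jumpSet T u ∩ Ioo 0 r) (fun t => incrementalCost E d δ t (leftLimit u t) (u t)
        + incrementalCost E d δ t (u t) (rightLimit T u t))]
    change g 0 + _ = _
    rw [← tsum_pi_single (0 : ℝ) (g 0), ← ENNReal.tsum_add]
    refine tsum_congr fun r' => ?_
    by_cases hr0 : r' = 0
    · subst hr0
      simp [h0]
    · rw [Pi.single_eq_of_ne hr0, zero_add]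
      by_cases hmem : r' ∈ Ioo 0 r
      · have hT : r' ∈ Icc 0 T := ⟨hmem.1.le, hmem.2.le.trans hr.2⟩
        rw [indicator_of_mem (show r' ∈ Ico 0 r from ⟨hmem.1.le, hmem.2⟩)]
        by_cases hJ : r' ∈ jumpSet T u
        · rw [indicator_of_mem (show r' ∈ jumpSet T u ∩ Ioo 0 r from ⟨hJ, hmem⟩), hu r' hT,
            incrementalCost_self E hself, zero_add]
        · rw [indicator_of_notMem fun hcon => hJ hcon.1]
          have : u r' = rightLimit T u r' := by
            by_contra hne
            exact hJ ⟨hT, Or.inr hne⟩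
          simp only [hg]
          rw [← this, incrementalCost_self E hself]
      · rw [indicator_of_notMem fun hcon => hmem hcon.2, indicator_of_notMem]
        exact fun hcon => hmem ⟨lt_of_le_of_ne hcon.1 (Ne.symm hr0), hcon.2⟩
  · have : r = 0 := le_antisymm (not_lt.1 h0) hr.1
    simp [this]

/-! ### The limit curve as a function of time -/

namespace IsLimitCurve

/-- The first parameter at which the limit curve reaches time `r`. -/
noncomputable def entry (A : Set ℝ) {Z : Type*} (θ : ℝ → ℝ × Z) (r : ℝ) : ℝ := sInf (fiber A θ r)

/-- The last parameter at which the limit curve is at time `r`. -/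
noncomputable def exit (A : Set ℝ) {Z : Type*} (θ : ℝ → ℝ × Z) (r : ℝ) : ℝ := sSup (fiber A θ r)

/-- The limit curve in the time variable, left-continuous by construction. -/
noncomputable def curve (A : Set ℝ) {Z : Type*} (θ : ℝ → ℝ × Z) (r : ℝ) : Z := (θ (entry A θ r)).2

variable {Z : Type*} [TopologicalSpace Z] {T : ℝ} {z₀ : Z} {F₀ C_P : ℝ}
  {d : Z → Z → ℝ≥0∞} {E P : ℝ → Z → ℝ} {h : ℝ≥0 → ℝ≥0} {z : Z} {C M : ℝ} {τ : ℕ → ℝ} {N : ℕ → ℕ}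
  {t s : ℕ → ℕ → ℝ} {x : ℕ → ℕ → Z} {A : Set ℝ} {θ : ℝ → ℝ × Z}

theorem fiber_nonempty [T2Space Z]
    (L : IsLimitCurve T z₀ F₀ d (correction h d) E z C M τ N t s x A θ) (hN : ∀ n, N n ≠ 0)
    {r : ℝ} (hr : r ∈ Icc 0 T) : (fiber A θ r).Nonempty := by
  obtain ⟨a, ha, har⟩ := L.exists_time_eq hN hr
  exact ⟨a, ha, har⟩

theorem isLeast_entry [T2Space Z]
    (L : IsLimitCurve T z₀ F₀ d (correction h d) E z C M τ N t s x A θ)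
    (S : IsSystem T z₀ F₀ C_P d E P h) (hN : ∀ n, N n ≠ 0) {r : ℝ} (hr : r ∈ Icc 0 T) :
    IsLeast (fiber A θ r) (entry A θ r) :=
  (L.isCompact_fiber S r).isLeast_sInf (L.fiber_nonempty hN hr)

theorem isGreatest_exit [T2Space Z]
    (L : IsLimitCurve T z₀ F₀ d (correction h d) E z C M τ N t s x A θ)
    (S : IsSystem T z₀ F₀ C_P d E P h) (hN : ∀ n, N n ≠ 0) {r : ℝ} (hr : r ∈ Icc 0 T) :
    IsGreatest (fiber A θ r) (exit A θ r) :=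
  (L.isCompact_fiber S r).isGreatest_sSup (L.fiber_nonempty hN hr)

theorem entry_le_exit [T2Space Z]
    (L : IsLimitCurve T z₀ F₀ d (correction h d) E z C M τ N t s x A θ)
    (S : IsSystem T z₀ F₀ C_P d E P h) (hN : ∀ n, N n ≠ 0) {r : ℝ} (hr : r ∈ Icc 0 T) :
    entry A θ r ≤ exit A θ r :=
  (L.isLeast_entry S hN hr).2 (L.isGreatest_exit S hN hr).1

theorem exit_lt_entry [T2Space Z]
    (L : IsLimitCurve T z₀ F₀ d (correction h d) E z C M τ N t s x A θ)
    (S : IsSystem T z₀ F₀ C_P d E P h) (hN : ∀ n, N n ≠ 0) {r r' : ℝ} (hr : r ∈ Icc 0 T)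
    (hr' : r' ∈ Icc 0 T) (hlt : r < r') : exit A θ r < entry A θ r' := by
  by_contra hcon
  have h1 := (L.isGreatest_exit S hN hr).1
  have h2 := (L.isLeast_entry S hN hr').1
  have := (L.chain S h2.1 h1.1 (not_lt.1 hcon)).1
  rw [h1.2, h2.2] at this
  linarith

theorem θ_entry [T2Space Z]
    (L : IsLimitCurve T z₀ F₀ d (correction h d) E z C M τ N t s x A θ)
    (S : IsSystem T z₀ F₀ C_P d E P h) (hN : ∀ n, N n ≠ 0) {r : ℝ} (hr : r ∈ Icc 0 T) :
    θ (entry A θ r) = (r, curve A θ r) :=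
  Prod.ext (L.isLeast_entry S hN hr).1.2 rfl

theorem curve_mem [T2Space Z]
    (L : IsLimitCurve T z₀ F₀ d (correction h d) E z C M τ N t s x A θ)
    (S : IsSystem T z₀ F₀ C_P d E P h) (hN : ∀ n, N n ≠ 0) {r : ℝ} (hr : r ∈ Icc 0 T) :
    (r, curve A θ r) ∈ sublevel T z₀ F₀ d E C := by
  rw [← L.θ_entry S hN hr]
  exact L.mem_sublevel S (L.isLeast_entry S hN hr).1.1

theorem entry_zero [T2Space Z]
    (L : IsLimitCurve T z₀ F₀ d (correction h d) E z C M τ N t s x A θ)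
    (S : IsSystem T z₀ F₀ C_P d E P h) (hN : ∀ n, N n ≠ 0) :
    entry A θ 0 = 0 ∧ curve A θ 0 = z := by
  have h0 := L.zero_mem
  have h1 := L.isLeast_entry S hN (r := 0) ⟨le_rfl, S.T_pos.le⟩
  have h2 : entry A θ 0 = 0 :=
    le_antisymm (h1.2 ⟨h0.1, by rw [h0.2]⟩) (L.subset_Icc h1.1.1).1
  exact ⟨h2, by rw [curve, h2, h0.2]⟩

/-- Parameters whose times converge to `r` converge, provided that the fiber over `r` contains a
single point within the bounds that they obey. -/
theorem tendsto_param [T2Space Z]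
    (L : IsLimitCurve T z₀ F₀ d (correction h d) E z C M τ N t s x A θ)
    (S : IsSystem T z₀ F₀ C_P d E P h) {ι : Type*} {l : Filter ι} [l.IsCountablyGenerated]
    {a : ι → ℝ} {r r₀ lo hi : ℝ} (ha : ∀ᶠ i in l, a i ∈ A ∧ lo ≤ a i ∧ a i ≤ hi)
    (hlim : Tendsto (fun i => (θ (a i)).1) l (𝓝 r))
    (H : ∀ c ∈ fiber A θ r, lo ≤ c → c ≤ hi → c = r₀) : Tendsto a l (𝓝 r₀) := by
  refine tendsto_of_subseq_tendsto fun ns hns => ?_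
  obtain ⟨n₀, hn₀⟩ := eventually_atTop.1 (hns.eventually ha)
  obtain ⟨c, hc, φ, hφ, hφc⟩ := L.isCompact.isSeqCompact (x := fun n => a (ns (n + n₀)))
    fun n => (hn₀ _ (by omega)).1
  have hφ' : Tendsto (fun n => ns (φ n + n₀)) atTop l :=
    hns.comp ((tendsto_add_atTop_nat n₀).comp hφ.tendsto_atTop)
  have h1 := L.tendsto_comp S (Eventually.of_forall fun n => (hn₀ (φ n + n₀) (by omega)).1) hc hφc
  have h2 : (θ c).1 = r :=
    tendsto_nhds_unique ((continuous_fst.tendsto _).comp h1) (hlim.comp hφ')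
  have h3 : c = r₀ := H c ⟨hc, h2⟩
    (ge_of_tendsto hφc (Eventually.of_forall fun n => (hn₀ (φ n + n₀) (by omega)).2.1))
    (le_of_tendsto hφc (Eventually.of_forall fun n => (hn₀ (φ n + n₀) (by omega)).2.2))
  exact ⟨fun n => φ n + n₀, h3 ▸ hφc⟩

theorem tendsto_entry_left [T2Space Z]
    (L : IsLimitCurve T z₀ F₀ d (correction h d) E z C M τ N t s x A θ)
    (S : IsSystem T z₀ F₀ C_P d E P h) (hN : ∀ n, N n ≠ 0) {r : ℝ} (hr : r ∈ Ioc 0 T) :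
    Tendsto (entry A θ) (𝓝[<] r) (𝓝 (entry A θ r)) := by
  have hr' : r ∈ Icc 0 T := ⟨hr.1.le, hr.2⟩
  refine L.tendsto_param S (lo := 0) (hi := entry A θ r) (r := r) ?_ ?_ fun c hc _ h2 =>
    le_antisymm h2 ((L.isLeast_entry S hN hr').2 hc)
  · filter_upwards [eventually_mem_Icc_left hr, self_mem_nhdsWithin] with r' h1 h2
    have h3 := (L.isLeast_entry S hN h1.1).1.1
    exact ⟨h3, (L.subset_Icc h3).1,
      (L.entry_le_exit S hN h1.1).trans (L.exit_lt_entry S hN h1.1 hr' h2).le⟩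
  · refine (tendsto_id.mono_left nhdsWithin_le_nhds).congr' ?_
    filter_upwards [eventually_mem_Icc_left hr] with r' h1
    rw [L.θ_entry S hN h1.1]; rfl

theorem tendsto_entry_right [T2Space Z]
    (L : IsLimitCurve T z₀ F₀ d (correction h d) E z C M τ N t s x A θ)
    (S : IsSystem T z₀ F₀ C_P d E P h) (hN : ∀ n, N n ≠ 0) {r : ℝ} (hr : r ∈ Ico 0 T) :
    Tendsto (entry A θ) (𝓝[>] r) (𝓝 (exit A θ r)) := by
  have hr' : r ∈ Icc 0 T := ⟨hr.1, hr.2.le⟩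
  refine L.tendsto_param S (lo := exit A θ r) (hi := M) (r := r) ?_ ?_ fun c hc h1 _ =>
    le_antisymm ((L.isGreatest_exit S hN hr').2 hc) h1
  · filter_upwards [eventually_mem_Icc_right hr, self_mem_nhdsWithin] with r' h1 h2
    have h3 := (L.isLeast_entry S hN h1.1).1.1
    exact ⟨h3, (L.exit_lt_entry S hN hr' h1.1 h2).le, (L.subset_Icc h3).2⟩
  · refine (tendsto_id.mono_left nhdsWithin_le_nhds).congr' ?_
    filter_upwards [eventually_mem_Icc_right hr] with r' h1
    rw [L.θ_entry S hN h1.1]; rfl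

theorem tendsto_curve_left [T2Space Z]
    (L : IsLimitCurve T z₀ F₀ d (correction h d) E z C M τ N t s x A θ)
    (S : IsSystem T z₀ F₀ C_P d E P h) (hN : ∀ n, N n ≠ 0) {r : ℝ} (hr : r ∈ Ioc 0 T) :
    Tendsto (curve A θ) (𝓝[<] r) (𝓝 (curve A θ r)) := by
  refine (continuous_snd.tendsto _).comp (L.tendsto_comp S ?_
    (L.isLeast_entry S hN ⟨hr.1.le, hr.2⟩).1.1 (L.tendsto_entry_left S hN hr))
  filter_upwards [eventually_mem_Icc_left hr] with r' h1 using (L.isLeast_entry S hN h1.1).1.1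

theorem tendsto_curve_right [T2Space Z]
    (L : IsLimitCurve T z₀ F₀ d (correction h d) E z C M τ N t s x A θ)
    (S : IsSystem T z₀ F₀ C_P d E P h) (hN : ∀ n, N n ≠ 0) {r : ℝ} (hr : r ∈ Ico 0 T) :
    Tendsto (curve A θ) (𝓝[>] r) (𝓝 (θ (exit A θ r)).2) := by
  refine (continuous_snd.tendsto _).comp (L.tendsto_comp S ?_
    (L.isGreatest_exit S hN ⟨hr.1, hr.2.le⟩).1.1 (L.tendsto_entry_right S hN hr))
  filter_upwards [eventually_mem_Icc_right hr] with r' h1 using (L.isLeast_entry S hN h1.1).1.1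

theorem leftLimit_curve [T2Space Z]
    (L : IsLimitCurve T z₀ F₀ d (correction h d) E z C M τ N t s x A θ)
    (S : IsSystem T z₀ F₀ C_P d E P h) (hN : ∀ n, N n ≠ 0) {r : ℝ} (hr : r ∈ Icc 0 T) :
    leftLimit (curve A θ) r = curve A θ r := by
  rcases hr.1.lt_or_eq with h0 | h0
  · exact leftLimit_eq h0 (L.tendsto_curve_left S hN ⟨h0, hr.2⟩)
  · rw [leftLimit, dif_neg]
    exact fun hcon => absurd hcon.1 (by rw [← h0]; exact lt_irrefl _)

theorem rightLimit_curve [T2Space Z]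
    (L : IsLimitCurve T z₀ F₀ d (correction h d) E z C M τ N t s x A θ)
    (S : IsSystem T z₀ F₀ C_P d E P h) (hN : ∀ n, N n ≠ 0) {r : ℝ} (hr : r ∈ Ico 0 T) :
    rightLimit T (curve A θ) r = (θ (exit A θ r)).2 :=
  rightLimit_eq hr.2 (L.tendsto_curve_right S hN hr)

/-- The increment of the limit curve together with the incremental cost of the jump at its left end
point is controlled by the increment of the parameter minus the elapsed time. -/
theorem dist_add_incrementalCost_le [T2Space Z]
    (L : IsLimitCurve T z₀ F₀ d (correction h d) E z C M τ N t s x A θ)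
    (S : IsSystem T z₀ F₀ C_P d E P h) (hN : ∀ n, N n ≠ 0) {r r' : ℝ} (hr : r ∈ Icc 0 T)
    (hr' : r' ∈ Icc 0 T) (hlt : r < r') :
    d (curve A θ r) (curve A θ r') + incrementalCost E d (correction h d) r (curve A θ r)
      (rightLimit T (curve A θ) r) ≤
      ENNReal.ofReal ((entry A θ r' - r') - (entry A θ r - r)) := by
  have h1 := L.isLeast_entry S hN hr
  have h1' := L.isLeast_entry S hN hr'
  have h2 := L.isGreatest_exit S hN hr
  have h3 := L.exit_lt_entry S hN hr hr' hlt
  have h4 := L.entry_le_exit S hN hr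
  have h5 := L.time_sub_le S h2.1.1 h1'.1.1 h3.le
  rw [h2.1.2, h1'.1.2] at h5
  rw [L.rightLimit_curve S hN ⟨hr.1, lt_of_lt_of_le hlt hr'.2⟩]
  have hc := L.jumpCost_le S (L.fiber_nonempty hN hr)
  have hd := L.dist_le S h2.1.1 h1'.1.1 h3.le
  rw [h2.1.2, h1'.1.2] at hd
  calc d (curve A θ r) (curve A θ r') + incrementalCost E d (correction h d) r (curve A θ r)
        (θ (exit A θ r)).2
      ≤ (d (curve A θ r) (θ (exit A θ r)).2 + d (θ (exit A θ r)).2 (curve A θ r')) +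
        incrementalCost E d (correction h d) r (curve A θ r) (θ (exit A θ r)).2 :=
        add_le_add_left (S.dist.triangle _ _ _) _
    _ = (d (curve A θ r) (θ (exit A θ r)).2 +
        incrementalCost E d (correction h d) r (curve A θ r) (θ (exit A θ r)).2) +
        d (θ (exit A θ r)).2 (curve A θ r') := by ring
    _ ≤ ENNReal.ofReal (exit A θ r - entry A θ r) +
        ENNReal.ofReal (entry A θ r' - exit A θ r - (r' - r)) := by
        rw [dist_add_incrementalCost]
        exact add_le_add hc hd
    _ = _ := by
        rw [← ENNReal.ofReal_add (sub_nonneg.2 h4) (by linarith)]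
        congr 1; ring

/-- Parameter minus time is monotone: it measures the energy released so far. -/
theorem entry_sub_mono [T2Space Z]
    (L : IsLimitCurve T z₀ F₀ d (correction h d) E z C M τ N t s x A θ)
    (S : IsSystem T z₀ F₀ C_P d E P h) (hN : ∀ n, N n ≠ 0) :
    MonotoneOn (fun r => entry A θ r - r) (Icc 0 T) := by
  intro r hr r' hr' hrr
  rcases hrr.eq_or_lt with rfl | hlt
  · exact le_rfl
  have h1 := (L.isLeast_entry S hN hr).1
  have h1' := (L.isLeast_entry S hN hr').1
  have h3 := (L.entry_le_exit S hN hr).trans (L.exit_lt_entry S hN hr hr' hlt).le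
  have h5 := L.time_sub_le S h1.1 h1'.1 h3
  rw [h1.2, h1'.2] at h5
  simp only
  linarith

theorem isBV_curve [T2Space Z]
    (L : IsLimitCurve T z₀ F₀ d (correction h d) E z C M τ N t s x A θ)
    (S : IsSystem T z₀ F₀ C_P d E P h) (hN : ∀ n, N n ≠ 0) : IsBV T d (curve A θ) := by
  refine ⟨⟨fun r hr => ?_, fun r hr => ?_, fun r _ h0 => S.sep _ _ h0, fun r _ h0 => S.sep _ _ h0⟩,
    ?_⟩
  · have hr' : r ∈ Icc 0 T := ⟨hr.1.le, hr.2⟩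
    rw [L.leftLimit_curve S hN hr']
    refine ⟨L.tendsto_curve_left S hN hr, ?_⟩
    have h1 : Tendsto (fun r' => ENNReal.ofReal (entry A θ r - entry A θ r')) (𝓝[<] r) (𝓝 0) := by
      have := ENNReal.tendsto_ofReal ((L.tendsto_entry_left S hN hr).const_sub (entry A θ r))
      simpa using this
    refine tendsto_of_tendsto_of_tendsto_of_le_of_le' tendsto_const_nhds h1
      (Eventually.of_forall fun _ => zero_le) ?_
    filter_upwards [eventually_mem_Icc_left hr, self_mem_nhdsWithin] with r' h2 h3
    have h4 := (L.entry_le_exit S hN h2.1).trans (L.exit_lt_entry S hN h2.1 hr' h3).le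
    exact le_add_self.trans (L.chain S (L.isLeast_entry S hN h2.1).1.1
      (L.isLeast_entry S hN hr').1.1 h4).2
  · have hr' : r ∈ Icc 0 T := ⟨hr.1, hr.2.le⟩
    rw [L.rightLimit_curve S hN hr]
    refine ⟨L.tendsto_curve_right S hN hr, ?_⟩
    have h1 : Tendsto (fun r' => ENNReal.ofReal (entry A θ r' - exit A θ r)) (𝓝[>] r) (𝓝 0) := by
      have := ENNReal.tendsto_ofReal ((L.tendsto_entry_right S hN hr).sub_const (exit A θ r))
      simpa using this
    refine tendsto_of_tendsto_of_tendsto_of_le_of_le' tendsto_const_nhds h1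
      (Eventually.of_forall fun _ => zero_le) ?_
    filter_upwards [eventually_mem_Icc_right hr, self_mem_nhdsWithin] with r' h2 h3
    have h4 := (L.exit_lt_entry S hN hr' h2.1 h3).le
    exact le_add_self.trans (L.chain S (L.isGreatest_exit S hN hr').1.1
      (L.isLeast_entry S hN h2.1).1.1 h4).2
  · have key := variation_add_tsum_le (u := curve A θ) S.dist.triangle S.dist.self_eq_zero
      (isLeast_Icc S.T_pos.le) (isGreatest_Icc S.T_pos.le) (g := fun _ => 0)
      (L.entry_sub_mono S hN) (fun r hr r' hr' hlt => by
        rw [add_zero]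
        exact le_self_add.trans (L.dist_add_incrementalCost_le S hN hr hr' hlt))
    exact ne_top_of_le_ne_top ENNReal.ofReal_ne_top (le_self_add.trans key)

/-- The augmented variation of the curve is bounded by the energy that the minimization steps have
released. -/
theorem augmentedVariation_le [T2Space Z]
    (L : IsLimitCurve T z₀ F₀ d (correction h d) E z C M τ N t s x A θ)
    (S : IsSystem T z₀ F₀ C_P d E P h) (hN : ∀ n, N n ≠ 0) {r : ℝ} (hr : r ∈ Icc 0 T) :
    augmentedVariation T E d (correction h d) (curve A θ) 0 r ≤
      ENNReal.ofReal (entry A θ r - r) := by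
  rw [augmentedVariation_eq_of_leftLimit S.dist.self_eq_zero (fun r hr => L.leftLimit_curve S hN hr)
    hr]
  have hsub : ∀ r' ∈ Icc 0 r, r' ∈ Icc 0 T := fun r' hr' => ⟨hr'.1, hr'.2.trans hr.2⟩
  have key := variation_add_tsum_le (u := curve A θ) S.dist.triangle S.dist.self_eq_zero
    (isLeast_Icc hr.1) (isGreatest_Icc hr.1) (W := fun r => entry A θ r - r)
    ((L.entry_sub_mono S hN).mono hsub) (fun a ha b hb hab =>
      L.dist_add_incrementalCost_le S hN (hsub a ha) (hsub b hb) hab)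
  rw [(L.entry_zero S hN).1, sub_zero, sub_zero, Icc_sdiff_right,
    tsum_subtype (Ico 0 r) (fun r' => incrementalCost E d (correction h d) r' (curve A θ r')
      (rightLimit T (curve A θ) r'))] at key
  exact key

end IsLimitCurve

namespace IsLimitCurve

variable {Z : Type*} [TopologicalSpace Z] {T : ℝ} {z₀ : Z} {F₀ C_P : ℝ}
  {d : Z → Z → ℝ≥0∞} {E P : ℝ → Z → ℝ} {h : ℝ≥0 → ℝ≥0} {z : Z} {C M : ℝ} {τ : ℕ → ℝ} {N : ℕ → ℕ}
  {t s : ℕ → ℕ → ℝ} {x : ℕ → ℕ → Z} {A : Set ℝ} {θ : ℝ → ℝ × Z}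

/-! ### Stability of the limit curve -/

/-- Along nodes that converge to the entry parameter of a time `r` the energies converge, and the
limit state is stable: the predecessors of these nodes cannot stay behind, because a hole that ends
at the entry parameter would be contained in the fiber of `r`. -/
theorem tendsto_energy_node [T2Space Z]
    (L : IsLimitCurve T z₀ F₀ d (correction h d) E z C M τ N t s x A θ)
    (S : IsSystem T z₀ F₀ C_P d E P h) (hN : ∀ n, N n ≠ 0) {r : ℝ} (hr : r ∈ Ioc 0 T)
    {k : ℕ → ℕ} (hk : ∀ n, k n ≤ N n)
    (hs : Tendsto (fun n => s n (k n)) atTop (𝓝 (entry A θ r))) :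
    Tendsto (fun n => E (t n (k n)) (x n (k n))) atTop (𝓝 (E r (curve A θ r))) ∧
      StableAt E d (correction h d) r (curve A θ r) := by
  have hr' : r ∈ Icc 0 T := ⟨hr.1.le, hr.2⟩
  have h1 := (L.limit_id (Eventually.of_forall hk) hs).2
  rw [L.θ_entry S hN hr'] at h1
  have ht1 : Tendsto (fun n => t n (k n)) atTop (𝓝 r) := (continuous_fst.tendsto _).comp h1
  have hpos : ∀ᶠ n in atTop, k n - 1 + 1 = k n := by
    filter_upwards [ht1.eventually (lt_mem_nhds hr.1)] with n hn
    have : k n ≠ 0 := fun h0 => by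
      rw [h0, (L.scheme n).t_zero] at hn
      exact lt_irrefl _ hn
    omega
  have hs2 : Tendsto (fun n => s n (k n - 1)) atTop (𝓝 (entry A θ r)) := by
    refine L.tendsto_node (k := fun n => k n - 1)
      (Eventually.of_forall fun n => (Nat.sub_le _ _).trans (hk n)) fun ψ a hψ ha hlim hlim' => ?_
    have hle : a ≤ entry A θ r := le_of_tendsto_of_tendsto hlim (hs.comp hψ)
      (Eventually.of_forall fun i => (L.scheme _).s_mono (Nat.sub_le _ _))
    refine le_antisymm hle ((L.isLeast_entry S hN hr').2 ⟨ha, ?_⟩)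
    refine tendsto_nhds_unique ((continuous_fst.tendsto _).comp hlim') ?_
    have h3 : Tendsto (fun i => t (ψ i) (k (ψ i)) - τ (ψ i)) atTop (𝓝 r) := by
      simpa using (ht1.comp hψ).sub (L.mesh.comp hψ)
    refine tendsto_of_tendsto_of_tendsto_of_le_of_le' h3 (ht1.comp hψ) ?_
      (Eventually.of_forall fun i => (L.scheme _).t_mono (Nat.sub_le _ _))
    filter_upwards [hψ.eventually hpos] with i hi
    have := (L.scheme (ψ i)).t_step (k (ψ i) - 1)
    rw [hi] at this
    simp only [Function.comp]
    linarith
  have h2 := (L.limit_id (k := fun n => k n - 1)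
    (Eventually.of_forall fun n => (Nat.sub_le _ _).trans (hk n)) hs2).2
  rw [L.θ_entry S hN hr'] at h2
  refine S.tendsto_energy_of_minimal (p := fun n => (t n (k n), x n (k n)))
    (w := fun n => (t n (k n - 1), x n (k n - 1))) (q := (r, curve A θ r))
    (fun n => (L.scheme n).mem _) (fun n => (L.scheme n).mem _) h1
    ((continuous_snd.tendsto _).comp h2) ?_
  filter_upwards [hpos] with n hn y hy
  have := (L.scheme n).minimal (k n - 1) y hy
  rwa [hn] at this

/-- The states of the left-continuous curve are stable at all positive times, jump times included.
-/
theorem stableAt_curve [T2Space Z]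
    (L : IsLimitCurve T z₀ F₀ d (correction h d) E z C M τ N t s x A θ)
    (S : IsSystem T z₀ F₀ C_P d E P h) (hN : ∀ n, N n ≠ 0) {r : ℝ} (hr : r ∈ Ioc 0 T) :
    StableAt E d (correction h d) r (curve A θ r) := by
  obtain ⟨k, hk, hs⟩ := L.approx _ (L.isLeast_entry S hN ⟨hr.1.le, hr.2⟩).1.1
  exact (L.tendsto_energy_node S hN hr hk hs).2

/-- The initial state is stable as well if the curve is continuous at time `0`. -/
theorem stableAt_curve_of_notMem_jumpSet [T2Space Z]
    (L : IsLimitCurve T z₀ F₀ d (correction h d) E z C M τ N t s x A θ)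
    (S : IsSystem T z₀ F₀ C_P d E P h) (hN : ∀ n, N n ≠ 0) {r : ℝ} (hr : r ∈ Icc 0 T)
    (hJ : r ∉ jumpSet T (curve A θ)) : StableAt E d (correction h d) r (curve A θ r) := by
  rcases hr.1.lt_or_eq with h0 | rfl
  · exact L.stableAt_curve S hN ⟨h0, hr.2⟩
  have h0 : (0 : ℝ) ∈ Ico 0 T := ⟨le_rfl, S.T_pos⟩
  have heq : curve A θ 0 = (θ (exit A θ 0)).2 := by
    rw [← L.rightLimit_curve S hN h0]
    by_contra hne
    exact hJ ⟨hr, Or.inr hne⟩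
  have hlim := L.tendsto_curve_right S hN h0
  rw [← heq] at hlim
  obtain ⟨a, ha⟩ := exists_seq_tendsto (𝓝[>] (0 : ℝ))
  obtain ⟨n₀, hn₀⟩ := eventually_atTop.1 (ha.eventually (eventually_mem_Icc_right h0))
  have ha' := ha.comp (tendsto_add_atTop_nat n₀)
  exact (S.tendsto_energy_of_stable (p := fun n => (a (n + n₀), curve A θ (a (n + n₀))))
    (q := (0, curve A θ 0)) (fun n => L.curve_mem S hN (hn₀ _ (by omega)).1)
    ((tendsto_nhdsWithin_iff.1 ha').1.prodMk_nhds (hlim.comp ha'))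
    (Eventually.of_forall fun n => L.stableAt_curve S hN
      ⟨(hn₀ _ (by omega)).2, (hn₀ (n + n₀) (by omega)).1.2⟩)).2

/-! ### Integrability of the power along the limit curve -/

/-- The interior times at which the limit curve spends a single parameter. -/
def regularTimes (T : ℝ) (A : Set ℝ) (θ : ℝ → ℝ × Z) : Set ℝ :=
  {r ∈ Ioo 0 T | entry A θ r = exit A θ r}

theorem countable_diff_regularTimes [T2Space Z]
    (L : IsLimitCurve T z₀ F₀ d (correction h d) E z C M τ N t s x A θ)
    (S : IsSystem T z₀ F₀ C_P d E P h) (hN : ∀ n, N n ≠ 0) :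
    (Icc 0 T \ regularTimes T A θ).Countable := by
  have hcount : {r ∈ Icc 0 T | entry A θ r < exit A θ r}.Countable := by
    refine Set.PairwiseDisjoint.countable_of_isOpen (s := fun r => Ioo (entry A θ r) (exit A θ r))
      (a := {r ∈ Icc 0 T | entry A θ r < exit A θ r}) ?_ (fun _ _ => isOpen_Ioo)
      fun r hr => nonempty_Ioo.2 hr.2
    have key : ∀ r ∈ {r ∈ Icc 0 T | entry A θ r < exit A θ r},
        ∀ r' ∈ {r ∈ Icc 0 T | entry A θ r < exit A θ r}, r < r' →
        Disjoint (Ioo (entry A θ r) (exit A θ r)) (Ioo (entry A θ r') (exit A θ r')) := by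
      intro r hr r' hr' hlt
      rw [Set.disjoint_left]
      intro a ha ha'
      have := L.exit_lt_entry S hN hr.1 hr'.1 hlt
      linarith [ha.2, ha'.1]
    intro r hr r' hr' hne
    rcases lt_or_gt_of_ne hne with h1 | h1
    · exact key r hr r' hr' h1
    · exact (key r' hr' r hr h1).symm
  refine (hcount.union (Set.toFinite {0, T}).countable).mono fun r hr => ?_
  by_cases h0 : r ∈ ({0, T} : Set ℝ)
  · exact Or.inr h0
  left
  refine ⟨hr.1, lt_of_le_of_ne (L.entry_le_exit S hN hr.1) fun he => hr.2 ⟨⟨?_, ?_⟩, he⟩⟩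
  · exact lt_of_le_of_ne hr.1.1 fun h1 => h0 (Or.inl h1.symm)
  · exact lt_of_le_of_ne hr.1.2 fun h1 => h0 (Or.inr h1)

theorem ae_mem_regularTimes [T2Space Z]
    (L : IsLimitCurve T z₀ F₀ d (correction h d) E z C M τ N t s x A θ)
    (S : IsSystem T z₀ F₀ C_P d E P h) (hN : ∀ n, N n ≠ 0) :
    ∀ᵐ r, r ∈ Icc 0 T → r ∈ regularTimes T A θ := by
  have := (L.countable_diff_regularTimes S hN).ae_notMem volume
  filter_upwards [this] with r hr hr'
  by_contra hcon
  exact hr ⟨hr', hcon⟩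

/-- The power along the curve is upper semicontinuous at times where the curve is continuous along
the filter: the states are stable, so that the energies converge. -/
theorem eventually_power_curve_lt [T2Space Z]
    (L : IsLimitCurve T z₀ F₀ d (correction h d) E z C M τ N t s x A θ)
    (S : IsSystem T z₀ F₀ C_P d E P h) (hN : ∀ n, N n ≠ 0) {r c : ℝ} {l : Filter ℝ}
    [l.IsCountablyGenerated] (hl : ∀ᶠ r' in l, r' ∈ Ioc 0 T) (hlr : Tendsto id l (𝓝 r))
    (hu : Tendsto (curve A θ) l (𝓝 (curve A θ r))) (hc : P r (curve A θ r) < c) :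
    ∀ᶠ r' in l, P r' (curve A θ r') < c := by
  by_contra hcon
  rw [not_eventually] at hcon
  obtain ⟨a, ha, hac⟩ := exists_seq_forall_of_frequently hcon
  obtain ⟨n₀, hn₀⟩ := eventually_atTop.1 (ha.eventually hl)
  have ha' := ha.comp (tendsto_add_atTop_nat n₀)
  have hp : ∀ n, (a (n + n₀), curve A θ (a (n + n₀))) ∈ sublevel T z₀ F₀ d E C := fun n =>
    L.curve_mem S hN ⟨(hn₀ (n + n₀) (by omega)).1.le, (hn₀ (n + n₀) (by omega)).2⟩
  have hpq : Tendsto (fun n => (a (n + n₀), curve A θ (a (n + n₀)))) atTop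
      (𝓝 (r, curve A θ r)) := (hlr.comp ha').prodMk_nhds (hu.comp ha')
  have hE := (S.tendsto_energy_of_stable hp hpq
    (Eventually.of_forall fun n => L.stableAt_curve S hN (hn₀ _ (by omega)))).1
  obtain ⟨n, hn⟩ := (S.eventually_power_lt hp hpq hE hc).exists
  exact hac _ hn

theorem measurableSet_regularTimes [T2Space Z]
    (L : IsLimitCurve T z₀ F₀ d (correction h d) E z C M τ N t s x A θ)
    (S : IsSystem T z₀ F₀ C_P d E P h) (hN : ∀ n, N n ≠ 0) :
    MeasurableSet (regularTimes T A θ) := by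
  have : regularTimes T A θ = Icc 0 T \ (Icc 0 T \ regularTimes T A θ) := by
    rw [Set.sdiff_sdiff_right_self]
    exact (inter_eq_right.2 fun r hr => Ioo_subset_Icc_self hr.1).symm
  rw [this]
  exact measurableSet_Icc.diff (L.countable_diff_regularTimes S hN).measurableSet

theorem tendsto_curve_regular [T2Space Z]
    (L : IsLimitCurve T z₀ F₀ d (correction h d) E z C M τ N t s x A θ)
    (S : IsSystem T z₀ F₀ C_P d E P h) (hN : ∀ n, N n ≠ 0) {r : ℝ} (hr : r ∈ regularTimes T A θ) :
    Tendsto (curve A θ) (𝓝 r) (𝓝 (curve A θ r)) := by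
  have h1 := L.tendsto_curve_left S hN (r := r) ⟨hr.1.1, hr.1.2.le⟩
  have h2 := L.tendsto_curve_right S hN (r := r) ⟨hr.1.1.le, hr.1.2⟩
  rw [← hr.2] at h2
  have := continuousAt_iff_continuous_left'_right'.2 ⟨h1, h2⟩
  exact this

/-- Measurability comes from upper semicontinuity on the regular times, which have full measure. -/
theorem integrableOn_power [T2Space Z]
    (L : IsLimitCurve T z₀ F₀ d (correction h d) E z C M τ N t s x A θ)
    (S : IsSystem T z₀ F₀ C_P d E P h) (hN : ∀ n, N n ≠ 0) :
    IntegrableOn (fun r => P r (curve A θ r)) (Icc 0 T) := by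
  have hmeas : MeasurableSet (regularTimes T A θ) := L.measurableSet_regularTimes S hN
  have hae : (regularTimes T A θ : Set ℝ) =ᵐ[volume] Icc 0 T := by
    refine Filter.Eventually.set_eq ?_
    filter_upwards [L.ae_mem_regularTimes S hN] with r hr
    exact ⟨fun h1 => Ioo_subset_Icc_self h1.1, hr⟩
  rw [← integrableOn_congr_set_ae hae]
  have hm : Measurable (fun r : regularTimes T A θ => P r (curve A θ r)) := by
    refine UpperSemicontinuous.measurable fun r c hc => ?_
    have := L.eventually_power_curve_lt S hN (l := 𝓝 (r : ℝ))
      (mem_of_superset (Ioo_mem_nhds r.2.1.1 r.2.1.2) Ioo_subset_Ioc_self) tendsto_id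
      (L.tendsto_curve_regular S hN r.2) hc
    exact continuous_subtype_val.continuousAt.eventually this
  refine ⟨(aemeasurable_restrict_of_measurable_subtype hmeas hm).aestronglyMeasurable, ?_⟩
  refine HasFiniteIntegral.restrict_of_bounded (C_P * C) ?_ ?_
  · exact (measure_mono fun r hr => Ioo_subset_Icc_self hr.1).trans_lt
      (measure_Icc_lt_top (a := (0 : ℝ)) (b := T))
  · refine (ae_restrict_iff' hmeas).2 (Eventually.of_forall fun r hr => ?_)
    exact S.abs_power_le (L.curve_mem S hN (Ioo_subset_Icc_self hr.1))


/-! ### The upper energy estimate -/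

open Classical in
/-- The last node strictly before a time, and `0` if there is none. -/
noncomputable def lastNode (N : ℕ → ℕ) (t : ℕ → ℕ → ℝ) (n : ℕ) (r : ℝ) : ℕ :=
  Nat.findGreatest (fun k => t n k < r) (N n)

/-- The derivative in time of the energy, along the piecewise constant discrete solution. -/
noncomputable def discretePower (E : ℝ → Z → ℝ) (N : ℕ → ℕ) (t : ℕ → ℕ → ℝ) (x : ℕ → ℕ → Z)
    (n : ℕ) (r : ℝ) : ℝ :=
  deriv (fun r' => E r' (x n (lastNode N t n r))) r

theorem lastNode_le (n : ℕ) (r : ℝ) : lastNode N t n r ≤ N n := Nat.findGreatest_le _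

theorem measurable_discretePower {Z : Type*} (E : ℝ → Z → ℝ) (N : ℕ → ℕ) (t : ℕ → ℕ → ℝ)
    (x : ℕ → ℕ → Z) (n : ℕ) : Measurable (discretePower E N t x n) := by
  classical
  have h0 : Measurable (lastNode N t n) := by
    unfold lastNode
    exact measurable_findGreatest fun k _ => measurableSet_Ioi
  have h1 : Measurable (fun p : ℝ × ℕ => deriv (fun r' => E r' (x n p.2)) p.1) :=
    measurable_from_prod_countable_left fun k => measurable_deriv fun r' => E r' (x n k)
  exact h1.comp (measurable_id.prodMk h0)

theorem lastNode_spec (L : IsLimitCurve T z₀ F₀ d (correction h d) E z C M τ N t s x A θ) (n : ℕ)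
    {r : ℝ} (hr : r ∈ Ioo 0 T) :
    t n (lastNode N t n r) < r ∧ r - τ n ≤ t n (lastNode N t n r) := by
  classical
  have h1 : t n (lastNode N t n r) < r :=
    Nat.findGreatest_spec (P := fun k => t n k < r) (m := 0) (Nat.zero_le _)
      (by rw [(L.scheme n).t_zero]; exact hr.1)
  refine ⟨h1, ?_⟩
  have hle : lastNode N t n r + 1 ≤ N n := by
    rcases (lastNode_le (N := N) (t := t) n r).lt_or_eq with h2 | h2
    · exact h2
    · rw [h2, (L.scheme n).t_last] at h1
      exact absurd hr.2 (not_lt.2 h1.le)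
  have h3 : ¬ t n (lastNode N t n r + 1) < r :=
    Nat.findGreatest_is_greatest (P := fun k => t n k < r) (Nat.lt_succ_self _) hle
  have := (L.scheme n).t_step (lastNode N t n r)
  linarith [not_lt.1 h3]

theorem lastNode_eq (L : IsLimitCurve T z₀ F₀ d (correction h d) E z C M τ N t s x A θ) {n k : ℕ}
    (hk : k < N n) {r : ℝ} (hr : r ∈ Ioc (t n k) (t n (k + 1))) : lastNode N t n r = k := by
  classical
  have h1 : k ≤ lastNode N t n r := Nat.le_findGreatest hk.le hr.1
  have h2 : t n (lastNode N t n r) < r :=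
    Nat.findGreatest_spec (P := fun k => t n k < r) hk.le hr.1
  by_contra hne
  have := (L.scheme n).t_mono (show k + 1 ≤ lastNode N t n r by omega)
  linarith [hr.2]

theorem ae_discretePower (L : IsLimitCurve T z₀ F₀ d (correction h d) E z C M τ N t s x A θ)
    (S : IsSystem T z₀ F₀ C_P d E P h) : ∀ᵐ r, r ∈ Ioo 0 T → ∀ n,
      discretePower E N t x n r = P r (x n (lastNode N t n r)) ∧
      (r, x n (lastNode N t n r)) ∈ sublevel T z₀ F₀ d E ((C + 1) * Real.exp (C_P * T)) := by
  have h1 : ∀ᵐ r, ∀ n k, r ∈ Ioo 0 T → deriv (fun r' => E r' (x n k)) r = P r (x n k) :=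
    ae_all_iff.2 fun n => ae_all_iff.2 fun k => S.ae_deriv_energy (x n k)
  filter_upwards [h1] with r hr hr0 n
  refine ⟨hr n _ hr0, Ioo_subset_Icc_self hr0, ?_⟩
  have := S.perturbedEnergy_le_of_mem ((L.scheme n).mem (lastNode N t n r))
    (Ioo_subset_Icc_self hr0)
  simp only
  linarith

/-- The discrete energy balance in integral form. -/
theorem energy_eq_integral (L : IsLimitCurve T z₀ F₀ d (correction h d) E z C M τ N t s x A θ)
    (S : IsSystem T z₀ F₀ C_P d E P h) {n k : ℕ} (hk : k ≤ N n) :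
    E (t n k) (x n k) + (s n k - t n k) =
      E 0 z + ∫ r in (0 : ℝ)..t n k, discretePower E N t x n r := by
  have hmem : ∀ i, t n i ∈ Icc 0 T := fun i => ((L.scheme n).mem i).1
  have hpiece : ∀ i < k, IntervalIntegrable (discretePower E N t x n) volume (t n i) (t n (i + 1)) ∧
      E (t n (i + 1)) (x n i) - E (t n i) (x n i) =
        ∫ r in t n i..t n (i + 1), discretePower E N t x n r := by
    intro i hi
    have hle := (L.scheme n).t_mono (Nat.le_succ i)
    obtain ⟨h1, h2⟩ := S.energy_sub_eq_integral (x n i) (hmem i).1 hle (hmem (i + 1)).2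
    have hcongr : ∀ r ∈ uIoc (t n i) (t n (i + 1)),
        deriv (fun r' => E r' (x n i)) r = discretePower E N t x n r := by
      intro r hr
      rw [uIoc_of_le hle] at hr
      rw [discretePower, L.lastNode_eq (hi.trans_le hk) hr]
    exact ⟨h1.congr hcongr, h2.trans (intervalIntegral.integral_congr_ae
      (Eventually.of_forall hcongr))⟩
  rw [(L.scheme n).balance k, Finset.sum_congr rfl fun i hi => (hpiece i (Finset.mem_range.1 hi)).2,
    intervalIntegral.sum_integral_adjacent_intervals fun i hi => (hpiece i hi).1,
    (L.scheme n).t_zero]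

/-- The discrete power exceeds the power of the limit curve by an amount that tends to zero: at
almost all times, the energies at the last nodes converge, so that the power is upper semicontinuous
along them. -/
theorem tendsto_discretePower_excess [T2Space Z]
    (L : IsLimitCurve T z₀ F₀ d (correction h d) E z C M τ N t s x A θ)
    (S : IsSystem T z₀ F₀ C_P d E P h) (hN : ∀ n, N n ≠ 0) :
    ∀ᵐ r, r ∈ Icc 0 T → Tendsto (fun n => max (discretePower E N t x n r - P r (curve A θ r)) 0)
      atTop (𝓝 0) := by
  obtain ⟨K, hK⟩ := S.energy_sub_le (C := C)
  filter_upwards [L.ae_discretePower S, L.ae_mem_regularTimes S hN] with r h1 h2 hr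
  have hreg := h2 hr
  have h1 := h1 hreg.1
  have ht : Tendsto (fun n => t n (lastNode N t n r)) atTop (𝓝 r) := by
    have h3 : Tendsto (fun n => r - τ n) atTop (𝓝 r) := by simpa using L.mesh.const_sub r
    exact tendsto_of_tendsto_of_tendsto_of_le_of_le h3 tendsto_const_nhds
      (fun n => (L.lastNode_spec n hreg.1).2) (fun n => (L.lastNode_spec n hreg.1).1.le)
  have hs : Tendsto (fun n => s n (lastNode N t n r)) atTop (𝓝 (entry A θ r)) := by
    refine L.tendsto_node (Eventually.of_forall fun n => lastNode_le n r)
      fun ψ a hψ ha _ hlim => ?_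
    have hfib : a ∈ fiber A θ r :=
      ⟨ha, tendsto_nhds_unique ((continuous_fst.tendsto _).comp hlim) (ht.comp hψ)⟩
    refine le_antisymm ?_ ((L.isLeast_entry S hN hr).2 hfib)
    rw [hreg.2]
    exact (L.isGreatest_exit S hN hr).2 hfib
  have hE := (L.tendsto_energy_node S hN ⟨hreg.1.1, hr.2⟩ (fun n => lastNode_le n r) hs).1
  have hx := (L.limit_id (Eventually.of_forall fun n => lastNode_le n r) hs).2
  rw [L.θ_entry S hN hr] at hx
  have hE' : Tendsto (fun n => E r (x n (lastNode N t n r))) atTop (𝓝 (E r (curve A θ r))) := by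
    have h4 : Tendsto (fun n => E r (x n (lastNode N t n r)) -
        E (t n (lastNode N t n r)) (x n (lastNode N t n r))) atTop (𝓝 0) := by
      have h5 : Tendsto (fun n => (K : ℝ) * |r - t n (lastNode N t n r)|) atTop (𝓝 0) := by
        simpa using ((ht.const_sub r).abs).const_mul (K : ℝ)
      exact squeeze_zero_norm (fun n => hK _ ⟨_, (L.scheme n).mem _⟩ _ ((L.scheme n).mem _).1 _ hr)
        h5
    simpa using h4.add hE
  have hP : ∀ c, P r (curve A θ r) < c → ∀ᶠ n in atTop, P r (x n (lastNode N t n r)) < c :=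
    fun c hc => S.eventually_power_lt (p := fun n => (r, x n (lastNode N t n r)))
      (q := (r, curve A θ r)) (fun n => (h1 n).2)
      (tendsto_const_nhds.prodMk_nhds ((continuous_snd.tendsto _).comp hx)) hE' hc
  rw [tendsto_order]
  refine ⟨fun a ha => Eventually.of_forall fun n => lt_of_lt_of_le ha (le_max_right _ _),
    fun a ha => ?_⟩
  filter_upwards [hP (P r (curve A θ r) + a) (by linarith)] with n hn
  rw [(h1 n).1]
  exact max_lt (by linarith) ha

/-- Reverse Fatou lemma for the discrete powers, by dominated convergence of their excess. -/
theorem tendsto_integral_excess [T2Space Z]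
    (L : IsLimitCurve T z₀ F₀ d (correction h d) E z C M τ N t s x A θ)
    (S : IsSystem T z₀ F₀ C_P d E P h) (hN : ∀ n, N n ≠ 0) :
    (∀ n, IntegrableOn (discretePower E N t x n) (Icc 0 T)) ∧
    Tendsto (fun n => ∫ r in Icc 0 T, max (discretePower E N t x n r - P r (curve A θ r)) 0)
      atTop (𝓝 0) := by
  set B := C_P * ((C + 1) * Real.exp (C_P * T)) with hB
  have hint := L.integrableOn_power S hN
  have hae : ∀ᵐ r ∂volume.restrict (Icc 0 T), ∀ n, |discretePower E N t x n r| ≤ B ∧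
      |P r (curve A θ r)| ≤ C_P * C := by
    rw [ae_restrict_iff' measurableSet_Icc]
    filter_upwards [L.ae_discretePower S, L.ae_mem_regularTimes S hN] with r h1 h2 hr n
    rw [((h1 (h2 hr).1) n).1]
    exact ⟨S.abs_power_le ((h1 (h2 hr).1) n).2, S.abs_power_le (L.curve_mem S hN hr)⟩
  have hfin : volume (Icc 0 T) < ⊤ := measure_Icc_lt_top
  have hdisc : ∀ n, IntegrableOn (discretePower E N t x n) (Icc 0 T) := fun n =>
    ⟨(measurable_discretePower _ _ _ _ n).aestronglyMeasurable,
      HasFiniteIntegral.restrict_of_bounded B hfin (hae.mono fun r hr => (hr n).1)⟩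
  refine ⟨hdisc, ?_⟩
  have := tendsto_integral_of_dominated_convergence (μ := volume.restrict (Icc 0 T))
    (F := fun n r => max (discretePower E N t x n r - P r (curve A θ r)) 0) (f := fun _ => 0)
    (fun _ => B + C_P * C) (fun n => (((hdisc n).sub hint).sup (integrable_zero _ _ _)).1)
    (integrable_const_iff.2 (Or.inr ⟨by simp⟩)) ?_ ?_
  · simpa using this
  · intro n
    filter_upwards [hae] with r hr
    obtain ⟨h1, h2⟩ := hr n
    rw [Real.norm_of_nonneg (le_max_right _ _)]
    exact max_le (by linarith [(abs_le.1 h1).2, (abs_le.1 h2).1])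
      (add_nonneg ((abs_nonneg _).trans h1) ((abs_nonneg _).trans h2))
  · rw [ae_restrict_iff' measurableSet_Icc]
    exact L.tendsto_discretePower_excess S hN

/-- The energy inequality of the limit curve, in terms of its parameter. -/
theorem energy_add_entry_le [T2Space Z]
    (L : IsLimitCurve T z₀ F₀ d (correction h d) E z C M τ N t s x A θ)
    (S : IsSystem T z₀ F₀ C_P d E P h) (hN : ∀ n, N n ≠ 0) {r : ℝ} (hr : r ∈ Icc 0 T) :
    E r (curve A θ r) + (entry A θ r - r) ≤ E 0 z + ∫ r' in (0 : ℝ)..r, P r' (curve A θ r') := by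
  rcases hr.1.eq_or_lt with rfl | h0
  · rw [(L.entry_zero S hN).1, (L.entry_zero S hN).2]
    simp
  obtain ⟨k, hk, hs⟩ := L.approx _ (L.isLeast_entry S hN hr).1.1
  have hE := (L.tendsto_energy_node S hN ⟨h0, hr.2⟩ hk hs).1
  have h1 := (L.limit_id (Eventually.of_forall hk) hs).2
  rw [L.θ_entry S hN hr] at h1
  have ht : Tendsto (fun n => t n (k n)) atTop (𝓝 r) := (continuous_fst.tendsto _).comp h1
  obtain ⟨hdisc, hexc⟩ := L.tendsto_integral_excess S hN
  have hint := L.integrableOn_power S hN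
  have hprim : Tendsto (fun n => ∫ r' in (0 : ℝ)..t n (k n), P r' (curve A θ r')) atTop
      (𝓝 (∫ r' in (0 : ℝ)..r, P r' (curve A θ r'))) := by
    have hI : IntervalIntegrable (fun r' => P r' (curve A θ r')) volume 0 T :=
      (intervalIntegrable_iff_integrableOn_Icc_of_le S.T_pos.le).2 hint
    have := intervalIntegral.continuousOn_primitive_interval' hI left_mem_uIcc
    rw [uIcc_of_le S.T_pos.le] at this
    exact (this r hr).tendsto.comp (tendsto_nhdsWithin_iff.2
      ⟨ht, Eventually.of_forall fun n => ((L.scheme n).mem _).1⟩)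
  have hlim := (hprim.const_add (E 0 z)).add hexc
  rw [add_zero] at hlim
  refine le_of_tendsto_of_tendsto (hE.add (hs.sub ht)) hlim (Eventually.of_forall fun n => ?_)
  have hmem := ((L.scheme n).mem (k n)).1
  have hsub : Ioc 0 (t n (k n)) ⊆ Icc 0 T := fun a ha => ⟨ha.1.le, ha.2.trans hmem.2⟩
  simp only
  rw [L.energy_eq_integral S (hk n), add_assoc, add_le_add_iff_left,
    intervalIntegral.integral_of_le hmem.1, intervalIntegral.integral_of_le hmem.1]
  have hexcI : IntegrableOn (fun r' => max (discretePower E N t x n r' - P r' (curve A θ r')) 0)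
      (Icc 0 T) := ((hdisc n).sub hint).sup (integrable_zero _ _ _)
  calc ∫ r' in Ioc 0 (t n (k n)), discretePower E N t x n r'
      ≤ ∫ r' in Ioc 0 (t n (k n)), (P r' (curve A θ r') +
          max (discretePower E N t x n r' - P r' (curve A θ r')) 0) := by
        refine integral_mono ((hdisc n).mono_set hsub)
          ((hint.mono_set hsub).add (hexcI.mono_set hsub)) fun r' => ?_
        have := le_max_left (discretePower E N t x n r' - P r' (curve A θ r')) 0
        simp only
        linarith
    _ = (∫ r' in Ioc 0 (t n (k n)), P r' (curve A θ r')) + ∫ r' in Ioc 0 (t n (k n)),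
          max (discretePower E N t x n r' - P r' (curve A θ r')) 0 :=
        integral_add (hint.mono_set hsub) (hexcI.mono_set hsub)
    _ ≤ _ := by
        refine add_le_add_right ?_ _
        exact setIntegral_mono_set hexcI (Eventually.of_forall fun _ => le_max_right _ _)
          hsub.eventuallyLE

end IsLimitCurve

/-- For nearby states the correction is negligible in the stability condition. -/
theorem IsPreSystem.eventually_energy_le_of_stable {Z : Type*} [TopologicalSpace Z] {T : ℝ} {z₀ : Z}
    {F₀ C_P : ℝ} {d : Z → Z → ℝ≥0∞} {E P : ℝ → Z → ℝ} {h : ℝ≥0 → ℝ≥0}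
    (S : IsPreSystem T z₀ F₀ C_P d E P h) {l : Filter ℝ} {u : ℝ → Z} {y : Z}
    (hd : Tendsto (fun s => d (u s) y) l (𝓝 0)) {ε : ℝ} (hε : 0 < ε) :
    ∀ᶠ s in l, d (u s) y ≠ ⊤ ∧ (StableAt E d (correction h d) s (u s) →
      E s (u s) ≤ E s y + (1 + ε) * (d (u s) y).toReal) := by
  have h1 := exists_gauge_le_mul S.h_mono S.h_cont S.h_zero (ε := ε.toNNReal)
    (Real.toNNReal_pos.2 hε)
  filter_upwards [hd.eventually h1, hd.eventually (gt_mem_nhds ENNReal.zero_lt_top)] with s h2 h3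
  refine ⟨h3.ne, fun hst => ?_⟩
  have h4 : d (u s) y + correction h d (u s) y ≤ ENNReal.ofReal ((1 + ε) * (d (u s) y).toReal) := by
    rw [ENNReal.ofReal_mul (by positivity), ENNReal.ofReal_toReal h3.ne,
      ENNReal.ofReal_add zero_le_one hε.le, ENNReal.ofReal_one, add_mul, one_mul]
    exact add_le_add_right h2 _
  have h5 := ENNReal.toReal_mono ENNReal.ofReal_ne_top h4
  rw [ENNReal.toReal_ofReal (by positivity)] at h5
  have := hst y (ne_top_of_le_ne_top ENNReal.ofReal_ne_top h4)
  linarith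

/-! ### Stability compared with variation -/

/-- The augmented variation of a left-continuous curve grows at least by the distance and by the
incremental cost of the jump at the left end point. -/
theorem augmentedVariation_add_le {Z : Type*} [TopologicalSpace Z] {T : ℝ}
    {d δ : Z → Z → ℝ≥0∞} {E : ℝ → Z → ℝ} {u : ℝ → Z} (hself : ∀ x, d x x = 0)
    (htri : ∀ x y z, d x z ≤ d x y + d y z) (hu : ∀ r ∈ Icc 0 T, leftLimit u r = u r) {s t : ℝ}
    (hs : 0 ≤ s) (hst : s < t) (ht : t ≤ T) :
    augmentedVariation T E d δ u 0 s +
      (d (u s) (u t) + incrementalCost E d δ s (u s) (rightLimit T u s)) ≤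
      augmentedVariation T E d δ u 0 t := by
  rw [augmentedVariation_eq_of_leftLimit hself hu ⟨hs, hst.le.trans ht⟩,
    augmentedVariation_eq_of_leftLimit hself hu ⟨hs.trans hst.le, ht⟩,
    ← variation_Icc_add htri hs hst.le]
  have h1 := dist_le_variation (d := d) (u := u) (left_mem_Icc.2 hst.le) (right_mem_Icc.2 hst.le)
    hst.le
  have h2 := tsum_indicator_add_le (B := Ico 0 s) (C := Ico 0 t) (i := s)
    (f := fun r' => incrementalCost E d δ r' (u r') (rightLimit T u r'))
    (Ico_subset_Ico_right hst.le) ⟨hs, hst⟩ fun h0 => lt_irrefl _ h0.2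
  calc _ = (variation d u (Icc 0 s) + d (u s) (u t)) + (_ +
        incrementalCost E d δ s (u s) (rightLimit T u s)) := by ring
    _ ≤ _ := add_le_add (add_le_add_right h1 _) h2

namespace IsLimitCurve

variable {Z : Type*} [TopologicalSpace Z] {T : ℝ} {z₀ : Z} {F₀ C_P : ℝ}
  {d : Z → Z → ℝ≥0∞} {E P : ℝ → Z → ℝ} {h : ℝ≥0 → ℝ≥0} {z : Z} {C M : ℝ} {τ : ℕ → ℝ} {N : ℕ → ℕ}
  {t s : ℕ → ℕ → ℝ} {x : ℕ → ℕ → Z} {A : Set ℝ} {θ : ℝ → ℝ × Z}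

theorem augmentedVariation_ne_top [T2Space Z]
    (L : IsLimitCurve T z₀ F₀ d (correction h d) E z C M τ N t s x A θ)
    (S : IsSystem T z₀ F₀ C_P d E P h) (hN : ∀ n, N n ≠ 0) {r : ℝ} (hr : r ∈ Icc 0 T) :
    augmentedVariation T E d (correction h d) (curve A θ) 0 r ≠ ⊤ :=
  ne_top_of_le_ne_top ENNReal.ofReal_ne_top (L.augmentedVariation_le S hN hr)

theorem dist_add_incrementalCost_le_sub [T2Space Z]
    (L : IsLimitCurve T z₀ F₀ d (correction h d) E z C M τ N t s x A θ)
    (S : IsSystem T z₀ F₀ C_P d E P h) (hN : ∀ n, N n ≠ 0) {r r' : ℝ} (hr : 0 ≤ r) (hlt : r < r')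
    (hr' : r' ≤ T) :
    d (curve A θ r) (curve A θ r') + incrementalCost E d (correction h d) r (curve A θ r)
      (rightLimit T (curve A θ) r) ≤ ENNReal.ofReal
        ((augmentedVariation T E d (correction h d) (curve A θ) 0 r').toReal -
          (augmentedVariation T E d (correction h d) (curve A θ) 0 r).toReal) := by
  have h1 := augmentedVariation_add_le (E := E) (δ := correction h d) S.dist.self_eq_zero
    S.dist.triangle (fun r hr => L.leftLimit_curve S hN hr) hr hlt hr'
  have h2 := L.augmentedVariation_ne_top S hN (r := r) ⟨hr, hlt.le.trans hr'⟩
  have h3 := L.augmentedVariation_ne_top S hN (r := r') ⟨hr.trans hlt.le, hr'⟩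
  rw [ENNReal.ofReal_sub _ ENNReal.toReal_nonneg, ENNReal.ofReal_toReal h2,
    ENNReal.ofReal_toReal h3]
  exact ENNReal.le_sub_of_add_le_left h2 h1

theorem toReal_augmentedVariation_mono [T2Space Z]
    (L : IsLimitCurve T z₀ F₀ d (correction h d) E z C M τ N t s x A θ)
    (S : IsSystem T z₀ F₀ C_P d E P h) (hN : ∀ n, N n ≠ 0) {r r' : ℝ} (hr : 0 ≤ r) (hlt : r < r')
    (hr' : r' ≤ T) :
    (augmentedVariation T E d (correction h d) (curve A θ) 0 r).toReal ≤
      (augmentedVariation T E d (correction h d) (curve A θ) 0 r').toReal :=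
  ENNReal.toReal_mono (L.augmentedVariation_ne_top S hN ⟨hr.trans hlt.le, hr'⟩)
    (le_self_add.trans (augmentedVariation_add_le (E := E) (δ := correction h d)
      S.dist.self_eq_zero S.dist.triangle (fun _ hr => L.leftLimit_curve S hN hr) hr hlt hr'))

/-! ### The lower energy estimate -/

theorem intervalIntegrable_power [T2Space Z]
    (L : IsLimitCurve T z₀ F₀ d (correction h d) E z C M τ N t s x A θ)
    (S : IsSystem T z₀ F₀ C_P d E P h) (hN : ∀ n, N n ≠ 0) {a b : ℝ} (ha : a ∈ Icc 0 T)
    (hb : b ∈ Icc 0 T) : IntervalIntegrable (fun r => P r (curve A θ r)) volume a b :=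
  ((intervalIntegrable_iff_integrableOn_Icc_of_le S.T_pos.le).2
    (L.integrableOn_power S hN)).mono_set
    (by rw [uIcc_of_le S.T_pos.le]; exact uIcc_subset_Icc ha hb)

/-- The increments from the left of the functional in `energy_le_energy_add`: here stability, the
power control and the upper semicontinuity of the power enter. -/
theorem eventually_left [T2Space Z]
    (L : IsLimitCurve T z₀ F₀ d (correction h d) E z C M τ N t s x A θ)
    (S : IsSystem T z₀ F₀ C_P d E P h) (hN : ∀ n, N n ≠ 0) {r : ℝ} (hr : r ∈ Ioc 0 T) {ε : ℝ}
    (hε : 0 < ε) : ∀ᶠ r' in 𝓝[<] r,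
      E r' (curve A θ r') +
        (1 + ε) * (augmentedVariation T E d (correction h d) (curve A θ) 0 r').toReal ≤
      E r (curve A θ r) +
        (1 + ε) * (augmentedVariation T E d (correction h d) (curve A θ) 0 r).toReal -
        (∫ a in r'..r, P a (curve A θ a)) + ε * (r - r') := by
  have hr0 : r ∈ Icc 0 T := ⟨hr.1.le, hr.2⟩
  have hd := ((L.isBV_curve S hN).regulated.left_lim r hr).2
  rw [L.leftLimit_curve S hN hr0] at hd
  have hlt := L.eventually_power_curve_lt S hN (l := 𝓝[<] r) (r := r)
    (c := P r (curve A θ r) + ε / 2)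
    ((eventually_mem_Icc_left hr).mono fun a ha => ⟨ha.2, ha.1.2⟩)
    (tendsto_id.mono_left nhdsWithin_le_nhds) (L.tendsto_curve_left S hN hr) (by linarith)
  obtain ⟨a₀, ha₀, hIoo⟩ := mem_nhdsLT_iff_exists_Ioo_subset.1 hlt
  filter_upwards [S.eventually_energy_le_of_stable hd hε, eventually_mem_Icc_left hr,
    Ioo_mem_nhdsLT ha₀, S.eventually_left_quotient hr (curve A θ r)
      (c := P r (curve A θ r) - ε / 2) (by linarith)] with r' h1 h2 h3 h4
  have h5 := h1.2 (L.stableAt_curve S hN ⟨h2.2, h2.1.2⟩)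
  have h6 : (d (curve A θ r') (curve A θ r)).toReal ≤
      (augmentedVariation T E d (correction h d) (curve A θ) 0 r).toReal -
        (augmentedVariation T E d (correction h d) (curve A θ) 0 r').toReal := by
    have := ENNReal.toReal_mono ENNReal.ofReal_ne_top
      (le_self_add.trans (L.dist_add_incrementalCost_le_sub S hN h2.2.le h3.2 hr.2))
    rwa [ENNReal.toReal_ofReal (sub_nonneg.2
      (L.toReal_augmentedVariation_mono S hN h2.2.le h3.2 hr.2))] at this
  have h7 : (∫ a in r'..r, P a (curve A θ a)) ≤ (P r (curve A θ r) + ε / 2) * (r - r') := by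
    have := intervalIntegral.integral_mono_on h3.2.le (L.intervalIntegrable_power S hN h2.1 hr0)
      (intervalIntegrable_const (c := P r (curve A θ r) + ε / 2)) fun a ha => ?_
    · rw [intervalIntegral.integral_const, smul_eq_mul, mul_comm] at this
      exact this
    · rcases ha.2.lt_or_eq with hlt' | rfl
      · exact le_of_lt (hIoo ⟨h3.1.trans_le ha.1, hlt'⟩)
      · linarith
  have h8 := mul_le_mul_of_nonneg_left h6 (show 0 ≤ 1 + ε by linarith)
  linarith

/-- The increments from the right of the functional in `energy_le_energy_add`: the jump cost
dominates the energy released in the jump. -/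
theorem eventually_right [T2Space Z]
    (L : IsLimitCurve T z₀ F₀ d (correction h d) E z C M τ N t s x A θ)
    (S : IsSystem T z₀ F₀ C_P d E P h) (hN : ∀ n, N n ≠ 0) {r : ℝ} (hr : r ∈ Ico 0 T) {η : ℝ}
    (hη : 0 < η) : ∀ᶠ r' in 𝓝[>] r,
      E r (curve A θ r) +
        (augmentedVariation T E d (correction h d) (curve A θ) 0 r).toReal - η ≤
      E r' (curve A θ r') +
        (augmentedVariation T E d (correction h d) (curve A θ) 0 r').toReal := by
  have hr0 : r ∈ Icc 0 T := ⟨hr.1, hr.2.le⟩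
  have hlim := ((L.isBV_curve S hN).regulated.right_lim r hr).1
  set y := rightLimit T (curve A θ) r with hy
  have hfar : ∀ a ∈ Icc 0 T, d z₀ (curve A θ a) ≤
      d z₀ (curve A θ 0) + variation d (curve A θ) (Icc 0 T) := fun a ha =>
    (S.dist.triangle _ _ _).trans (add_le_add_right
      (dist_le_variation (left_mem_Icc.2 S.T_pos.le) ha ha.1) _)
  have h1 := S.eventually_sub_le_energy_of_tendsto (l := 𝓝[>] r) (t := id)
    ((eventually_mem_Icc_right hr).mono fun a ha => ha.1)
    (tendsto_id.mono_left nhdsWithin_le_nhds) hlim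
    (ENNReal.add_ne_top.2 ⟨S.dist.finite_from _, (L.isBV_curve S hN).finite_variation⟩)
    ((eventually_mem_Icc_right hr).mono fun a ha => hfar a ha.1) (half_pos hη)
  have hcost := S.ofReal_energy_sub_le_jumpCost hr0 (curve A θ r) y (S.dist.finite_from _)
  rw [← dist_add_incrementalCost] at hcost
  set I := incrementalCost E d (correction h d) r (curve A θ r) y with hI
  have h2 : ∀ᶠ r' in 𝓝[>] r, ENNReal.ofReal (E r (curve A θ r) - E r y - η / 2) ≤
      d (curve A θ r) (curve A θ r') + I := by
    rcases le_or_gt (E r (curve A θ r) - E r y) 0 with h0 | h0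
    · refine Eventually.of_forall fun r' => ?_
      rw [ENNReal.ofReal_of_nonpos (by linarith)]
      exact zero_le
    · have hlsc : LowerSemicontinuous fun y' => d (curve A θ r) y' + I :=
        (S.dist.lsc.comp (Continuous.prodMk_right (curve A θ r))).add lowerSemicontinuous_const
      have h3 : ENNReal.ofReal (E r (curve A θ r) - E r y - η / 2) < d (curve A θ r) y + I :=
        lt_of_lt_of_le ((ENNReal.ofReal_lt_ofReal_iff h0).2 (by linarith)) hcost
      exact (hlim.eventually (hlsc y _ h3)).mono fun r' h4 => le_of_lt h4
  filter_upwards [h1, h2, eventually_mem_Icc_right hr, self_mem_nhdsWithin] with r' h3 h4 h5 h6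
  have h7 := L.dist_add_incrementalCost_le_sub S hN hr.1 h6 h5.1.2
  have h8 := (ENNReal.ofReal_le_ofReal_iff (sub_nonneg.2
    (L.toReal_augmentedVariation_mono S hN hr.1 h6 h5.1.2))).1 (h4.trans h7)
  simp only [id] at h3
  linarith

/-- The lower energy estimate. The energy plus `1 + ε` times the augmented variation, minus the work
of the power, decreases at most at rate `ε`, by stability from the left and the jump cost from the
right. -/
theorem energy_le_energy_add [T2Space Z]
    (L : IsLimitCurve T z₀ F₀ d (correction h d) E z C M τ N t s x A θ)
    (S : IsSystem T z₀ F₀ C_P d E P h) (hN : ∀ n, N n ≠ 0) {r : ℝ} (hr : r ∈ Icc 0 T) :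
    E 0 z + ∫ a in (0 : ℝ)..r, P a (curve A θ a) ≤ E r (curve A θ r) +
      (augmentedVariation T E d (correction h d) (curve A θ) 0 r).toReal := by
  set m : ℝ → ℝ := fun r => (augmentedVariation T E d (correction h d) (curve A θ) 0 r).toReal
    with hm
  set q : ℝ → ℝ := fun r => ∫ a in (0 : ℝ)..r, P a (curve A θ a) with hq
  have h00 : (0 : ℝ) ∈ Icc 0 T := ⟨le_rfl, S.T_pos.le⟩
  have hm0 : m 0 = 0 := by
    have := L.augmentedVariation_le S hN h00
    rw [(L.entry_zero S hN).1, sub_zero, ENNReal.ofReal_zero, nonpos_iff_eq_zero] at this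
    simp only [hm, this, ENNReal.toReal_zero]
  have hqsub : ∀ a ∈ Icc 0 T, ∀ b ∈ Icc 0 T, q b - q a = ∫ c in a..b, P c (curve A θ c) :=
    fun a ha b hb => intervalIntegral.integral_interval_sub_left
      (L.intervalIntegrable_power S hN h00 hb) (L.intervalIntegrable_power S hN h00 ha)
  have hqc : ContinuousOn q (Icc 0 T) := by
    have := intervalIntegral.continuousOn_primitive_interval'
      (L.intervalIntegrable_power S hN h00 (right_mem_Icc.2 S.T_pos.le)) left_mem_uIcc
    rwa [uIcc_of_le S.T_pos.le] at this
  have key : ∀ ε > 0, E 0 z ≤ E r (curve A θ r) + (1 + ε) * m r - q r + ε * r := by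
    intro ε hε
    have := le_of_eventually_left_of_eventually_right hr.1
      (f := fun r => E r (curve A θ r) + (1 + ε) * m r - q r + ε * r) ?_ ?_
    · simpa [hm0, hq, (L.entry_zero S hN).2] using this
    · intro t ht
      have ht' : t ∈ Ioc 0 T := ⟨ht.1, ht.2.trans hr.2⟩
      filter_upwards [L.eventually_left S hN ht' hε, eventually_mem_Icc_left ht'] with r' h1 h2
      have := hqsub r' h2.1 t ⟨ht'.1.le, ht'.2⟩
      simp only [hm] at h1 ⊢
      linarith
    · intro t ht η hη
      have ht' : t ∈ Ico 0 T := ⟨ht.1, ht.2.trans_le hr.2⟩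
      have hq' : ∀ᶠ r' in 𝓝[>] t, q r' < q t + η / 2 := by
        have h1 : 𝓝[>] t ≤ 𝓝[Icc 0 T] t := by
          rw [← nhdsWithin_Ioo_eq_nhdsGT ht'.2]
          exact nhdsWithin_mono _ fun a ha => ⟨ht'.1.trans ha.1.le, ha.2.le⟩
        exact ((hqc t ⟨ht'.1, ht'.2.le⟩).mono_left h1).eventually (gt_mem_nhds (by linarith))
      filter_upwards [L.eventually_right S hN ht' (half_pos hη), eventually_mem_Icc_right ht',
        self_mem_nhdsWithin, hq'] with r' h1 h2 h3 h4
      have h5 : m t ≤ m r' := L.toReal_augmentedVariation_mono S hN ht'.1 h3 h2.1.2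
      have h6 : 0 ≤ ε * (m r' - m t) := mul_nonneg hε.le (sub_nonneg.2 h5)
      have h7 : 0 ≤ ε * (r' - t) := mul_nonneg hε.le (sub_nonneg.2 (le_of_lt h3))
      simp only [hm] at h1 h6 ⊢
      linarith
  have hlim : Tendsto (fun ε : ℝ => E r (curve A θ r) + (1 + ε) * m r - q r + ε * r) (𝓝[>] 0)
      (𝓝 (E r (curve A θ r) + (1 + 0) * m r - q r + 0 * r)) := by
    refine Tendsto.mono_left ?_ nhdsWithin_le_nhds
    exact Continuous.tendsto (by fun_prop) 0
  have := ge_of_tendsto hlim (eventually_nhdsWithin_of_forall fun ε hε => key ε hε)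
  simp only [hm, hq] at this ⊢
  linarith

/-- The upper and the lower energy estimate leave no room: the released energy is the augmented
variation. -/
theorem isVESolution_curve [T2Space Z]
    (L : IsLimitCurve T z₀ F₀ d (correction h d) E z C M τ N t s x A θ)
    (S : IsSystem T z₀ F₀ C_P d E P h) (hN : ∀ n, N n ≠ 0) :
    IsVESolution T E P d (correction h d) (curve A θ) where
  bv := L.isBV_curve S hN
  stable r hr := stableAt_iff.1 (L.stableAt_curve_of_notMem_jumpSet S hN hr.1 hr.2)
  integrable := L.integrableOn_power S hN
  balance r hr := by
    have h1 := L.energy_le_energy_add S hN hr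
    have h2 := L.energy_add_entry_le S hN hr
    have h3 := ENNReal.toReal_mono ENNReal.ofReal_ne_top (L.augmentedVariation_le S hN hr)
    have h4 := L.entry_sub_mono S hN ⟨le_rfl, S.T_pos.le⟩ hr hr.1
    simp only [(L.entry_zero S hN).1, sub_zero] at h4
    rw [ENNReal.toReal_ofReal h4] at h3
    rw [← EReal.coe_ennreal_toReal (L.augmentedVariation_ne_top S hN hr), ← EReal.coe_add,
      (L.entry_zero S hN).2]
    exact congrArg _ (le_antisymm (by linarith) h1)

end IsLimitCurve

/-- Existence of visco-energetic solutions from every initial state. -/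
theorem IsSystem.exists_isVESolution {Z : Type*} [TopologicalSpace Z] [T2Space Z] {T : ℝ} {z₀ : Z}
    {F₀ C_P : ℝ} {d : Z → Z → ℝ≥0∞} {E P : ℝ → Z → ℝ} {h : ℝ≥0 → ℝ≥0}
    (S : IsSystem T z₀ F₀ C_P d E P h) (z : Z) :
    ∃ u, u 0 = z ∧ IsVESolution T E P d (correction h d) u := by
  obtain ⟨C, M, τ, N, t, s, x, A, θ, hN, L⟩ := S.exists_limitCurve z
  exact ⟨_, (L.entry_zero S hN).2, L.isVESolution_curve S hN⟩

/-! ### Reduction to the second variable -/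

theorem liftDist_isQuasiDistance {F Z : Type*} [TopologicalSpace F] [TopologicalSpace Z]
    {x₀ : F × Z} {d : Z → Z → ℝ≥0∞} (hd : IsQuasiDistance d x₀.2) :
    IsQuasiDistance (liftDist d : F × Z → F × Z → ℝ≥0∞) x₀ where
  lsc := hd.lsc.comp ((continuous_snd.comp continuous_fst).prodMk
    (continuous_snd.comp continuous_snd))
  self_eq_zero x := hd.self_eq_zero x.2
  finite_from x := hd.finite_from x.2
  triangle x y z := hd.triangle x.2 y.2 z.2

namespace IsPreSystem

variable {F Z : Type*} [TopologicalSpace F] [TopologicalSpace Z] {T : ℝ} {x₀ : F × Z} {F₀ C_P : ℝ}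
  {d : Z → Z → ℝ≥0∞} {E P : ℝ → F × Z → ℝ} {h : ℝ≥0 → ℝ≥0}

/-- Lifts of a convergent sequence that stay in a sublevel converge along a subsequence. -/
theorem exists_subseq_lift [T2Space Z]
    (S : IsPreSystem T x₀ F₀ C_P (liftDist d) E P h) {C : ℝ}
    {p : ℕ → ℝ × Z} {q : ℝ × Z} {φ : ℕ → F} (hp : Tendsto p atTop (𝓝 q))
    (hmem : ∀ n, ((p n).1, (φ n, (p n).2)) ∈ sublevel T x₀ F₀ (liftDist d) E C) :
    ∃ (ψ : ℕ → ℕ) (φ' : F), StrictMono ψ ∧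
      Tendsto (fun n => ((p (ψ n)).1, (φ (ψ n), (p (ψ n)).2))) atTop (𝓝 (q.1, (φ', q.2))) := by
  obtain ⟨l, -, ψ, hψ, hlim⟩ := S.lscCompact.compact C hmem
  have h1 := hp.comp hψ.tendsto_atTop
  have h2 : q.1 = l.1 := tendsto_nhds_unique ((continuous_fst.tendsto _).comp h1)
    ((continuous_fst.tendsto _).comp hlim)
  have h3 : q.2 = l.2.2 := tendsto_nhds_unique ((continuous_snd.tendsto _).comp h1)
    (((continuous_snd.comp continuous_snd).tendsto _).comp hlim)
  refine ⟨ψ, l.2.1, hψ, ?_⟩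
  rw [h2, h3]
  exact hlim

theorem bddBelow_energy (S : IsPreSystem T x₀ F₀ C_P (liftDist d) E P h) {t : ℝ}
    (ht : t ∈ Icc 0 T) (z : Z) : BddBelow (range fun φ => E t (φ, z)) := by
  refine ⟨-((d x₀.2 z).toReal + F₀), ?_⟩
  rintro _ ⟨φ, rfl⟩
  have := S.perturbedEnergy_nonneg ht (φ, z)
  simp only [perturbedEnergy, liftDist] at this ⊢
  linarith

theorem marginalEnergy_le (S : IsPreSystem T x₀ F₀ C_P (liftDist d) E P h) {t : ℝ}
    (ht : t ∈ Icc 0 T) (φ : F) (z : Z) : marginalEnergy E t z ≤ E t (φ, z) :=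
  ciInf_le (S.bddBelow_energy ht z) φ

theorem isLeast_marginalEnergy [T2Space F] [T2Space Z]
    (S : IsPreSystem T x₀ F₀ C_P (liftDist d) E P h) {t : ℝ}
    (ht : t ∈ Icc 0 T) (z : Z) :
    IsLeast (range fun φ => E t (φ, z)) (marginalEnergy E t z) := by
  refine ⟨?_, by rintro _ ⟨φ, rfl⟩; exact S.marginalEnergy_le ht φ z⟩
  obtain ⟨e, -, he, hemem⟩ := exists_seq_tendsto_sInf (S := range fun φ => E t (φ, z))
    ⟨_, x₀.1, rfl⟩ (S.bddBelow_energy ht z)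
  choose φ hφ using hemem
  obtain ⟨B, hB⟩ := he.bddAbove_range
  obtain ⟨ψ, φ', hψ, hlim⟩ := S.exists_subseq_lift (p := fun _ => (t, z)) (q := (t, z)) (φ := φ)
    (C := B + (d x₀.2 z).toReal + F₀) tendsto_const_nhds fun n => ⟨ht, by
      have := hB ⟨n, rfl⟩
      rw [← hφ n] at this
      simpa [perturbedEnergy, liftDist] using this⟩
  refine ⟨φ', le_antisymm ?_ (S.marginalEnergy_le ht φ' z)⟩
  refine S.energy_le_of_tendsto (p := fun n => (t, (φ (ψ n), z))) (q := (t, (φ', z)))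
    (C := B + (d x₀.2 z).toReal + F₀) (fun n => ⟨ht, ?_⟩) hlim (he.comp hψ.tendsto_atTop)
    (Eventually.of_forall fun n => (hφ (ψ n)).le)
  have := hB ⟨ψ n, rfl⟩
  rw [← hφ (ψ n)] at this
  simpa [perturbedEnergy, liftDist] using this

theorem mem_minimizers_iff [T2Space F] [T2Space Z]
    (S : IsPreSystem T x₀ F₀ C_P (liftDist d) E P h) {t : ℝ}
    (ht : t ∈ Icc 0 T) {φ : F} {z : Z} :
    φ ∈ minimizers E t z ↔ E t (φ, z) = marginalEnergy E t z := by
  refine ⟨fun hφ => le_antisymm ?_ (S.marginalEnergy_le ht φ z), fun hφ φ' => ?_⟩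
  · obtain ⟨φ', h1⟩ := (S.isLeast_marginalEnergy ht z).1
    rw [← h1]
    exact hφ φ'
  · rw [hφ]
    exact S.marginalEnergy_le ht φ' z

theorem minimizers_nonempty [T2Space F] [T2Space Z]
    (S : IsPreSystem T x₀ F₀ C_P (liftDist d) E P h) {t : ℝ}
    (ht : t ∈ Icc 0 T) (z : Z) : (minimizers E t z).Nonempty := by
  obtain ⟨φ, hφ⟩ := (S.isLeast_marginalEnergy ht z).1
  exact ⟨φ, (S.mem_minimizers_iff ht).2 hφ⟩

theorem lift_mem_sublevel [T2Space F] [T2Space Z]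
    (S : IsPreSystem T x₀ F₀ C_P (liftDist d) E P h) {C : ℝ} {p : ℝ × Z}
    (hp : p ∈ sublevel T x₀.2 F₀ d (marginalEnergy E) C) {φ : F} (hφ : φ ∈ minimizers E p.1 p.2) :
    (p.1, (φ, p.2)) ∈ sublevel T x₀ F₀ (liftDist d) E C := by
  refine ⟨hp.1, ?_⟩
  have := hp.2
  rwa [perturbedEnergy, ← (S.mem_minimizers_iff hp.1).1 hφ] at this

theorem mem_sublevel_of_lift [T2Space F] [T2Space Z]
    (S : IsPreSystem T x₀ F₀ C_P (liftDist d) E P h) {C : ℝ} {t : ℝ}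
    {φ : F} {z : Z} (hp : (t, (φ, z)) ∈ sublevel T x₀ F₀ (liftDist d) E C) :
    (t, z) ∈ sublevel T x₀.2 F₀ d (marginalEnergy E) C := by
  refine ⟨hp.1, le_trans ?_ hp.2⟩
  simp only [perturbedEnergy, liftDist]
  linarith [S.marginalEnergy_le hp.1 φ z]

/-- Minimizers over converging points, whose marginal energies converge, have a subsequence that
converges to a minimizer. -/
theorem exists_subseq_minimizers [T2Space F] [T2Space Z]
    (S : IsPreSystem T x₀ F₀ C_P (liftDist d) E P h) {C : ℝ}
    {p : ℕ → ℝ × Z} {q : ℝ × Z} {φ : ℕ → F}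
    (hp : ∀ n, p n ∈ sublevel T x₀.2 F₀ d (marginalEnergy E) C) (hpq : Tendsto p atTop (𝓝 q))
    (hφ : ∀ n, φ n ∈ minimizers E (p n).1 (p n).2)
    (hE : Tendsto (fun n => marginalEnergy E (p n).1 (p n).2) atTop
      (𝓝 (marginalEnergy E q.1 q.2))) :
    ∃ (ψ : ℕ → ℕ) (φ' : F), StrictMono ψ ∧ φ' ∈ minimizers E q.1 q.2 ∧
      Tendsto (fun n => ((p (ψ n)).1, (φ (ψ n), (p (ψ n)).2))) atTop (𝓝 (q.1, (φ', q.2))) ∧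
      Tendsto (fun n => E (p (ψ n)).1 (φ (ψ n), (p (ψ n)).2)) atTop (𝓝 (E q.1 (φ', q.2))) := by
  have hmem := fun n => S.lift_mem_sublevel (hp n) (hφ n)
  obtain ⟨ψ, φ', hψ, hlim⟩ := S.exists_subseq_lift hpq hmem
  have hq := (S.mem_sublevel_of_tendsto (fun n => hmem (ψ n)) hlim).1
  have hE' : Tendsto (fun n => E (p (ψ n)).1 (φ (ψ n), (p (ψ n)).2)) atTop
      (𝓝 (marginalEnergy E q.1 q.2)) := by
    refine (hE.comp hψ.tendsto_atTop).congr fun n => ?_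
    exact ((S.mem_minimizers_iff (hp (ψ n)).1).1 (hφ (ψ n))).symm
  have hmin : E q.1 (φ', q.2) = marginalEnergy E q.1 q.2 :=
    le_antisymm (S.energy_le_of_tendsto (fun n => hmem (ψ n)) hlim hE'
      (Eventually.of_forall fun n => le_rfl)) (S.marginalEnergy_le hq _ _)
  exact ⟨ψ, φ', hψ, (S.mem_minimizers_iff hq).2 hmin, hlim, hmin ▸ hE'⟩

theorem bddAbove_power [T2Space F] [T2Space Z]
    (S : IsPreSystem T x₀ F₀ C_P (liftDist d) E P h) {t : ℝ}
    (ht : t ∈ Icc 0 T) (z : Z) : BddAbove ((fun φ => P t (φ, z)) '' minimizers E t z) := by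
  refine ⟨C_P * perturbedEnergy x₀.2 F₀ d (marginalEnergy E) t z, ?_⟩
  rintro _ ⟨φ, hφ, rfl⟩
  have := (le_abs_self _).trans (S.bound t ht (φ, z))
  rwa [perturbedEnergy, (S.mem_minimizers_iff ht).1 hφ] at this

theorem power_le_marginalPower [T2Space F] [T2Space Z]
    (S : IsPreSystem T x₀ F₀ C_P (liftDist d) E P h) {t : ℝ}
    (ht : t ∈ Icc 0 T) {φ : F} {z : Z} (hφ : φ ∈ minimizers E t z) :
    P t (φ, z) ≤ marginalPower E P t z :=
  le_csSup (S.bddAbove_power ht z) ⟨φ, hφ, rfl⟩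

theorem isGreatest_marginalPower [T2Space F] [T2Space Z]
    (S : IsPreSystem T x₀ F₀ C_P (liftDist d) E P h) {t : ℝ}
    (ht : t ∈ Icc 0 T) (z : Z) :
    IsGreatest ((fun φ => P t (φ, z)) '' minimizers E t z) (marginalPower E P t z) := by
  refine ⟨?_, by rintro _ ⟨φ, hφ, rfl⟩; exact S.power_le_marginalPower ht hφ⟩
  obtain ⟨e, -, he, hemem⟩ := exists_seq_tendsto_sSup
    ((S.minimizers_nonempty ht z).image (fun φ => P t (φ, z))) (S.bddAbove_power ht z)
  choose φ hφ hφe using hemem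
  obtain ⟨ψ, φ', hψ, hφ', hlim, hE⟩ := S.exists_subseq_minimizers (p := fun _ => (t, z))
    (q := (t, z)) (φ := φ) (fun n => ⟨ht, le_rfl⟩) tendsto_const_nhds hφ tendsto_const_nhds
  refine ⟨φ', hφ', le_antisymm (S.power_le_marginalPower ht hφ') ?_⟩
  refine le_of_forall_gt fun c hc => ?_
  obtain ⟨c', hc', hcc⟩ := exists_between hc
  have h1 := S.eventually_power_lt (C := perturbedEnergy x₀.2 F₀ d (marginalEnergy E) t z)
    (fun n => S.lift_mem_sublevel (p := (t, z)) ⟨ht, le_rfl⟩ (hφ (ψ n))) hlim hE hc'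
  refine lt_of_le_of_lt (le_of_tendsto (he.comp hψ.tendsto_atTop) ?_) hcc
  filter_upwards [h1] with n hn
  simp only [Function.comp, ← hφe]
  exact hn.le

theorem exists_argmax [T2Space F] [T2Space Z]
    (S : IsPreSystem T x₀ F₀ C_P (liftDist d) E P h) {t : ℝ}
    (ht : t ∈ Icc 0 T) (z : Z) : ∃ φ ∈ minimizers E t z, P t (φ, z) = marginalPower E P t z :=
  (S.isGreatest_marginalPower ht z).1

/-- Compactness and lower semicontinuity pass to the marginal energy, by lifting with minimizers. -/
theorem lscCompact_marginal [T2Space F] [T2Space Z] [FirstCountableTopology Z]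
    (S : IsPreSystem T x₀ F₀ C_P (liftDist d) E P h) :
    LscCompact T x₀.2 F₀ d (marginalEnergy E) := by
  refine ⟨fun C q hq a ha => ?_, fun C p hp => ?_⟩
  · by_contra hcon
    rw [not_eventually] at hcon
    obtain ⟨p, hp, hpa⟩ := exists_seq_forall_of_frequently (hcon.and_eventually self_mem_nhdsWithin)
    choose φ hφ using fun n => S.minimizers_nonempty (hpa n).2.1 (p n).2
    have hmem := fun n => S.lift_mem_sublevel (hpa n).2 (hφ n)
    obtain ⟨ψ, φ', hψ, hlim⟩ := S.exists_subseq_lift (tendsto_nhdsWithin_iff.1 hp).1 hmem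
    have h1 := S.energy_le_of_tendsto (fun n => hmem (ψ n)) hlim (c := fun _ => a)
      tendsto_const_nhds (Eventually.of_forall fun n => by
        simp only
        rw [(S.mem_minimizers_iff (hpa (ψ n)).2.1).1 (hφ (ψ n))]
        exact not_lt.1 (hpa (ψ n)).1)
    exact absurd ha (not_lt.2 ((S.marginalEnergy_le hq.1 _ _).trans h1))
  · choose φ hφ using fun n => S.minimizers_nonempty (hp n).1 (p n).2
    obtain ⟨l, hl, ψ, hψ, hlim⟩ := S.lscCompact.compact C
      fun n => S.lift_mem_sublevel (hp n) (hφ n)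
    exact ⟨(l.1, l.2.2), S.mem_sublevel_of_lift hl, ψ, hψ,
      ((continuous_fst.prodMk (continuous_snd.comp continuous_snd)).tendsto _).comp hlim⟩

/-- The reduced system is a system of the same kind. -/
theorem marginal [T2Space F] [T2Space Z] [FirstCountableTopology Z]
    (S : IsPreSystem T x₀ F₀ C_P (liftDist d) E P h) (hd : IsQuasiDistance d x₀.2)
    (hsep : Separates d) :
    IsSystem T x₀.2 F₀ C_P d (marginalEnergy E) (marginalPower E P) h where
  T_pos := S.T_pos
  C_pos := S.C_pos
  dist := hd
  lscCompact := S.lscCompact_marginal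
  left_continuous := by
    intro C x y hx hxy v
    have h0 : (0 : ℝ) ∈ Icc 0 T := ⟨le_rfl, S.T_pos.le⟩
    refine tendsto_of_subseq_tendsto fun ns hns => ?_
    choose φ hφ using fun n => S.minimizers_nonempty h0 (x (ns n))
    have hmem := fun n => S.lift_mem_sublevel (p := (0, x (ns n))) ⟨h0, hx (ns n)⟩ (hφ n)
    obtain ⟨ψ, φ', hψ, hlim⟩ := S.exists_subseq_lift (p := fun n => ((0 : ℝ), x (ns n)))
      (q := (0, y)) (tendsto_const_nhds.prodMk_nhds (hxy.comp hns)) hmem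
    exact ⟨ψ, S.left_continuous C (fun n => (φ (ψ n), x (ns (ψ n)))) (φ', y)
      (fun n => (hmem (ψ n)).2) ((continuous_snd.tendsto _).comp hlim) (x₀.1, v)⟩
  eventually_left_quotient := by
    intro t ht z c hc
    have ht' : t ∈ Icc 0 T := ⟨ht.1.le, ht.2⟩
    obtain ⟨φ, hφ, hP⟩ := S.exists_argmax ht' z
    rw [← hP] at hc
    filter_upwards [S.eventually_left_quotient ht (φ, z) hc,
      eventually_mem_Icc_left ht] with s h1 h2
    have := S.marginalEnergy_le h2.1 φ z
    rw [(S.mem_minimizers_iff ht').1 hφ] at h1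
    linarith
  eventually_right_quotient := by
    intro t ht z c hc
    have ht' : t ∈ Icc 0 T := ⟨ht.1, ht.2.le⟩
    obtain ⟨φ, hφ, hP⟩ := S.exists_argmax ht' z
    rw [← hP] at hc
    filter_upwards [S.eventually_right_quotient ht (φ, z) hc,
      eventually_mem_Icc_right ht] with s h1 h2
    have := S.marginalEnergy_le h2.1 φ z
    rw [(S.mem_minimizers_iff ht').1 hφ] at h1
    linarith
  bound := by
    intro t ht z
    obtain ⟨φ, hφ, hP⟩ := S.exists_argmax ht z
    have := S.bound t ht (φ, z)
    rwa [hP, perturbedEnergy, (S.mem_minimizers_iff ht).1 hφ] at this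
  eventually_power_lt := by
    intro C p q hp hpq hE c hc
    by_contra hcon
    rw [not_eventually] at hcon
    obtain ⟨ns, hns, hlt⟩ := exists_seq_forall_of_frequently hcon
    have hq : q.1 ∈ Icc 0 T := isClosed_Icc.mem_of_tendsto
      ((continuous_fst.tendsto _).comp hpq) (Eventually.of_forall fun n => (hp n).1)
    choose φ hφ hP using fun n => S.exists_argmax (hp (ns n)).1 (p (ns n)).2
    obtain ⟨ψ, φ', hψ, hφ', hlim, hE'⟩ := S.exists_subseq_minimizers (fun n => hp (ns n))
      (hpq.comp hns) hφ (hE.comp hns)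
    have h1 := S.eventually_power_lt (fun n => S.lift_mem_sublevel (hp (ns (ψ n))) (hφ (ψ n)))
      hlim hE' ((S.power_le_marginalPower hq hφ').trans_lt hc)
    obtain ⟨n, hn⟩ := h1.exists
    simp only [hP] at hn
    exact hlt _ hn
  h_mono := S.h_mono
  h_cont := S.h_cont
  h_zero := S.h_zero
  sep := hsep

end IsPreSystem

/-! ### Measurable selections with values in a Souslin space -/

/-- A Hausdorff Souslin space has a countable family of open sets that separates its points and
generates its Borel sets: the complement of the diagonal is a countable union of open rectangles,
and countably separated sub-σ-algebras of a Souslin space are not strictly smaller. -/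
theorem exists_separating_open_seq {F : Type*} [TopologicalSpace F] [T2Space F] [Nonempty F]
    [MeasurableSpace F] [BorelSpace F] (hF : AnalyticSet (univ : Set F)) :
    ∃ W : ℕ → Set F, (∀ n, IsOpen (W n)) ∧
      ‹MeasurableSpace F› = MeasurableSpace.generateFrom (range W) := by
  rw [AnalyticSet] at hF
  obtain ⟨f, hf, hrange⟩ := hF.resolve_left univ_nonempty.ne_empty
  have hsurj : Function.Surjective f := range_eq_univ.1 hrange
  -- separated pairs of open sets, and a countable family of them that covers all pairs of points
  set ι := {p : Set F × Set F // IsOpen p.1 ∧ IsOpen p.2 ∧ Disjoint p.1 p.2} with hι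
  set R : ι → Set ((ℕ → ℕ) × (ℕ → ℕ)) := fun p => (f ⁻¹' p.1.1) ×ˢ (f ⁻¹' p.1.2) with hR
  obtain ⟨J, hJ, hJU⟩ := TopologicalSpace.isOpen_iUnion_countable R fun p =>
    (p.2.1.preimage hf).prod (p.2.2.1.preimage hf)
  have hsep : ∀ x y : F, x ≠ y → ∃ p ∈ J, x ∈ p.1.1 ∧ y ∈ p.1.2 := by
    intro x y hxy
    obtain ⟨a, rfl⟩ := hsurj x
    obtain ⟨b, rfl⟩ := hsurj y
    obtain ⟨U, V, hU, hV, ha, hb, hUV⟩ := t2_separation hxy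
    have hmem : (a, b) ∈ ⋃ p ∈ J, R p := by
      rw [hJU]
      exact mem_iUnion.2 ⟨⟨(U, V), hU, hV, hUV⟩, ha, hb⟩
    obtain ⟨p, hp, h1, h2⟩ := mem_iUnion₂.1 hmem
    exact ⟨p, hp, h1, h2⟩
  obtain ⟨W, hW⟩ : ∃ W : ℕ → Set F, insert ∅ ((fun p : ι => p.1.1) '' J) = range W :=
    ((hJ.image _).insert ∅).exists_eq_range (insert_nonempty _ _)
  have hopen : ∀ n, IsOpen (W n) := by
    intro n
    have : W n ∈ insert ∅ ((fun p : ι => p.1.1) '' J) := hW ▸ mem_range_self n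
    rcases this with h0 | ⟨p, -, h0⟩
    · rw [h0]; exact isOpen_empty
    · rw [← h0]; exact p.2.1
  refine ⟨W, hopen, le_antisymm ?_
    (MeasurableSpace.generateFrom_le fun s ⟨n, hn⟩ => hn ▸ (hopen n).measurableSet)⟩
  intro s hs
  have hfs : MeasurableSet (f ⁻¹' s) := hf.measurable hs
  let m : MeasurableSpace F := MeasurableSpace.generateFrom (range W)
  have hfm : Measurable f := measurable_generateFrom (by
    rintro _ ⟨n, rfl⟩
    exact ((hopen n).preimage hf).measurableSet)
  have : MeasurableSpace.CountablySeparated F := ⟨range W, countable_range W,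
    fun s hs => MeasurableSpace.measurableSet_generateFrom hs, by
      intro x _ y _ hxy
      by_contra hne
      obtain ⟨p, hp, h1, h2⟩ := hsep x y hne
      have h3 : p.1.1 ∈ range W := hW ▸ Or.inr ⟨p, hp, rfl⟩
      exact Set.disjoint_left.1 p.2.2.2 ((hxy _ h3).1 h1) h2⟩
  exact (hfm.measurableSet_preimage_iff_of_surjective hsurj).1 hfs

open Classical in
/-- The closed sets that guide the selection: among the points of `A` that are left, those outside
of the open set `W n` are preferred. -/
def selectionSet {F : Type*} (W : ℕ → Set F) (A : Set F) : ℕ → Set F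
  | 0 => univ
  | n + 1 => if (A ∩ (selectionSet W A n ∩ (W n)ᶜ)).Nonempty then selectionSet W A n ∩ (W n)ᶜ
      else selectionSet W A n

theorem isClosed_selectionSet {F : Type*} [TopologicalSpace F] {W : ℕ → Set F}
    (hW : ∀ n, IsOpen (W n)) (A : Set F) (n : ℕ) : IsClosed (selectionSet W A n) := by
  induction n with
  | zero => exact isClosed_univ
  | succ n ih =>
    rw [selectionSet]
    split_ifs
    · exact ih.inter (hW n).isClosed_compl
    · exact ih

theorem antitone_selectionSet {F : Type*} (W : ℕ → Set F) (A : Set F) :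
    Antitone (selectionSet W A) := by
  refine antitone_nat_of_succ_le fun n => ?_
  rw [selectionSet]
  split_ifs
  · exact inter_subset_left
  · exact le_rfl

theorem selectionSet_nonempty {F : Type*} (W : ℕ → Set F) {A : Set F} (hA : A.Nonempty) (n : ℕ) :
    (A ∩ selectionSet W A n).Nonempty := by
  induction n with
  | zero => simpa [selectionSet] using hA
  | succ n ih =>
    rw [selectionSet]
    split_ifs with h0
    · exact h0
    · exact ih

/-- A multifunction with nonempty sequentially compact values in a Souslin space, for which the
preimages of closed sets are measurable, has a measurable selection. -/
theorem exists_measurable_selection {α F : Type*} [MeasurableSpace α] [TopologicalSpace F]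
    [T2Space F] [Nonempty F] [MeasurableSpace F] [BorelSpace F]
    (hF : AnalyticSet (univ : Set F)) {A : α → Set F} (hne : ∀ a, (A a).Nonempty)
    (hcpt : ∀ a, IsSeqCompact (A a))
    (hmeas : ∀ H : Set F, IsClosed H → MeasurableSet {a | (A a ∩ H).Nonempty}) :
    ∃ φ : α → F, Measurable φ ∧ ∀ a, φ a ∈ A a := by
  obtain ⟨W, hW, hgen⟩ := exists_separating_open_seq hF
  have hex : ∀ a, ∃ x ∈ A a, ∀ n, x ∈ selectionSet W (A a) n := by
    intro a
    choose x hx using selectionSet_nonempty W (hne a)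
    obtain ⟨y, hy, ψ, hψ, hlim⟩ := hcpt a fun n => (hx n).1
    refine ⟨y, hy, fun n => (isClosed_selectionSet hW (A a) n).mem_of_tendsto hlim ?_⟩
    filter_upwards [hψ.tendsto_atTop.eventually_ge_atTop n] with m hm
    exact antitone_selectionSet W (A a) hm (hx (ψ m)).2
  choose φ hφA hφ using hex
  have hset : ∀ n, ∀ G : Set F, IsClosed G →
      MeasurableSet {a | (A a ∩ (selectionSet W (A a) n ∩ G)).Nonempty} := by
    intro n
    induction n with
    | zero => simpa [selectionSet] using hmeas
    | succ n ih =>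
      intro G hG
      have h1 := ih (W n)ᶜ (hW n).isClosed_compl
      have h2 := ih ((W n)ᶜ ∩ G) ((hW n).isClosed_compl.inter hG)
      convert! (h1.inter h2).union (h1.compl.inter (ih G hG)) using 1
      ext a
      simp only [selectionSet, mem_ofPred_eq, mem_union, mem_inter_iff, mem_compl_iff]
      split_ifs with h0
      · simp [h0, inter_assoc]
      · simp [h0]
  refine ⟨φ, ?_, hφA⟩
  rw [hgen]
  refine measurable_generateFrom ?_
  rintro _ ⟨n, rfl⟩
  convert! (hset n (W n)ᶜ (hW n).isClosed_compl).compl using 1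
  ext a
  refine ⟨fun h1 h2 => ?_, fun h1 => ?_⟩
  · have h3 := hφ a (n + 1)
    rw [selectionSet,
      if_pos (show (A a ∩ (selectionSet W (A a) n ∩ (W n)ᶜ)).Nonempty from h2)] at h3
    exact h3.2 h1
  · by_contra h2
    exact h1 ⟨φ a, hφA a, hφ a n, h2⟩

/-! ### Curves of bounded variation -/

section BV

variable {Z : Type*} [TopologicalSpace Z] {T : ℝ} {d : Z → Z → ℝ≥0∞} {u : ℝ → Z}

/-- The variation of the curve up to time `t`, extended to all real times. -/
noncomputable def variationFun (T : ℝ) (d : Z → Z → ℝ≥0∞) (u : ℝ → Z) (t : ℝ) : ℝ :=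
  (variation d u (Icc 0 t ∩ Icc 0 T)).toReal

theorem IsBV.variation_ne_top (hu : IsBV T d u) {A : Set ℝ} (hA : A ⊆ Icc 0 T) :
    variation d u A ≠ ⊤ :=
  ne_top_of_le_ne_top hu.finite_variation (variation_mono hA)

theorem IsBV.monotone_variationFun (hu : IsBV T d u) : Monotone (variationFun T d u) :=
  fun _ _ hst => ENNReal.toReal_mono (hu.variation_ne_top inter_subset_right)
    (variation_mono (inter_subset_inter_left _ (Icc_subset_Icc_right hst)))

theorem IsBV.dist_le (hu : IsBV T d u) {s t : ℝ} (hs : 0 ≤ s)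
    (hst : s ≤ t) (ht : t ≤ T) :
    d (u s) (u t) ≤ ENNReal.ofReal (variationFun T d u t - variationFun T d u s) := by
  have h1 : variation d u (Icc 0 s ∩ Icc 0 T) + d (u s) (u t) ≤
      variation d u (Icc 0 t ∩ Icc 0 T) := by
    have hsub : ∀ r ≤ T, Icc 0 r ∩ Icc 0 T = Icc 0 r := fun r hr =>
      inter_eq_left.2 (Icc_subset_Icc_right hr)
    rw [hsub s (hst.trans ht), hsub t ht]
    exact (add_le_add_right
      (dist_le_variation (left_mem_Icc.2 hst) (right_mem_Icc.2 hst) hst) _).trans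
      (variation_add_le (Icc_subset_Icc_right hst) (Icc_subset_Icc_left hs)
        fun x hx y hy => hx.2.trans hy.1)
  have h2 := hu.variation_ne_top (A := Icc 0 s ∩ Icc 0 T) inter_subset_right
  have h3 := hu.variation_ne_top (A := Icc 0 t ∩ Icc 0 T) inter_subset_right
  rw [variationFun, variationFun, ENNReal.ofReal_sub _ ENNReal.toReal_nonneg,
    ENNReal.ofReal_toReal h2, ENNReal.ofReal_toReal h3]
  exact ENNReal.le_sub_of_add_le_left h2 h1

/-- A curve of bounded variation jumps only where its variation does: `d` separates points. -/
theorem IsBV.countable_jumpSet (hu : IsBV T d u)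
    (hlsc : LowerSemicontinuous fun p : Z × Z => d p.1 p.2)
    (hsep : Separates d) : (jumpSet T u).Countable := by
  have hV := hu.monotone_variationFun
  refine (hV.countable_not_continuousAt.union (Set.toFinite {0, T}).countable).mono fun t ht => ?_
  by_contra hcon
  simp only [mem_union, mem_ofPred_eq, not_or, not_not, mem_insert_iff, mem_singleton_iff] at hcon
  obtain ⟨hc, h0, hT⟩ := hcon
  have ht0 : 0 < t := lt_of_le_of_ne ht.1.1 (Ne.symm h0)
  have htT : t < T := lt_of_le_of_ne ht.1.2 hT
  have hlim : Tendsto (fun s => ENNReal.ofReal |variationFun T d u t - variationFun T d u s|)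
      (𝓝 t) (𝓝 0) := by
    have := ENNReal.tendsto_ofReal (hc.tendsto.const_sub (variationFun T d u t)).abs
    simpa using this
  have hzero : ∀ {l : Filter ℝ} [l.NeBot] {x y : Z} {f g : ℝ → Z}, l ≤ 𝓝 t → Tendsto f l (𝓝 x) →
      Tendsto g l (𝓝 y) → (∀ᶠ s in l, d (f s) (g s) ≤
        ENNReal.ofReal |variationFun T d u t - variationFun T d u s|) → x = y := by
    intro l _ x y f g hl hf hg hle
    refine hsep _ _ (nonpos_iff_eq_zero.1 (not_lt.1 fun hpos => ?_))
    obtain ⟨c, hc0, hcd⟩ := exists_between hpos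
    have h1 := (hf.prodMk_nhds hg).eventually (hlsc (x, y) c hcd)
    have h2 := (hlim.mono_left hl).eventually (gt_mem_nhds hc0)
    obtain ⟨s, hs1, hs2, hs3⟩ := (h1.and (h2.and hle)).exists
    exact absurd (hs1.trans_le hs3) (not_lt.2 hs2.le)
  rcases ht.2 with h1 | h1
  · refine h1 (hzero nhdsWithin_le_nhds (hu.regulated.left_lim t ⟨ht0, htT.le⟩).1
      tendsto_const_nhds ?_)
    filter_upwards [eventually_mem_Icc_left (T := T) ⟨ht0, htT.le⟩,
      self_mem_nhdsWithin] with s h2 h3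
    exact (hu.dist_le h2.2.le (le_of_lt h3) htT.le).trans
      (ENNReal.ofReal_le_ofReal (le_abs_self _))
  · refine h1 (hzero nhdsWithin_le_nhds tendsto_const_nhds
      (hu.regulated.right_lim t ⟨ht0.le, htT⟩).1 ?_)
    filter_upwards [eventually_mem_Icc_right (T := T) ⟨ht0.le, htT⟩,
      self_mem_nhdsWithin] with s h2 h3
    rw [abs_sub_comm]
    exact (hu.dist_le ht0.le (le_of_lt h3) h2.1.2).trans
      (ENNReal.ofReal_le_ofReal (le_abs_self _))

theorem limits_of_notMem_jumpSet {t : ℝ} (ht : t ∈ Icc 0 T) (hJ : t ∉ jumpSet T u) :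
    leftLimit u t = u t ∧ rightLimit T u t = u t := by
  constructor <;> by_contra hne
  · exact hJ ⟨ht, Or.inl hne⟩
  · exact hJ ⟨ht, Or.inr (Ne.symm hne)⟩

theorem IsBV.continuousAt (hu : IsBV T d u) {t : ℝ} (ht : t ∈ Ioo 0 T)
    (hJ : t ∉ jumpSet T u) : ContinuousAt u t := by
  obtain ⟨h1, h2⟩ := limits_of_notMem_jumpSet (Ioo_subset_Icc_self ht) hJ
  have h3 := (hu.regulated.left_lim t (Ioo_subset_Ioc_self ht)).1
  have h4 := (hu.regulated.right_lim t (Ioo_subset_Ico_self ht)).1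
  rw [h1] at h3
  rw [h2] at h4
  exact continuousAt_iff_continuous_left'_right'.2 ⟨h3, h4⟩

/-- The augmented variation is additive: at the intermediate time both incremental costs appear on
either side. -/
theorem augmentedVariation_add (E : ℝ → Z → ℝ) (δ : Z → Z → ℝ≥0∞) (hself : ∀ x, d x x = 0)
    (htri : ∀ x y z, d x z ≤ d x y + d y z) {s t : ℝ} (hs : 0 ≤ s) (hst : s ≤ t) (ht : t ≤ T) :
    augmentedVariation T E d δ u 0 s + augmentedVariation T E d δ u s t =
      augmentedVariation T E d δ u 0 t := by
  have hzero : ∀ a, augmentedVariation T E d δ u a a = 0 := fun a => by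
    simp [augmentedVariation, jumpVariation, variation_subsingleton hself]
  rcases hs.eq_or_lt with rfl | hs0
  · rw [hzero, zero_add]
  rcases hst.eq_or_lt with rfl | hst0
  · rw [hzero, add_zero]
  unfold augmentedVariation jumpVariation
  rw [if_pos hs0, if_pos hst0, if_pos (hs0.trans hst0), ← variation_Icc_add htri hs hst]
  set f : ℝ → ℝ≥0∞ := fun r => incrementalCost E d δ r (leftLimit u r) (u r) +
    incrementalCost E d δ r (u r) (rightLimit T u r) with hf
  have hsum : ∑' r : (jumpSet T u ∩ Ioo 0 t : Set ℝ), f r =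
      ∑' r : (jumpSet T u ∩ Ioo 0 s : Set ℝ), f r + f s +
        ∑' r : (jumpSet T u ∩ Ioo s t : Set ℝ), f r := by
    rw [tsum_subtype (jumpSet T u ∩ Ioo 0 t) f, tsum_subtype (jumpSet T u ∩ Ioo 0 s) f,
      tsum_subtype (jumpSet T u ∩ Ioo s t) f, ← tsum_pi_single s (f s), ← ENNReal.tsum_add,
      ← ENNReal.tsum_add]
    refine tsum_congr fun r => ?_
    have hJ : r ∉ jumpSet T u → r ∈ Icc 0 T → f r = 0 := fun hr hrT => by
      obtain ⟨h1, h2⟩ := limits_of_notMem_jumpSet hrT hr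
      simp only [hf, h1, h2, incrementalCost_self E hself, add_zero]
    rcases lt_trichotomy r s with hr | rfl | hr
    · have h1 : ¬ s < r := not_lt.2 hr.le
      rw [Pi.single_eq_of_ne hr.ne]
      by_cases h2 : r ∈ jumpSet T u <;> by_cases h3 : 0 < r <;>
        simp [indicator, h1, h2, h3, hr, hr.trans hst0]
    · rw [Pi.single_eq_same]
      by_cases hr : r ∈ jumpSet T u
      · simp [indicator, hr, hs0, hst0]
      · simp [indicator, hr, hJ hr ⟨hs, hst.trans ht⟩]
    · have h1 : ¬ r < s := not_lt.2 hr.le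
      rw [Pi.single_eq_of_ne hr.ne']
      by_cases h2 : r ∈ jumpSet T u <;> by_cases h3 : r < t <;>
        simp [indicator, h1, h2, h3, hr, hs0.trans hr]
  change _ + (_ + _ + ∑' r : (jumpSet T u ∩ Ioo 0 s : Set ℝ), f r) +
    (_ + (_ + _ + ∑' r : (jumpSet T u ∩ Ioo s t : Set ℝ), f r)) =
    _ + (_ + _ + ∑' r : (jumpSet T u ∩ Ioo 0 t : Set ℝ), f r)
  rw [hsum]
  ring

end BV

namespace IsPreSystem

variable {F Z : Type*} [TopologicalSpace F] [TopologicalSpace Z] {T : ℝ} {x₀ : F × Z}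
  {F₀ C_P : ℝ} {d : Z → Z → ℝ≥0∞} {E P : ℝ → F × Z → ℝ} {h : ℝ≥0 → ℝ≥0} {u : ℝ → Z}

/-! ### Selections of minimizers along a curve -/

/-- Minimizers in a closed set converge along a subsequence to a minimizer in this set, and the
power is upper semicontinuous along it. -/
theorem exists_limit_minimizer [T2Space F] [T2Space Z]
    (S : IsPreSystem T x₀ F₀ C_P (liftDist d) E P h) {C : ℝ} {p : ℕ → ℝ × Z} {q : ℝ × Z}
    {φ : ℕ → F} {H : Set F} (hH : IsClosed H)
    (hp : ∀ n, p n ∈ sublevel T x₀.2 F₀ d (marginalEnergy E) C) (hpq : Tendsto p atTop (𝓝 q))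
    (hφ : ∀ n, φ n ∈ H ∩ minimizers E (p n).1 (p n).2)
    (hE : Tendsto (fun n => marginalEnergy E (p n).1 (p n).2) atTop
      (𝓝 (marginalEnergy E q.1 q.2))) :
    ∃ φ' ∈ H ∩ minimizers E q.1 q.2, ∃ ψ : ℕ → ℕ, StrictMono ψ ∧
      Tendsto (fun n => φ (ψ n)) atTop (𝓝 φ') ∧
      ∀ c, P q.1 (φ', q.2) < c → ∀ᶠ n in atTop, P (p (ψ n)).1 (φ (ψ n), (p (ψ n)).2) < c := by
  obtain ⟨ψ, φ', hψ, hφ', hlim, hE'⟩ := S.exists_subseq_minimizers hp hpq (fun n => (hφ n).2) hE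
  have h1 : Tendsto (fun n => φ (ψ n)) atTop (𝓝 φ') :=
    ((continuous_fst.comp continuous_snd).tendsto _).comp hlim
  exact ⟨φ', ⟨hH.mem_of_tendsto h1 (Eventually.of_forall fun n => (hφ (ψ n)).1), hφ'⟩, ψ, hψ, h1,
    fun c hc => S.eventually_power_lt (fun n => S.lift_mem_sublevel (hp (ψ n)) (hφ (ψ n)).2)
      hlim hE' hc⟩

/-- The minimizers at which the marginal power is attained. -/
def maximalMinimizers (E P : ℝ → F × Z → ℝ) (t : ℝ) (z : Z) : Set F :=
  {φ ∈ minimizers E t z | marginalPower E P t z ≤ P t (φ, z)}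

theorem maximalMinimizers_nonempty [T2Space F] [T2Space Z]
    (S : IsPreSystem T x₀ F₀ C_P (liftDist d) E P h) {t : ℝ} (ht : t ∈ Icc 0 T) (z : Z) :
    (maximalMinimizers E P t z).Nonempty := by
  obtain ⟨φ, h1, h2⟩ := S.exists_argmax ht z
  exact ⟨φ, h1, h2.ge⟩

theorem power_eq_of_mem [T2Space F] [T2Space Z]
    (S : IsPreSystem T x₀ F₀ C_P (liftDist d) E P h) {t : ℝ} (ht : t ∈ Icc 0 T) {φ : F} {z : Z}
    (hφ : φ ∈ maximalMinimizers E P t z) : P t (φ, z) = marginalPower E P t z :=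
  le_antisymm (S.power_le_marginalPower ht hφ.1) hφ.2

theorem isSeqCompact_maximalMinimizers [T2Space F] [T2Space Z]
    (S : IsPreSystem T x₀ F₀ C_P (liftDist d) E P h) {t : ℝ} (ht : t ∈ Icc 0 T) (z : Z) :
    IsSeqCompact (maximalMinimizers E P t z) := by
  intro φ hφ
  obtain ⟨φ', hφ', ψ, hψ, hlim, hP⟩ := S.exists_limit_minimizer (p := fun _ => (t, z))
    (q := (t, z)) (φ := φ) isClosed_univ (fun n => ⟨ht, le_rfl⟩) tendsto_const_nhds
    (fun n => ⟨mem_univ _, (hφ n).1⟩) tendsto_const_nhds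
  refine ⟨φ', ⟨hφ'.2, not_lt.1 fun hlt => ?_⟩, ψ, hψ, hlim⟩
  obtain ⟨n, hn⟩ := (hP _ hlt).exists
  exact absurd (hφ (ψ n)).2 (not_le.2 hn)

/-- Along a stable curve, the set of the times at which a closed set contains a minimizer of maximal
power is measurable: the maximal power over the minimizers in the closed set is upper
semicontinuous on the continuity times of the curve. -/
theorem measurableSet_maximalMinimizers [T2Space F] [T2Space Z] [FirstCountableTopology Z]
    (S : IsPreSystem T x₀ F₀ C_P (liftDist d) E P h) (hd : IsQuasiDistance d x₀.2)
    (hsep : Separates d) {C : ℝ} {G : Set ℝ}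
    (hmem : ∀ t ∈ G, (t, u t) ∈ sublevel T x₀.2 F₀ d (marginalEnergy E) C)
    (hcont : ∀ t ∈ G, ContinuousAt u t)
    (hst : ∀ t ∈ G, StableAt (marginalEnergy E) d (correction h d) t (u t))
    {H : Set F} (hH : IsClosed H) :
    MeasurableSet {t : G | (maximalMinimizers E P t (u t) ∩ H).Nonempty} := by
  have R := S.marginal hd hsep
  have hlim : ∀ (a : ℕ → G) (t : G), Tendsto a atTop (𝓝 t) →
      Tendsto (fun n => ((a n : ℝ), u (a n))) atTop (𝓝 ((t : ℝ), u t)) ∧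
      Tendsto (fun n => marginalEnergy E (a n) (u (a n))) atTop
        (𝓝 (marginalEnergy E t (u t))) := by
    intro a t hat
    have h1 : Tendsto (fun n => (a n : ℝ)) atTop (𝓝 (t : ℝ)) :=
      (continuous_subtype_val.tendsto t).comp hat
    have h2 := h1.prodMk_nhds ((hcont t t.2).tendsto.comp h1)
    exact ⟨h2, (R.tendsto_energy_of_stable (p := fun n => ((a n : ℝ), u (a n)))
      (q := ((t : ℝ), u t)) (fun n => hmem _ (a n).2) h2
      (Eventually.of_forall fun n => hst _ (a n).2)).1⟩
  set pH : G → EReal := fun t =>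
    sSup ((fun φ => (P t (φ, u t) : EReal)) '' (H ∩ minimizers E t (u t))) with hpH
  have hpHm : Measurable pH := by
    refine UpperSemicontinuous.measurable fun t c hc => ?_
    by_contra hcon
    rw [not_eventually] at hcon
    obtain ⟨a, ha, hac⟩ := exists_seq_forall_of_frequently hcon
    obtain ⟨c', hc1, hc2⟩ := EReal.lt_iff_exists_real_btwn.1 hc
    have hex : ∀ n, ∃ φ ∈ H ∩ minimizers E (a n) (u (a n)), c' < P (a n) (φ, u (a n)) := by
      intro n
      obtain ⟨_, ⟨φ, hφ, rfl⟩, hlt⟩ := lt_sSup_iff.1 (hc2.trans_le (not_lt.1 (hac n)))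
      exact ⟨φ, hφ, EReal.coe_lt_coe_iff.1 hlt⟩
    choose φ hφ hφc using hex
    obtain ⟨φ', hφ', ψ, -, -, hP⟩ := S.exists_limit_minimizer hH (fun n => hmem _ (a n).2)
      (hlim a t ha).1 hφ (hlim a t ha).2
    have h1 : (P t (φ', u t) : EReal) ≤ pH t := le_sSup ⟨φ', hφ', rfl⟩
    obtain ⟨n, hn⟩ := (hP c' (EReal.coe_lt_coe_iff.1 (h1.trans_lt hc1))).exists
    exact lt_asymm hn (hφc (ψ n))
  have hpm : Measurable (fun t : G => marginalPower E P t (u t)) := by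
    refine UpperSemicontinuous.measurable fun t c hc => ?_
    by_contra hcon
    rw [not_eventually] at hcon
    obtain ⟨a, ha, hac⟩ := exists_seq_forall_of_frequently hcon
    obtain ⟨n, hn⟩ := (R.eventually_power_lt (fun n => hmem _ (a n).2) (hlim a t ha).1
      (hlim a t ha).2 hc).exists
    exact hac n hn
  have heq : {t : G | (maximalMinimizers E P t (u t) ∩ H).Nonempty} =
      {t : G | (marginalPower E P t (u t) : EReal) ≤ pH t} := by
    ext t
    constructor
    · rintro ⟨φ, hφ, hφH⟩
      exact (EReal.coe_le_coe_iff.2 hφ.2).trans (le_sSup ⟨φ, ⟨hφH, hφ.1⟩, rfl⟩)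
    · intro hle
      have hle : (marginalPower E P t (u t) : EReal) ≤ pH t := hle
      have hex : ∀ n : ℕ, ∃ φ ∈ H ∩ minimizers E t (u t),
          marginalPower E P t (u t) - 1 / ((n : ℝ) + 1) < P t (φ, u t) := by
        intro n
        have h1 : ((marginalPower E P t (u t) - 1 / ((n : ℝ) + 1) : ℝ) : EReal) < pH t :=
          lt_of_lt_of_le (EReal.coe_lt_coe_iff.2 (sub_lt_self _ (by positivity))) hle
        obtain ⟨_, ⟨φ, hφ, rfl⟩, hlt⟩ := lt_sSup_iff.1 h1
        exact ⟨φ, hφ, EReal.coe_lt_coe_iff.1 hlt⟩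
      choose φ hφ hφc using hex
      obtain ⟨φ', hφ', ψ, hψ, -, hP⟩ := S.exists_limit_minimizer
        (p := fun _ => ((t : ℝ), u t)) (q := ((t : ℝ), u t)) hH (fun n => hmem _ t.2)
        tendsto_const_nhds hφ tendsto_const_nhds
      refine ⟨φ', ⟨hφ'.2, not_lt.1 fun hlt => ?_⟩, hφ'.1⟩
      obtain ⟨c, hc1, hc2⟩ := exists_between hlt
      have h3 : Tendsto (fun n => marginalPower E P t (u t) - 1 / ((ψ n : ℝ) + 1)) atTop
          (𝓝 (marginalPower E P t (u t))) := by
        simpa using ((tendsto_one_div_add_atTop_nhds_zero_nat (𝕜 := ℝ)).comp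
          hψ.tendsto_atTop).const_sub (marginalPower E P t (u t))
      obtain ⟨n, h4, h5⟩ := ((hP c hc1).and (h3.eventually (lt_mem_nhds hc2))).exists
      exact lt_asymm (h5.trans (hφc (ψ n))) h4
  rw [heq]
  exact measurableSet_le hpm.coe_real_ereal hpHm

/-- The interior times at which the curve does not jump. -/
def continuityTimes (T : ℝ) (u : ℝ → Z) : Set ℝ := Ioo 0 T \ jumpSet T u

/-- Minimizers of maximal power along a stable curve, measurably in the Souslin case: the countably
many jump times and the end points are negligible. -/
theorem exists_selection [T2Space F] [T2Space Z] [FirstCountableTopology Z] [MeasurableSpace F]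
    [BorelSpace F] (S : IsPreSystem T x₀ F₀ C_P (liftDist d) E P h) (hd : IsQuasiDistance d x₀.2)
    (hsep : Separates d) (hu : IsBV T d u) {C : ℝ}
    (hmem : ∀ t ∈ Icc 0 T, (t, u t) ∈ sublevel T x₀.2 F₀ d (marginalEnergy E) C)
    (hst : ∀ t ∈ Icc 0 T \ jumpSet T u,
      StableAt (marginalEnergy E) d (correction h d) t (u t)) :
    ∃ φ : ℝ → F, (∀ t ∈ Icc 0 T, φ t ∈ maximalMinimizers E P t (u t)) ∧
      (AnalyticSet (univ : Set F) → AEMeasurable φ (volume.restrict (Icc 0 T))) := by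
  classical
  have : Nonempty F := ⟨x₀.1⟩
  choose! φ₀ hφ₀ using fun t (ht : t ∈ Icc 0 T) => S.maximalMinimizers_nonempty ht (u t)
  by_cases hF : AnalyticSet (univ : Set F)
  swap
  · exact ⟨φ₀, hφ₀, fun hcon => absurd hcon hF⟩
  have hG : ∀ t ∈ continuityTimes T u, t ∈ Icc 0 T := fun t ht => Ioo_subset_Icc_self ht.1
  obtain ⟨g, hgm, hg⟩ := exists_measurable_selection (α := continuityTimes T u) hF
    (A := fun t => maximalMinimizers E P t (u t))
    (fun t => S.maximalMinimizers_nonempty (hG t t.2) _)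
    (fun t => S.isSeqCompact_maximalMinimizers (hG t t.2) _)
    (fun H hH => S.measurableSet_maximalMinimizers hd hsep (fun t ht => hmem t (hG t ht))
      (fun t ht => hu.continuousAt ht.1 ht.2) (fun t ht => hst t ⟨hG t ht, ht.2⟩) hH)
  have hJ := hu.countable_jumpSet hd.lsc hsep
  have hGm : MeasurableSet (continuityTimes T u) := measurableSet_Ioo.diff hJ.measurableSet
  have hae : (continuityTimes T u : Set ℝ) =ᵐ[volume] Icc 0 T :=
    (sdiff_null_ae_eq_self (hJ.measure_zero volume)).trans Ioo_ae_eq_Icc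
  refine ⟨fun t => if ht : t ∈ continuityTimes T u then g ⟨t, ht⟩ else φ₀ t, fun t ht => ?_,
    fun _ => ?_⟩
  · simp only
    split_ifs with h1
    · exact hg ⟨t, h1⟩
    · exact hφ₀ t ht
  · rw [← Measure.restrict_congr_set hae]
    refine aemeasurable_restrict_of_measurable_subtype hGm ?_
    convert! hgm using 1
    ext t
    simp

/-! ### Equivalence of reduced and selected solutions -/

/-- A minimizer of maximal power has the marginal power, so that the balance lifts; additivity of
the augmented variation gives it between any two times. -/
theorem isSelectedSolution_of_isVESolution [T2Space F] [T2Space Z] [FirstCountableTopology Z]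
    [MeasurableSpace F] [BorelSpace F] (S : IsPreSystem T x₀ F₀ C_P (liftDist d) E P h)
    (hd : IsQuasiDistance d x₀.2) (hsep : Separates d)
    (hu : IsVESolution T (marginalEnergy E) (marginalPower E P) d (correction h d) u) :
    ∃ φ : ℝ → F, IsSelectedSolution T E P d (correction h d) φ u := by
  have h0T : (0 : ℝ) ∈ Icc 0 T := ⟨le_rfl, S.T_pos.le⟩
  have hint : ∀ {a b : ℝ}, a ∈ Icc 0 T → b ∈ Icc 0 T →
      IntervalIntegrable (fun r => marginalPower E P r (u r)) volume a b := fun ha hb =>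
    ((intervalIntegrable_iff_integrableOn_Icc_of_le S.T_pos.le).2 hu.integrable).mono_set
      (by rw [uIcc_of_le S.T_pos.le]; exact uIcc_subset_Icc ha hb)
  -- finiteness of the augmented variation, and the balance as an identity of real numbers
  have hfin : ∀ t ∈ Icc 0 T,
      augmentedVariation T (marginalEnergy E) d (correction h d) u 0 t ≠ ⊤ := by
    intro t ht htop
    have := hu.balance t ht
    rw [htop, EReal.coe_ennreal_top, EReal.coe_add_top] at this
    exact (EReal.coe_ne_top _) this.symm
  have hbal : ∀ t ∈ Icc 0 T, marginalEnergy E t (u t) +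
      (augmentedVariation T (marginalEnergy E) d (correction h d) u 0 t).toReal =
        marginalEnergy E 0 (u 0) + ∫ r in (0 : ℝ)..t, marginalPower E P r (u r) := by
    intro t ht
    have := hu.balance t ht
    rw [← EReal.coe_ennreal_toReal (hfin t ht), ← EReal.coe_add] at this
    exact EReal.coe_injective this
  -- the solution stays in a sublevel
  obtain ⟨C, hC⟩ : ∃ C, ∀ t ∈ Icc 0 T, (t, u t) ∈ sublevel T x₀.2 F₀ d (marginalEnergy E) C := by
    refine ⟨marginalEnergy E 0 (u 0) + (∫ r in (0 : ℝ)..T, |marginalPower E P r (u r)|) +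
      (d x₀.2 (u 0) + variation d u (Icc 0 T)).toReal + F₀, fun t ht => ⟨ht, ?_⟩⟩
    have h1 := hbal t ht
    have h2 : (∫ r in (0 : ℝ)..t, marginalPower E P r (u r)) ≤
        ∫ r in (0 : ℝ)..T, |marginalPower E P r (u r)| := by
      refine (intervalIntegral.integral_mono_on ht.1 (hint h0T ht) (hint h0T ht).abs
        fun r _ => le_abs_self _).trans ?_
      exact intervalIntegral.integral_mono_interval le_rfl ht.1 ht.2
        (Eventually.of_forall fun r => abs_nonneg _) (hint h0T (right_mem_Icc.2 S.T_pos.le)).abs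
    have h3 : (d x₀.2 (u t)).toReal ≤ (d x₀.2 (u 0) + variation d u (Icc 0 T)).toReal :=
      ENNReal.toReal_mono (ENNReal.add_ne_top.2 ⟨hd.finite_from _, hu.bv.finite_variation⟩)
        ((hd.triangle _ _ _).trans (add_le_add_right (dist_le_variation h0T ht ht.1) _))
    have h4 : 0 ≤ (augmentedVariation T (marginalEnergy E) d (correction h d) u 0 t).toReal :=
      ENNReal.toReal_nonneg
    simp only [perturbedEnergy]
    linarith
  obtain ⟨φ, hφ, hφm⟩ := S.exists_selection hd hsep hu.bv hC
    fun t ht => stableAt_iff.2 (hu.stable t ht)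
  have hE : ∀ t ∈ Icc 0 T, E t (φ t, u t) = marginalEnergy E t (u t) := fun t ht =>
    (S.mem_minimizers_iff ht).1 (hφ t ht).1
  have hP : ∀ t ∈ Icc 0 T, P t (φ t, u t) = marginalPower E P t (u t) := fun t ht =>
    S.power_eq_of_mem ht (hφ t ht)
  refine ⟨φ, hu.bv, fun hF => (hφm hF).nullMeasurable, fun t ht => (hφ t ht).1,
    fun t ht φ' z' => ?_, (integrableOn_congr_fun (fun t ht => hP t ht) measurableSet_Icc).2
      hu.integrable, fun s hs t ht hst => ?_⟩
  · rw [hE t ht.1]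
    refine (hu.stable t ht z').trans (add_le_add_left ?_ _)
    exact EReal.coe_le_coe_iff.2 (S.marginalEnergy_le ht.1 φ' z')
  · have hadd := augmentedVariation_add (u := u) (marginalEnergy E) (correction h d)
      hd.self_eq_zero hd.triangle hs.1 hst ht.2
    have hs_fin := hfin s hs
    have hst_fin : augmentedVariation T (marginalEnergy E) d (correction h d) u s t ≠ ⊤ :=
      ne_top_of_le_ne_top (hfin t ht) (le_add_self.trans hadd.le)
    have h1 := congrArg ENNReal.toReal hadd
    rw [ENNReal.toReal_add hs_fin hst_fin] at h1
    have h2 := intervalIntegral.integral_interval_sub_left (hint h0T ht) (hint h0T hs)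
    have h3 : ∫ r in s..t, P r (φ r, u r) = ∫ r in s..t, marginalPower E P r (u r) := by
      refine intervalIntegral.integral_congr fun r hr => ?_
      rw [uIcc_of_le hst] at hr
      exact hP r ⟨hs.1.trans hr.1, hr.2.trans ht.2⟩
    rw [hE t ht, hE s hs, h3, ← EReal.coe_ennreal_toReal hst_fin, ← EReal.coe_add]
    refine congrArg _ ?_
    linarith [hbal t ht, hbal s hs]

/-- The power of a selected solution is the marginal power at almost every time: the stability and
the balance bound the power of the selection from below, wherever its primitive and the variation
of the curve are differentiable. -/
theorem ae_power_eq [T2Space F] [T2Space Z] [FirstCountableTopology Z] [MeasurableSpace F]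
    (S : IsPreSystem T x₀ F₀ C_P (liftDist d) E P h) (hd : IsQuasiDistance d x₀.2)
    (hsep : Separates d) {φ : ℝ → F} (hu : IsSelectedSolution T E P d (correction h d) φ u)
    (hst : ∀ t ∈ Icc 0 T \ jumpSet T u,
      StableAt (marginalEnergy E) d (correction h d) t (u t)) :
    ∀ᵐ r, r ∈ Icc 0 T → P r (φ r, u r) = marginalPower E P r (u r) := by
  have R := S.marginal hd hsep
  have hT := S.T_pos
  have h0T : (0 : ℝ) ∈ Icc 0 T := ⟨le_rfl, hT.le⟩
  have hJ := hu.bv.countable_jumpSet hd.lsc hsep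
  have hI : IntervalIntegrable (fun r => P r (φ r, u r)) volume 0 T :=
    (intervalIntegrable_iff_integrableOn_Icc_of_le hT.le).2 hu.integrable
  have hint : ∀ {a b : ℝ}, a ∈ Icc 0 T → b ∈ Icc 0 T →
      IntervalIntegrable (fun r => P r (φ r, u r)) volume a b := fun ha hb =>
    hI.mono_set (by rw [uIcc_of_le hT.le]; exact uIcc_subset_Icc ha hb)
  filter_upwards [hI.ae_hasDerivAt_integral, hu.bv.monotone_variationFun.ae_differentiableAt,
    hJ.ae_notMem volume, (Set.toFinite {0, T}).countable.ae_notMem volume] with r h1 h2 h3 h4 hr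
  have hr' : r ∈ Ioo 0 T := by
    simp only [mem_insert_iff, mem_singleton_iff, not_or] at h4
    exact ⟨lt_of_le_of_ne hr.1 (Ne.symm h4.1), lt_of_le_of_ne hr.2 h4.2⟩
  refine le_antisymm (S.power_le_marginalPower hr (hu.minimizer r hr)) ?_
  rw [uIcc_of_le hT.le] at h1
  have hQ := h1 hr 0 h0T
  set V := variationFun T d u with hV
  set Q : ℝ → ℝ := fun s => ∫ a in (0 : ℝ)..s, P a (φ a, u a) with hQdef
  have hleft : 𝓝[<] r ≤ 𝓝[≠] r := nhdsWithin_mono _ fun s hs => ne_of_lt hs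
  have hQs := hQ.tendsto_slope.mono_left hleft
  have hVs := h2.hasDerivAt.tendsto_slope.mono_left hleft
  have hd0 : Tendsto (fun s => d (u s) (u r)) (𝓝[<] r) (𝓝 0) := by
    have := (hu.bv.regulated.left_lim r (Ioo_subset_Ioc_self hr')).2
    rwa [(limits_of_notMem_jumpSet hr h3).1] at this
  have key : ∀ ε > 0, marginalPower E P r (u r) - ε - ε * deriv V r ≤ P r (φ r, u r) := by
    intro ε hε
    have hlim : Tendsto (fun s => slope Q r s + ε * slope V r s) (𝓝[<] r)
        (𝓝 (P r (φ r, u r) + ε * deriv V r)) := hQs.add (hVs.const_mul ε)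
    have hfreq : ∃ᶠ s in 𝓝[<] r, s ∉ jumpSet T u := by
      have hdense : Dense (jumpSet T u)ᶜ := hJ.dense_compl ℝ
      intro hev
      obtain ⟨a, ha, hsub⟩ := mem_nhdsLT_iff_exists_Ioo_subset.1 hev
      obtain ⟨s, hs, hsJ⟩ := hdense.exists_between ha
      exact hsub hsJ hs
    have hge := ge_of_tendsto_of_frequently hlim
      (b := marginalPower E P r (u r) - ε) ((hfreq.and_eventually
        ((R.eventually_energy_le_of_stable hd0 hε).and
          ((R.eventually_left_quotient (Ioo_subset_Ioc_self hr') (u r)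
            (c := marginalPower E P r (u r) - ε) (by linarith)).and
          ((eventually_mem_Icc_left (Ioo_subset_Ioc_self hr')).and
            self_mem_nhdsWithin)))).mono ?_)
    · linarith
    rintro s ⟨hsJ, ⟨hdfin, hs1⟩, hs2, ⟨hs3, hs0⟩, hsr⟩
    have hsr : s < r := hsr
    have hs4 := hs1 (hst s ⟨hs3, hsJ⟩)
    have hs5 : (d (u s) (u r)).toReal ≤ V r - V s := by
      have := ENNReal.toReal_mono ENNReal.ofReal_ne_top (hu.bv.dist_le hs0.le hsr.le hr.2)
      rwa [ENNReal.toReal_ofReal (sub_nonneg.2 (hu.bv.monotone_variationFun hsr.le))] at this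
    -- the balance between `s` and `r`, with the augmented variation bounded below by the distance
    have hs6 : marginalEnergy E r (u r) + (d (u s) (u r)).toReal ≤
        marginalEnergy E s (u s) + (Q r - Q s) := by
      have hb := hu.balance s hs3 r hr hsr.le
      have hle : (d (u s) (u r) : EReal) ≤
          (augmentedVariation T (marginalEnergy E) d (correction h d) u s r : EReal) :=
        EReal.coe_ennreal_le_coe_ennreal_iff.2 ((dist_le_variation (left_mem_Icc.2 hsr.le)
          (right_mem_Icc.2 hsr.le) hsr.le).trans le_self_add)
      have h5 := (add_le_add_right hle (E r (φ r, u r) : EReal)).trans hb.le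
      rw [← EReal.coe_ennreal_toReal hdfin, ← EReal.coe_add, EReal.coe_le_coe_iff,
        (S.mem_minimizers_iff hr).1 (hu.minimizer r hr),
        (S.mem_minimizers_iff hs3).1 (hu.minimizer s hs3)] at h5
      have h6 : Q r - Q s = ∫ a in s..r, P a (φ a, u a) :=
        intervalIntegral.integral_interval_sub_left (hint h0T hr) (hint h0T hs3)
      rw [h6]
      exact h5
    have hs7 := mul_le_mul_of_nonneg_left hs5 hε.le
    have hpos : 0 < r - s := sub_pos.2 hsr
    have hs8 : slope Q r s + ε * slope V r s = ((Q r - Q s) + ε * (V r - V s)) / (r - s) := by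
      have : s - r ≠ 0 := by linarith
      rw [slope_def_field, slope_def_field]
      field_simp
      ring
    rw [hs8, le_div_iff₀ hpos]
    linarith
  have hlim : Tendsto (fun ε : ℝ => marginalPower E P r (u r) - ε - ε * deriv V r) (𝓝[>] 0)
      (𝓝 (marginalPower E P r (u r) - 0 - 0 * deriv V r)) := by
    refine Tendsto.mono_left ?_ nhdsWithin_le_nhds
    exact Continuous.tendsto (by fun_prop) 0
  have := le_of_tendsto hlim (eventually_nhdsWithin_of_forall fun ε hε => key ε hε)
  simpa using this

/-- Whatever the selected minimizers are, the balance forces their power to be the maximal one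
almost everywhere. -/
theorem isVESolution_of_isSelectedSolution [T2Space F] [T2Space Z] [FirstCountableTopology Z]
    [MeasurableSpace F] (S : IsPreSystem T x₀ F₀ C_P (liftDist d) E P h)
    (hd : IsQuasiDistance d x₀.2) (hsep : Separates d) {φ : ℝ → F}
    (hu : IsSelectedSolution T E P d (correction h d) φ u) :
    IsVESolution T (marginalEnergy E) (marginalPower E P) d (correction h d) u := by
  have h0T : (0 : ℝ) ∈ Icc 0 T := ⟨le_rfl, S.T_pos.le⟩
  have hE : ∀ t ∈ Icc 0 T, E t (φ t, u t) = marginalEnergy E t (u t) := fun t ht =>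
    (S.mem_minimizers_iff ht).1 (hu.minimizer t ht)
  have hstable : ∀ t ∈ Icc 0 T \ jumpSet T u, ∀ y, (marginalEnergy E t (u t) : EReal) ≤
      (marginalEnergy E t y : EReal) + ((d (u t) y + correction h d (u t) y : ℝ≥0∞) : EReal) := by
    intro t ht y
    obtain ⟨φ', hφ'⟩ := S.minimizers_nonempty ht.1 y
    rw [← hE t ht.1, ← (S.mem_minimizers_iff ht.1).1 hφ']
    exact hu.stable t ht φ' y
  have hae := S.ae_power_eq hd hsep hu fun t ht => stableAt_iff.2 (hstable t ht)
  refine ⟨hu.bv, hstable, hu.integrable.congr ((ae_restrict_iff' measurableSet_Icc).2 hae),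
    fun t ht => ?_⟩
  have h1 : ∫ r in (0 : ℝ)..t, marginalPower E P r (u r) = ∫ r in (0 : ℝ)..t, P r (φ r, u r) := by
    refine intervalIntegral.integral_congr_ae ?_
    filter_upwards [hae] with r hr hmem
    rw [uIoc_of_le ht.1] at hmem
    exact (hr ⟨hmem.1.le, hmem.2.trans ht.2⟩).symm
  rw [h1, ← hE t ht, ← hE 0 h0T]
  exact hu.balance 0 h0T t ht ht.1

end IsPreSystem

end VE

theorem theorem4p6 {F Z : Type*}
    [TopologicalSpace F] [T2Space F] [FirstCountableTopology F] [MeasurableSpace F] [BorelSpace F]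
    [TopologicalSpace Z] [T2Space Z] [FirstCountableTopology Z]
    (T : ℝ) (hT : 0 < T) (x₀ : F × Z)
    (d : Z → Z → ℝ≥0∞) (hd : VE.IsQuasiDistance d x₀.2) (hsep : VE.Separates d)
    (E P : ℝ → F × Z → ℝ) (F₀ C_P : ℝ) (hF₀ : 0 ≤ F₀) (hC_P : 0 < C_P)
    (hA1 : VE.LscCompact T x₀ F₀ (VE.liftDist d) E)
    (hA2 : VE.PowerControl T x₀ F₀ C_P (VE.liftDist d) E P)
    (h : ℝ≥0 → ℝ≥0) (h_mono : Monotone h) (h_cont : Continuous h)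
    (h_zero : Tendsto (fun r : ℝ≥0 => h r / r) (𝓝[>] 0) (𝓝 0)) :
    (∀ t ∈ Icc 0 T, ∀ z,
      IsLeast (range fun φ => E t (φ, z)) (VE.marginalEnergy E t z) ∧
      IsGreatest ((fun φ => P t (φ, z)) '' VE.minimizers E t z) (VE.marginalPower E P t z)) ∧
    (∀ z₀ : Z, ∃ z : ℝ → Z, z 0 = z₀ ∧
      VE.IsVESolution T (VE.marginalEnergy E) (VE.marginalPower E P) d (VE.correction h d) z) ∧
    (∀ z : ℝ → Z,
      VE.IsVESolution T (VE.marginalEnergy E) (VE.marginalPower E P) d (VE.correction h d) z ↔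
        ∃ φ : ℝ → F, VE.IsSelectedSolution T E P d (VE.correction h d) φ z) := by
  have S : VE.IsPreSystem T x₀ F₀ C_P (VE.liftDist d) E P h :=
    VE.IsPreSystem.of_powerControl hT hC_P (VE.liftDist_isQuasiDistance hd) hA1 hA2 h_mono h_cont
      h_zero
  refine ⟨fun t ht z => ⟨S.isLeast_marginalEnergy ht z, S.isGreatest_marginalPower ht z⟩,
    fun z₀ => (S.marginal hd hsep).exists_isVESolution z₀, fun z => ⟨fun hz =>
      S.isSelectedSolution_of_isVESolution hd hsep hz, ?_⟩⟩
  rintro ⟨φ, hφ⟩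
  exact S.isVESolution_of_isSelectedSolution hd hsep hφ
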